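/- Let $F$ be a free group of finite rank $n\ge 2$. For a free basis $\mathcal B$ of $F$, let $T_{\mathcal B}$ be the Cayley tree of $F$ with respect to $\mathcal B$, let $\partial T_{\mathcal B}$ be its boundary at infinity and let $\overline{T}_{\mathcal B}=T_{\mathcal B}\cup\partial T_{\mathcal B}$. Let $W\subset F\setminus\{1\}$ be a finite set. The line pattern $\mathcal L$ generated by $W$ consists of the lines in $T_{\mathcal B}$ with endpoints $gw^{\infty}=\lim_{m\to\infty} gw^{m}$ and $gw^{-\infty}=\lim_{m\to\infty} gw^{-m}$ in $\partial T_{\mathcal B}$, for $w\in W$ and $g\in F$; two such lines are the same if they have the same pair of endpoints. The decomposition space $\mathcal D$ is the quotient of $\partial T_{\mathcal B_0}$, for any fixed free basis $\mathcal B_0$ of $F$, obtained by identifying the two endpoints of each line of $\mathcal L$, with the quotient topology. For a free basis $\mathcal B$, the Whitehead graph $\mathrm{Wh}_{\mathcal B}(*)$ of $\mathcal L$ is the multigraph whose vertices are the $2n$ connected components of $\overline{T}_{\mathcal B}\setminus\{*\}$, where $*$ is the identity vertex, with one edge for each line of $\mathcal L$ whose endpoints lie in two different components, joining these two components. A vertex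 of a multigraph is a cut vertex if deleting it disconnects the connected component that contains it. A multigraph is a circle if it is a polygon, that is, a cycle through all its vertices which uses every edge exactly once. A cut set of a topological space $X$ is a subset $S\subset X$ such that $X\setminus S$ is disconnected; it is minimal if no proper subset of $S$ is a cut set of $X$. Then the following are equivalent: 1. For every free basis $\mathcal B$ of $F$, if $\mathrm{Wh}_{\mathcal B}(*)$ has no cut vertex, then it is a circle. 2. For some free basis $\mathcal B$ of $F$, the Whitehead graph $\mathrm{Wh}_{\mathcal B}(*)$ is a circle. 3. $\mathcal D$ is homeomorphic to the circle $S^1$. 4. Every minimal cut set of $\mathcal D$ has exactly two elements. -/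

import Mathlib

namespace Graph

/-- A vertex `v` of a multigraph is a cut vertex if deleting it (together with its incident edges)
disconnects the connected component containing it: some two other vertices that can be joined by a
path in `G` cannot be joined by a path in `G` with `v` deleted. -/
def IsCutVertex {α β : Type*} (G : Graph α β) (v : α) : Prop :=
  v ∈ G.vertexSet ∧ ∃ x ∈ G.vertexSet, ∃ y ∈ G.vertexSet, x ≠ v ∧ y ≠ v ∧
    Relation.ReflTransGen G.Adj x y ∧ ¬ Relation.ReflTransGen (G.deleteVerts {v}).Adj x y

/-- A multigraph is a circle if it is a polygon with `m ≥ 1` sides: its vertices and its edges can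
both be labelled bijectively by `ℤ/m` so that edge `i` joins vertex `i` to vertex `i + 1`. -/
def IsCircle {α β : Type*} (G : Graph α β) : Prop :=
  ∃ m : ℕ, 1 ≤ m ∧ ∃ (v : ZMod m ≃ G.vertexSet) (e : ZMod m ≃ G.edgeSet),
    ∀ i : ZMod m, G.IsLink (e i : β) (v i) (v (i + 1))

end Graph

section CutSets

/-- A cut set of a topological space is a subset whose complement is disconnected. -/
def IsCutSet {X : Type*} [TopologicalSpace X] (S : Set X) : Prop := ¬ IsPreconnected Sᶜ

/-- A minimal cut set is a cut set no proper subset of which is a cut set. -/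
def IsMinimalCutSet {X : Type*} [TopologicalSpace X] (S : Set X) : Prop :=
  IsCutSet S ∧ ∀ T : Set X, T ⊂ S → ¬ IsCutSet T

end CutSets

namespace LinePattern

/-- The boundary at infinity of the Cayley tree of a free group with respect to a free basis with
`n` elements. A point is a geodesic ray from the identity vertex, that is, an infinite reduced word
in the `2 * n` letters; the letter `(i, true)` is the `i`-th basis element and `(i, false)` is its
inverse. The topology is the subspace topology of the product of discrete spaces, for which the
shadows of the vertices (the sets of infinite words with a given finite prefix) are a basis. -/
abbrev Boundary (n : ℕ) : Type :=
  {ξ : ℕ → Fin n × Bool // ∀ k, ξ (k + 1) ≠ ((ξ k).1, !(ξ k).2)}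

variable {F : Type*} [Group F] {n : ℕ}

/-- The sequence of vertices `u m` of the Cayley tree for the basis `B` converges to the boundary
point `ξ`: for every `k`, the reduced word of `u m` begins with the first `k` letters of `ξ` as soon
as `m` is large enough. -/
def ConvergesTo (B : FreeGroupBasis (Fin n) F) (u : ℕ → F) (ξ : Boundary n) : Prop :=
  ∀ k : ℕ, ∀ᶠ m in Filter.atTop,
    List.ofFn (fun i : Fin k => ξ.1 i) <+: (B.repr (u m)).toWord

/-- The line pattern generated by `W`, drawn in the Cayley tree for the basis `B`. The `w`-line at
`g` is the geodesic with endpoints `lim g * w ^ m` and `lim g * w ^ (-m)`; a line is recorded as the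
unordered pair of its two endpoints, which determines it. -/
def lines (B : FreeGroupBasis (Fin n) F) (W : Set F) : Set (Sym2 (Boundary n)) :=
  {l | ∃ w ∈ W, ∃ g : F, ∃ ξ η : Boundary n, l = s(ξ, η) ∧
    ConvergesTo B (fun m => g * w ^ m) ξ ∧ ConvergesTo B (fun m => g * w⁻¹ ^ m) η}

/-- The decomposition space: the quotient of the boundary, with the quotient topology, in which the
two endpoints of each line of the pattern are identified. -/
abbrev DecompositionSpace (B : FreeGroupBasis (Fin n) F) (W : Set F) : Type :=
  Quot (fun ξ η : Boundary n => s(ξ, η) ∈ lines B W)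

/-- The Whitehead graph (at the identity vertex of the Cayley tree for `B`) of the line pattern
generated by `W`. Its vertices are the components of the complement of the identity vertex in the
compactified tree; they correspond to the `2 * n` letters, and a boundary point lies in the
component named by its first letter. It is a multigraph with one edge for each line of the pattern
whose endpoints lie in two different components, and this edge joins these components. -/
def whiteheadGraph (B : FreeGroupBasis (Fin n) F) (W : Set F) :
    Graph (Fin n × Bool) (Sym2 (Boundary n)) where
  vertexSet := Set.univ
  IsLink l x y := l ∈ lines B W ∧ x ≠ y ∧
    ∃ ξ η : Boundary n, l = s(ξ, η) ∧ ξ.1 0 = x ∧ η.1 0 = y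
  isLink_symm := by
    rintro l -
    refine ⟨?_⟩
    rintro x y ⟨hl, hxy, ξ, η, rfl, hx, hy⟩
    exact ⟨hl, hxy.symm, η, ξ, Sym2.eq_swap, hy, hx⟩
  eq_or_eq_of_isLink_of_isLink := by
    rintro l x y v w ⟨-, -, ξ, η, rfl, rfl, rfl⟩ ⟨-, -, ξ', η', h, rfl, rfl⟩
    rcases Sym2.eq_iff.1 h with ⟨rfl, rfl⟩ | ⟨rfl, rfl⟩
    · exact Or.inl rfl
    · exact Or.inr rfl
  left_mem_of_isLink := fun _ _ _ _ => Set.mem_univ _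

end LinePattern

/-! ### Infinite reduced words: the action of the free group, convergence, topology. -/

section

open Filter Topology

namespace LinePattern

variable {n : ℕ}

/-! An automorphism of a free group extends to a homeomorphism of the boundary that respects line
patterns (`nonempty_homeomorph`), so the decomposition space may be studied in whichever basis is
convenient. Lines are axes of conjugates of elements of `W`. A boundary point lies on at most one
line (`eq_of_mem_lineSet`), so points of the decomposition space have at most two preimages, and
only finitely many lines pass through a vertex (`finite_crossing`).

Condition 1 implies 2 by Whitehead's argument. Take a basis that minimises the total length of the
conjugacy classes of `W`. If deleting `x` separated a connected component of the graph, some part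
`C` joined to `x` would not contain the inverse of `x`, and the Whitehead automorphism given by `x`
and `C` would lengthen no class and shorten at least one (`exists_complexity_lt`). So there is no
cut vertex (`exists_forall_not_isCutVertex`).

Condition 2 implies 3 by an explicit coordinate. A circular Whitehead graph orders the `2 * n`
directions at a vertex cyclically. Exactly two lines cross each edge, one on either side, so the
orders at the two ends of an edge agree up to a sign. After its first letter, a ray makes one of `2
* n - 1` turns at each vertex, and the turns are the digits of a number in `[0, 1]`. A line always
turns to an extreme neighbour, so its ends are the two expansions `d (b-1) (b-1) …` and `(d+1) 0 0
…` of one number, preceded by common digits, or they meet where two adjacent arcs meet. Gluing the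
lines thus turns the `2 * n` Cantor sets into arcs and the arcs into a circle
(`nonempty_homeomorph_circle`).

Condition 3 implies 4 because two points separate a circle, whereas the empty set and single points
do not.

For the implication from 4 to 1, condition 4 says in particular that the space is connected and has
no cut points. A separation of the complement of a finite set is a two-colouring of boundary points
that is locally constant and respects lines. If there is no cut vertex, such a colouring is constant
on every shadow on which it is defined (`IsLineColoring.constOn`). It remains constant on one side
of an edge when the lines crossing the edge are removed: otherwise both colours accumulate at an end
of such a line, and the dynamics of its axis produce a colouring showing that this line is a cut
point (`exists_coloring_of_mixed`). Hence the lines crossing an edge form a minimal cut set, since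
any one of them joins the two sides. By condition 4 there are two of them, so all valences are two,
and a connected graph of valence two is a polygon (`isCircle_of_encard_cross`). -/

/-- The inverse of a letter. -/
def flip (y : Fin n × Bool) : Fin n × Bool := (y.1, !y.2)

@[simp] lemma flip_flip (y : Fin n × Bool) : flip (flip y) = y := by simp [flip]

lemma flip_ne (y : Fin n × Bool) : flip y ≠ y := by
  intro h
  have := congrArg Prod.snd h
  simp [flip] at this

/-- The element of the free group given by a letter. -/
def ltr (y : Fin n × Bool) : FreeGroup (Fin n) := FreeGroup.mk [y]

@[simp] lemma ltr_flip (y : Fin n × Bool) : ltr (flip y) = (ltr y)⁻¹ := by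
  simp [ltr, flip, FreeGroup.inv_mk, FreeGroup.invRev]

lemma Boundary.succ_ne (ξ : Boundary n) (k : ℕ) : ξ.1 (k + 1) ≠ flip (ξ.1 k) := ξ.2 k

/-- Deleting the first letter of an infinite word. -/
def tail (ξ : Boundary n) : Boundary n := ⟨fun k => ξ.1 (k + 1), fun k => ξ.2 (k + 1)⟩

/-- Adding a letter in front of an infinite word. -/
def cons (y : Fin n × Bool) (ξ : Boundary n) (h : ξ.1 0 ≠ flip y) : Boundary n :=
  ⟨fun k => Nat.casesOn k y ξ.1, fun k => by cases k with
    | zero => exact h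
    | succ k => exact ξ.2 k⟩

/-- The action of a letter on the boundary. -/
def letterAct (y : Fin n × Bool) (ξ : Boundary n) : Boundary n :=
  if h : ξ.1 0 = flip y then tail ξ else cons y ξ h

lemma letterAct_letterAct_flip (y : Fin n × Bool) (ξ : Boundary n) :
    letterAct (flip y) (letterAct y ξ) = ξ := by
  by_cases h : ξ.1 0 = flip y
  · have h1 : letterAct y ξ = tail ξ := dif_pos h
    have h2 : (tail ξ).1 0 ≠ flip (flip y) := by
      rw [← h]; exact ξ.succ_ne 0
    rw [h1, letterAct, dif_neg h2]
    apply Subtype.ext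
    funext k
    cases k with
    | zero => exact h.symm
    | succ k => rfl
  · have h1 : letterAct y ξ = cons y ξ h := dif_neg h
    have h2 : (cons y ξ h).1 0 = flip (flip y) := by
      rw [flip_flip]; rfl
    rw [h1, letterAct, dif_pos h2]
    rfl

/-- The action of a basis element as a permutation of the boundary. -/
def letterPerm (i : Fin n) : Equiv.Perm (Boundary n) where
  toFun := letterAct (i, true)
  invFun := letterAct (i, false)
  left_inv ξ := letterAct_letterAct_flip (i, true) ξ
  right_inv ξ := letterAct_letterAct_flip (i, false) ξ

instance : MulAction (FreeGroup (Fin n)) (Boundary n) :=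
  MulAction.compHom _ (FreeGroup.lift (letterPerm (n := n)))

lemma ltr_smul (y : Fin n × Bool) (ξ : Boundary n) : ltr y • ξ = letterAct y ξ := by
  change FreeGroup.lift letterPerm (FreeGroup.mk [y]) ξ = _
  obtain ⟨i, b⟩ := y
  cases b <;> simp [FreeGroup.lift_mk] <;> rfl

lemma ltr_smul_zero {y : Fin n × Bool} {ξ : Boundary n} (h : ξ.1 0 ≠ flip y) :
    (ltr y • ξ).1 0 = y := by
  rw [ltr_smul, letterAct, dif_neg h]; rfl

lemma ltr_smul_succ {y : Fin n × Bool} {ξ : Boundary n} (h : ξ.1 0 ≠ flip y) (k : ℕ) :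
    (ltr y • ξ).1 (k + 1) = ξ.1 k := by
  rw [ltr_smul, letterAct, dif_neg h]; rfl

lemma ltr_smul_eq_tail {y : Fin n × Bool} {ξ : Boundary n} (h : ξ.1 0 = flip y) :
    ltr y • ξ = tail ξ := by
  rw [ltr_smul, letterAct, dif_pos h]

lemma ltr_inv_smul_eq_tail (ξ : Boundary n) : (ltr (ξ.1 0))⁻¹ • ξ = tail ξ := by
  rw [← ltr_flip]; exact ltr_smul_eq_tail (by simp)

lemma ltr_smul_tail (ξ : Boundary n) : ltr (ξ.1 0) • tail ξ = ξ := by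
  rw [← ltr_inv_smul_eq_tail, smul_inv_smul]

lemma ltr_smul_zero_eq_iff {y : Fin n × Bool} {ξ : Boundary n} :
    (ltr y • ξ).1 0 = y ↔ ξ.1 0 ≠ flip y := by
  refine ⟨fun h h' => ?_, ltr_smul_zero⟩
  rw [ltr_smul_eq_tail h'] at h
  exact ξ.succ_ne 0 (by rw [h', flip_flip]; exact h)

lemma toWord_ltr_mul {y : Fin n × Bool} {g : FreeGroup (Fin n)}
    (h : g.toWord.head? ≠ some (flip y)) : (ltr y * g).toWord = y :: g.toWord := by
  rw [FreeGroup.toWord_mul, ltr, FreeGroup.toWord_mk, FreeGroup.reduce_singleton,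
    List.singleton_append, FreeGroup.reduce.cons, FreeGroup.reduce_toWord]
  cases hg : g.toWord with
  | nil => rfl
  | cons a L =>
    simp only
    rw [if_neg]
    rintro ⟨h1, h2⟩
    apply h
    rw [hg, List.head?_cons, Option.some_inj]
    ext
    · simp [flip, h1]
    · simp [flip, h2]

lemma toWord_ltr_mul_of_eq {y : Fin n × Bool} {g : FreeGroup (Fin n)} {L : List (Fin n × Bool)}
    (h : g.toWord = flip y :: L) : (ltr y * g).toWord = L := by
  rw [FreeGroup.toWord_mul, ltr, FreeGroup.toWord_mk, FreeGroup.reduce_singleton,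
    List.singleton_append, FreeGroup.reduce.cons, FreeGroup.reduce_toWord, h]
  simp [flip]

lemma toWord_mul_ltr {y : Fin n × Bool} {g : FreeGroup (Fin n)}
    (h : g.toWord.getLast? ≠ some (flip y)) : (g * ltr y).toWord = g.toWord ++ [y] := by
  have h1 : (ltr (flip y) * g⁻¹).toWord = flip y :: g⁻¹.toWord := by
    apply toWord_ltr_mul
    rw [FreeGroup.toWord_inv, flip_flip]
    intro h2
    apply h
    simp only [FreeGroup.invRev, List.head?_reverse, List.getLast?_map, Option.map_eq_some_iff]
      at h2
    obtain ⟨a, ha, h3⟩ := h2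
    rw [ha, ← h3]
    simp [flip]
  have h4 : (ltr (flip y) * g⁻¹)⁻¹ = g * ltr y := by simp
  rw [← h4, FreeGroup.toWord_inv, h1, FreeGroup.toWord_inv]
  simp [FreeGroup.invRev, flip]
  simp [Function.comp_def]

lemma toWord_mul_ltr_of_eq {y : Fin n × Bool} {g : FreeGroup (Fin n)} {L : List (Fin n × Bool)}
    (h : g.toWord = L ++ [flip y]) : (g * ltr y).toWord = L := by
  have h1 : (ltr (flip y) * g⁻¹).toWord = FreeGroup.invRev L := by
    apply toWord_ltr_mul_of_eq
    rw [FreeGroup.toWord_inv, h]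
    simp [FreeGroup.invRev, flip]
  have h4 : (ltr (flip y) * g⁻¹)⁻¹ = g * ltr y := by simp
  rw [← h4, FreeGroup.toWord_inv, h1, FreeGroup.invRev_invRev]

lemma mk_cons (y : Fin n × Bool) (L : List (Fin n × Bool)) :
    FreeGroup.mk (y :: L) = ltr y * FreeGroup.mk L := by
  simp [ltr, FreeGroup.mul_mk]

lemma head?_ne_of_isReduced {y : Fin n × Bool} {L : List (Fin n × Bool)}
    (h : FreeGroup.IsReduced (y :: L)) : L.head? ≠ some (flip y) := by
  cases L with
  | nil => simp
  | cons a L =>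
    rw [FreeGroup.IsReduced, List.isChain_cons_cons] at h
    intro h2
    rw [List.head?_cons, Option.some_inj] at h2
    subst h2
    have := h.1 rfl
    simp [flip] at this

/-- Induction on the reduced word of an element of a free group. -/
lemma reduced_induction {p : FreeGroup (Fin n) → Prop} (one : p 1)
    (mul : ∀ y g, g.toWord.head? ≠ some (flip y) → p g → p (ltr y * g))
    (g : FreeGroup (Fin n)) : p g := by
  have key : ∀ L : List (Fin n × Bool), FreeGroup.IsReduced L → p (FreeGroup.mk L) := by
    intro L
    induction L with
    | nil => intro _; exact one
    | cons y L ih =>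
      intro h
      rw [mk_cons]
      have hL : FreeGroup.IsReduced L := (List.isChain_cons.1 h).2
      refine mul y _ ?_ (ih hL)
      rw [FreeGroup.toWord_mk, hL.reduce_eq]
      exact head?_ne_of_isReduced h
  have := key g.toWord FreeGroup.isReduced_toWord
  rwa [FreeGroup.mk_toWord] at this

/-- The reduced word of `g` begins with the first `k` letters of `ξ`. -/
def Agree (k : ℕ) (g : FreeGroup (Fin n)) (ξ : Boundary n) : Prop :=
  ∀ i < k, g.toWord[i]? = some (ξ.1 i)

lemma Agree.mono {k k' : ℕ} {g : FreeGroup (Fin n)} {ξ : Boundary n} (h : Agree k g ξ)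
    (hk : k' ≤ k) : Agree k' g ξ := fun i hi => h i (by omega)

lemma Agree.le_norm {k : ℕ} {g : FreeGroup (Fin n)} {ξ : Boundary n} (h : Agree k g ξ) :
    k ≤ g.norm := by
  by_contra! hk
  have := h g.norm hk
  rw [List.getElem?_eq_none (by rfl)] at this
  simp at this

lemma agree_iff_prefix {k : ℕ} {g : FreeGroup (Fin n)} {ξ : Boundary n} :
    List.ofFn (fun i : Fin k => ξ.1 i) <+: g.toWord ↔ Agree k g ξ := by
  rw [List.prefix_iff_getElem?]
  simp only [List.length_ofFn, List.getElem_ofFn]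
  rfl

lemma Agree.ltr_mul {k : ℕ} {g : FreeGroup (Fin n)} {ξ : Boundary n} (h : Agree (k + 1) g ξ)
    (y : Fin n × Bool) : Agree k (ltr y * g) (ltr y • ξ) := by
  intro i hi
  by_cases hy : ξ.1 0 = flip y
  · obtain ⟨a, L, hL⟩ : ∃ a L, g.toWord = a :: L := by
      cases hL : g.toWord with
      | nil => have := h 0 (by omega); simp [hL] at this
      | cons a L => exact ⟨a, L, rfl⟩
    have h0 := h 0 (by omega)
    rw [hL] at h0
    simp at h0
    rw [h0, hy] at hL
    rw [toWord_ltr_mul_of_eq hL, ltr_smul_eq_tail hy]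
    have := h (i + 1) (by omega)
    rwa [hL, List.getElem?_cons_succ] at this
  · have h0 := h 0 (by omega)
    rw [toWord_ltr_mul]
    · cases i with
      | zero => simp [ltr_smul_zero hy]
      | succ i =>
        rw [ltr_smul_succ hy, List.getElem?_cons_succ]
        exact h i (by omega)
    · rw [List.head?_eq_getElem?, h0]
      simpa using hy

lemma Agree.mul_left (a : FreeGroup (Fin n)) {k : ℕ} {g : FreeGroup (Fin n)} {ξ : Boundary n}
    (h : Agree (k + a.norm) g ξ) : Agree k (a * g) (a • ξ) := by
  induction a using reduced_induction generalizing k with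
  | one => simpa using h
  | mul y a ha ih =>
    rw [mul_assoc, mul_smul]
    apply Agree.ltr_mul
    apply ih
    convert h using 1
    rw [FreeGroup.norm, FreeGroup.norm, toWord_ltr_mul ha, List.length_cons]
    omega

lemma getElem?_mul_ltr (g : FreeGroup (Fin n)) (y : Fin n × Bool) {i : ℕ} (hi : i + 1 < g.norm) :
    (g * ltr y).toWord[i]? = g.toWord[i]? := by
  rw [FreeGroup.norm] at hi
  by_cases h : g.toWord.getLast? = some (flip y)
  · obtain ⟨L, hL⟩ := List.getLast?_eq_some_iff.1 h
    rw [toWord_mul_ltr_of_eq hL, hL]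
    rw [hL] at hi
    simp at hi
    rw [List.getElem?_append_left hi]
  · rw [toWord_mul_ltr h, List.getElem?_append_left (by omega)]

lemma norm_ltr (y : Fin n × Bool) : (ltr y).norm = 1 := by
  rw [FreeGroup.norm, ltr, FreeGroup.toWord_mk, FreeGroup.reduce_singleton]; rfl

lemma norm_le_norm_mul_ltr (g : FreeGroup (Fin n)) (y : Fin n × Bool) :
    g.norm ≤ (g * ltr y).norm + 1 := by
  have := FreeGroup.norm_mul_le (g * ltr y) (ltr y)⁻¹
  rwa [mul_inv_cancel_right, FreeGroup.norm_inv_eq, norm_ltr] at this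

/-- Multiplying by `c` on the right can disturb only the last `c.norm` letters. Limits at infinity
are therefore insensitive to right multiplication. -/
lemma getElem?_mul_right (c : FreeGroup (Fin n)) (g : FreeGroup (Fin n)) {i : ℕ}
    (hi : i + c.norm < g.norm) : (g * c).toWord[i]? = g.toWord[i]? := by
  induction c using reduced_induction generalizing g with
  | one => simp
  | mul y c hc ih =>
    have h1 : (ltr y * c).norm = c.norm + 1 := by
      rw [FreeGroup.norm, FreeGroup.norm, toWord_ltr_mul hc, List.length_cons]
    have h2 := norm_le_norm_mul_ltr g y
    rw [← mul_assoc, ih _ (by omega), getElem?_mul_ltr _ _ (by omega)]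

lemma Agree.mul_right (c : FreeGroup (Fin n)) {k : ℕ} {g : FreeGroup (Fin n)} {ξ : Boundary n}
    (h : Agree (k + c.norm) g ξ) : Agree k (g * c) ξ := by
  intro i hi
  rw [getElem?_mul_right, h i (by omega)]
  have := h.le_norm
  omega

/-- Convergence of a sequence of vertices of the tree to a boundary point. -/
def Tends (u : ℕ → FreeGroup (Fin n)) (ξ : Boundary n) : Prop :=
  ∀ k, ∀ᶠ m in atTop, Agree k (u m) ξ

lemma convergesTo_iff {F : Type*} [Group F] (B : FreeGroupBasis (Fin n) F) (u : ℕ → F)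
    (ξ : Boundary n) : ConvergesTo B u ξ ↔ Tends (fun m => B.repr (u m)) ξ := by
  simp only [ConvergesTo, Tends, agree_iff_prefix]

lemma Tends.smul {u : ℕ → FreeGroup (Fin n)} {ξ : Boundary n} (h : Tends u ξ)
    (g : FreeGroup (Fin n)) : Tends (fun m => g * u m) (g • ξ) := fun k =>
  (h (k + g.norm)).mono fun _ hm => hm.mul_left g

lemma Tends.mul_right {u : ℕ → FreeGroup (Fin n)} {ξ : Boundary n} (h : Tends u ξ)
    (g : FreeGroup (Fin n)) : Tends (fun m => u m * g) ξ := fun k =>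
  (h (k + g.norm)).mono fun _ hm => hm.mul_right g

lemma Tends.comp {u : ℕ → FreeGroup (Fin n)} {ξ : Boundary n} (h : Tends u ξ)
    {f : ℕ → ℕ} (hf : Tendsto f atTop atTop) : Tends (fun m => u (f m)) ξ := fun k =>
  hf.eventually (h k)

lemma Tends.unique {u : ℕ → FreeGroup (Fin n)} {ξ η : Boundary n} (h : Tends u ξ)
    (h' : Tends u η) : ξ = η := by
  apply Subtype.ext
  funext k
  obtain ⟨m, hm, hm'⟩ := ((h (k + 1)).and (h' (k + 1))).exists
  have h1 := hm k (by omega)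
  rw [hm' k (by omega)] at h1
  exact (Option.some_inj.1 h1).symm

/-- The prefix of length `k` of an infinite word, as an element of the free group. -/
def pre (ξ : Boundary n) (k : ℕ) : FreeGroup (Fin n) :=
  FreeGroup.mk (List.ofFn fun i : Fin k => ξ.1 i)

@[simp] lemma pre_zero (ξ : Boundary n) : pre ξ 0 = 1 := by simp [pre]; rfl

lemma pre_succ' (ξ : Boundary n) (k : ℕ) : pre ξ (k + 1) = ltr (ξ.1 0) * pre (tail ξ) k := by
  rw [pre, List.ofFn_succ, mk_cons]; rfl

lemma pre_succ (ξ : Boundary n) (k : ℕ) : pre ξ (k + 1) = pre ξ k * ltr (ξ.1 k) := by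
  induction k generalizing ξ with
  | zero => simp [pre_succ']
  | succ k ih => rw [pre_succ', ih, ← mul_assoc, ← pre_succ']; rfl

lemma isReduced_ofFn (ξ : Boundary n) (k : ℕ) :
    FreeGroup.IsReduced (List.ofFn fun i : Fin k => ξ.1 i) := by
  rw [FreeGroup.IsReduced, List.isChain_iff_getElem]
  intro i hi h
  simp only [List.getElem_ofFn] at h ⊢
  by_contra h2
  apply ξ.succ_ne i
  refine Prod.ext h.symm ?_
  change (ξ.1 (i + 1)).2 = !(ξ.1 i).2
  revert h2
  cases (ξ.1 i).2 <;> cases (ξ.1 (i + 1)).2 <;> simp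

lemma toWord_pre (ξ : Boundary n) (k : ℕ) :
    (pre ξ k).toWord = List.ofFn fun i : Fin k => ξ.1 i := by
  rw [pre, FreeGroup.toWord_mk, (isReduced_ofFn ξ k).reduce_eq]

@[simp] lemma norm_pre (ξ : Boundary n) (k : ℕ) : (pre ξ k).norm = k := by
  rw [FreeGroup.norm, toWord_pre, List.length_ofFn]

lemma agree_pre (ξ : Boundary n) (k : ℕ) : Agree k (pre ξ k) ξ := by
  rw [← agree_iff_prefix, toWord_pre]

lemma tends_pre (ξ : Boundary n) : Tends (pre ξ) ξ := fun k => by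
  filter_upwards [eventually_ge_atTop k] with m hm
  exact (agree_pre ξ m).mono hm

lemma pre_inv_smul (ξ : Boundary n) (k i : ℕ) : ((pre ξ k)⁻¹ • ξ).1 i = ξ.1 (k + i) := by
  induction k generalizing ξ with
  | zero => simp
  | succ k ih =>
    rw [pre_succ', mul_inv_rev, mul_smul, ltr_inv_smul_eq_tail, ih]
    simp [tail, add_right_comm]

/-- Cylinders are translates of the sets cut out by a first letter, so statements about the identity
vertex can be moved to any edge of the tree. -/
lemma pre_inv_smul_zero_iff (ξ η : Boundary n) (k : ℕ) :
    ((pre ξ k)⁻¹ • η).1 0 = ξ.1 k ↔ ∀ i ≤ k, η.1 i = ξ.1 i := by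
  induction k generalizing ξ η with
  | zero => simp
  | succ k ih =>
    rw [pre_succ', mul_inv_rev, mul_smul]
    have h1 := ih (tail ξ) ((ltr (ξ.1 0))⁻¹ • η)
    rw [show (tail ξ).1 k = ξ.1 (k + 1) from rfl] at h1
    rw [h1]
    by_cases h : η.1 0 = ξ.1 0
    · rw [← h, ltr_inv_smul_eq_tail]
      constructor
      · intro h2 i hi
        cases i with
        | zero => exact h
        | succ i => exact h2 i (by omega)
      · intro h2 i hi
        exact h2 (i + 1) (by omega)
    · constructor
      · intro h2
        have h3 := h2 0 (by omega)
        rw [← ltr_flip, ltr_smul_zero (by simpa using h)] at h3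
        exact absurd h3.symm (ξ.succ_ne 0)
      · intro h2
        exact absurd (h2 0 (by omega)) h

lemma smul_append (g : FreeGroup (Fin n)) (η : Boundary n)
    (h : g.toWord.getLast? ≠ some (flip (η.1 0))) : Agree g.norm g (g • η) ∧
      ∀ i, (g • η).1 (g.norm + i) = η.1 i := by
  induction g using reduced_induction with
  | one => exact ⟨fun i hi => by simp at hi, fun i => by simp⟩
  | mul y g hg ih =>
    have hw := toWord_ltr_mul hg
    have hn : (ltr y * g).norm = g.norm + 1 := by
      rw [FreeGroup.norm, FreeGroup.norm, hw, List.length_cons]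
    have h2 : (g • η).1 0 ≠ flip y ∧ (Agree g.norm g (g • η) ∧
      ∀ i, (g • η).1 (g.norm + i) = η.1 i) := by
      cases hL : g.toWord with
      | nil =>
        rw [hw, hL] at h
        rw [FreeGroup.toWord_eq_nil_iff] at hL
        subst hL
        refine ⟨fun h3 => ?_, fun i hi => by simp at hi, fun i => by simp⟩
        rw [one_smul] at h3
        simp [h3] at h
      | cons a L =>
        rw [hw, hL, List.getLast?_cons_cons, ← hL] at h
        refine ⟨fun h3 => ?_, ih h⟩
        have := (ih h).1 0 (by rw [FreeGroup.norm, hL]; simp)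
        rw [h3, ← List.head?_eq_getElem?] at this
        exact hg this
    obtain ⟨h2, h3, h4⟩ := h2
    rw [hn, mul_smul]
    constructor
    · intro i hi
      rw [hw]
      cases i with
      | zero => simp [ltr_smul_zero h2]
      | succ i => rw [ltr_smul_succ h2, List.getElem?_cons_succ]; exact h3 i (by omega)
    · intro i
      rw [add_right_comm, ltr_smul_succ h2, h4]

/-- If `ξ` leaves the word of `g⁻¹` within its first `k` letters, at most `k - 1` letters of `g`
cancel against `ξ`, and the others begin `g • ξ`. This is the quantitative form of the dynamics on
the boundary. -/
lemma agree_smul_of_not_agree (g : FreeGroup (Fin n)) (ξ : Boundary n) (k : ℕ) (hk : k ≤ g.norm)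
    (h : ¬ Agree k g⁻¹ ξ) : Agree (g.norm + 1 - k) g (g • ξ) := by
  induction g using reduced_induction generalizing k with
  | one =>
    exfalso
    apply h
    intro i hi
    simp at hk
    omega
  | mul y g hg ih =>
    have hw := toWord_ltr_mul hg
    have hn : (ltr y * g).norm = g.norm + 1 := by
      rw [FreeGroup.norm, FreeGroup.norm, hw, List.length_cons]
    have hni : g⁻¹.norm = g.norm := FreeGroup.norm_inv_eq
    have hlast : g⁻¹.toWord.getLast? ≠ some y := by
      rw [FreeGroup.toWord_inv]
      intro h2
      apply hg
      simp only [FreeGroup.invRev, List.getLast?_reverse, List.head?_map, Option.map_eq_some_iff]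
        at h2
      obtain ⟨a, ha, h3⟩ := h2
      rw [ha, ← h3]
      simp [flip]
    have hwi : ((ltr y * g)⁻¹).toWord = g⁻¹.toWord ++ [flip y] := by
      rw [mul_inv_rev, ← ltr_flip]
      exact toWord_mul_ltr (by simpa using hlast)
    have step : ∀ j, (g • ξ).1 0 ≠ flip y → Agree j g (g • ξ) →
        Agree (j + 1) (ltr y * g) ((ltr y * g) • ξ) := by
      intro j h2 h3 i hi
      rw [hw, mul_smul]
      cases i with
      | zero => simp [ltr_smul_zero h2]
      | succ i => rw [ltr_smul_succ h2, List.getElem?_cons_succ]; exact h3 i (by omega)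
    rw [hn] at hk ⊢
    by_cases hk2 : k ≤ g.norm
    · have h5 : ¬ Agree k g⁻¹ ξ := by
        intro h6
        apply h
        intro i hi
        rw [hwi, List.getElem?_append_left]
        · exact h6 i hi
        · have : g⁻¹.toWord.length = g.norm := hni
          omega
      have h7 := ih k hk2 h5
      have h8 : (g • ξ).1 0 ≠ flip y := by
        intro h9
        apply hg
        rw [List.head?_eq_getElem?, h7 0 (by omega), h9]
      have := step _ h8 h7
      convert this using 1
      omega
    -- Here `k` is the full length, so only the letter `y` has to survive. If it cancelled, `ξ`
    -- would begin with the whole word of `(ltr y * g)⁻¹`.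
    · have h8 : (g • ξ).1 0 ≠ flip y := by
        intro h9
        apply h
        have h10 := smul_append g⁻¹ (g • ξ) (by rw [h9, flip_flip]; exact hlast)
        rw [inv_smul_smul, hni] at h10
        intro i hi
        rw [hwi]
        have hlen : g⁻¹.toWord.length = g.norm := hni
        by_cases hi2 : i < g.norm
        · rw [List.getElem?_append_left (by omega)]
          exact h10.1 i hi2
        · rw [List.getElem?_append_right (by omega)]
          have := h10.2 0
          have e : i = g.norm + 0 := by omega
          rw [e, this, h9, hlen]
          simp
      have := step 0 h8 (fun i hi => by omega)
      convert this using 1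
      omega

/-- The boundary points that begin with the first `k` letters of `ξ`. -/
def cyl (ξ : Boundary n) (k : ℕ) : Set (Boundary n) := {η | ∀ i < k, η.1 i = ξ.1 i}

lemma continuous_letter (k : ℕ) : Continuous fun ξ : Boundary n => ξ.1 k :=
  (continuous_apply k).comp continuous_subtype_val

lemma isClopen_cyl (ξ : Boundary n) (k : ℕ) : IsClopen (cyl ξ k) := by
  have : cyl ξ k = ⋂ i ∈ Finset.range k, {η : Boundary n | η.1 i = ξ.1 i} := by
    ext η; simp [cyl]
  rw [this]
  apply isClopen_biInter_finset
  intro i _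
  exact (isClopen_discrete {ξ.1 i}).preimage (continuous_letter i)

lemma mem_cyl_self (ξ : Boundary n) (k : ℕ) : ξ ∈ cyl ξ k := fun _ _ => rfl

lemma exists_cyl_subset {ξ : Boundary n} {N : Set (Boundary n)} (h : N ∈ 𝓝 ξ) :
    ∃ k, cyl ξ k ⊆ N := by
  obtain ⟨t, ht, htN⟩ := (mem_nhds_induced _ _ _).1 h
  rw [nhds_pi, Filter.mem_pi] at ht
  obtain ⟨I, hI, t', ht', hsub⟩ := ht
  obtain ⟨K, hK⟩ := hI.bddAbove
  refine ⟨K + 1, fun η hη => htN (hsub ?_)⟩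
  intro i hi
  rw [hη i (by have := hK hi; omega)]
  exact mem_of_mem_nhds (ht' i)

lemma cyl_mem_nhds (ξ : Boundary n) (k : ℕ) : cyl ξ k ∈ 𝓝 ξ :=
  (isClopen_cyl ξ k).isOpen.mem_nhds (mem_cyl_self ξ k)

instance : ContinuousConstSMul (FreeGroup (Fin n)) (Boundary n) where
  continuous_const_smul g := by
    induction g using reduced_induction with
    | one => simpa using continuous_id'
    | mul y g _ ih =>
      simp only [mul_smul]
      refine Continuous.comp (g := fun ξ => ltr y • ξ) ?_ ih
      refine continuous_induced_rng.2 (continuous_pi fun k => ?_)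
      -- Each letter of the image depends on three letters of `ξ` only. For `k = 0` the truncated `k
      -- - 1` is harmless, since that entry is not used.
      have : (fun ξ : Boundary n => (ltr y • ξ).1 k) =
          (fun t : (Fin n × Bool) × (Fin n × Bool) × (Fin n × Bool) =>
            if t.1 = flip y then t.2.2 else if k = 0 then y else t.2.1) ∘
          fun ξ : Boundary n => (ξ.1 0, ξ.1 (k - 1), ξ.1 (k + 1)) := by
        funext ξ
        by_cases h : ξ.1 0 = flip y
        · simp [h, ltr_smul_eq_tail, tail]
        · cases k with
          | zero => simp [h, ltr_smul_zero]
          | succ k => simp [h, ltr_smul_succ]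
      change Continuous fun ξ : Boundary n => (ltr y • ξ).1 k
      rw [this]
      exact continuous_of_discreteTopology.comp
        ((continuous_letter 0).prodMk ((continuous_letter _).prodMk (continuous_letter _)))

instance : CompactSpace (Boundary n) := by
  apply isCompact_iff_compactSpace.1
  apply IsClosed.isCompact
  change IsClosed {ξ : ℕ → Fin n × Bool | ∀ k, ξ (k + 1) ≠ ((ξ k).1, !(ξ k).2)}
  have : {ξ : ℕ → Fin n × Bool | ∀ k, ξ (k + 1) ≠ ((ξ k).1, !(ξ k).2)} =
      ⋂ k, (fun ξ : ℕ → Fin n × Bool => (ξ (k + 1), ξ k)) ⁻¹'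
        {t | t.1 ≠ (t.2.1, !t.2.2)} := by
    ext; simp
  rw [this]
  exact isClosed_iInter fun k => (isClosed_discrete _).preimage
    ((continuous_apply _).prodMk (continuous_apply _))

end LinePattern

end

/-! ### Axes and lines. -/

section

open Filter Topology

namespace LinePattern

variable {n : ℕ}

lemma exists_tends {u : ℕ → FreeGroup (Fin n)}
    (h : ∀ k : ℕ, ∃ y : Fin n × Bool, ∀ᶠ m in atTop, (u m).toWord[k]? = some y) : ∃ ξ, Tends u ξ := by
  choose y hy using h
  refine ⟨⟨y, fun k hk => ?_⟩, fun k => ?_⟩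
  · obtain ⟨m, h1, h2⟩ := ((hy k).and (hy (k + 1))).exists
    have hred : FreeGroup.IsReduced (u m).toWord := FreeGroup.isReduced_toWord
    rw [FreeGroup.IsReduced, List.isChain_iff_getElem] at hred
    obtain ⟨l1, e1⟩ := List.getElem?_eq_some_iff.1 h1
    obtain ⟨l2, e2⟩ := List.getElem?_eq_some_iff.1 h2
    have := hred k l2
    rw [e1, e2, hk] at this
    simp at this
  · exact (Set.finite_lt_nat k).eventually_all.2 fun i _ => hy i

/-- `ξ` and `η` are the attracting and the repelling fixed points of `u`. -/
def IsAxis (u : FreeGroup (Fin n)) (ξ η : Boundary n) : Prop :=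
  u ≠ 1 ∧ Tends (fun m => u ^ m) ξ ∧ Tends (fun m => u⁻¹ ^ m) η

lemma IsAxis.symm {u : FreeGroup (Fin n)} {ξ η : Boundary n} (h : IsAxis u ξ η) :
    IsAxis u⁻¹ η ξ := ⟨inv_ne_one.2 h.1, h.2.2, by simpa using h.2.1⟩

/-- The line pattern generated by a subset of the standard free group. -/
def lineSet (W : Set (FreeGroup (Fin n))) : Set (Sym2 (Boundary n)) :=
  {l | ∃ w ∈ W, ∃ g : FreeGroup (Fin n), ∃ ξ η : Boundary n, l = s(ξ, η) ∧
    Tends (fun m => g * w ^ m) ξ ∧ Tends (fun m => g * w⁻¹ ^ m) η}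

lemma lines_eq {F : Type*} [Group F] (B : FreeGroupBasis (Fin n) F) (W : Set F) :
    lines B W = lineSet (B.repr '' W) := by
  ext l
  simp only [lines, lineSet, convergesTo_iff, Set.mem_ofPred_eq, Set.exists_mem_image]
  refine exists_congr fun w => and_congr_right fun _ => ?_
  constructor
  · rintro ⟨g, ξ, η, h⟩
    exact ⟨B.repr g, ξ, η, by simpa using h⟩
  · rintro ⟨g, ξ, η, h⟩
    exact ⟨B.repr.symm g, ξ, η, by simpa using h⟩

lemma smul_mem_lineSet {W : Set (FreeGroup (Fin n))} {ξ η : Boundary n}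
    (h : s(ξ, η) ∈ lineSet W) (g : FreeGroup (Fin n)) : s(g • ξ, g • η) ∈ lineSet W := by
  obtain ⟨w, hw, a, ξ', η', he, h1, h2⟩ := h
  have key : s(g • ξ', g • η') ∈ lineSet W :=
    ⟨w, hw, g * a, _, _, rfl, by simpa only [mul_assoc] using h1.smul g,
      by simpa only [mul_assoc] using h2.smul g⟩
  rcases Sym2.eq_iff.1 he with ⟨rfl, rfl⟩ | ⟨rfl, rfl⟩
  · exact key
  · rwa [Sym2.eq_swap]

/-- The `w`-line at `g` is the axis of `g * w * g⁻¹`, because right multiplication by `g⁻¹` does not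
move limits. The inverse occurs since a line carries no orientation. -/
lemma exists_isAxis {W : Set (FreeGroup (Fin n))} (hW : 1 ∉ W) {ξ η : Boundary n}
    (h : s(ξ, η) ∈ lineSet W) : ∃ u, IsAxis u ξ η ∧ ∃ w ∈ W, ∃ g, u = g * w * g⁻¹ ∨
      u⁻¹ = g * w * g⁻¹ := by
  obtain ⟨w, hw, a, ξ', η', he, h1, h2⟩ := h
  have key : IsAxis (a * w * a⁻¹) ξ' η' := by
    refine ⟨fun h3 => hW ?_, ?_, ?_⟩
    · rw [conj_eq_one_iff] at h3
      rwa [← h3]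
    · simpa only [conj_pow] using h1.mul_right a⁻¹
    · have := h2.mul_right a⁻¹
      rw [conj_inv]
      simpa only [conj_pow] using this
  rcases Sym2.eq_iff.1 he with ⟨rfl, rfl⟩ | ⟨rfl, rfl⟩
  · exact ⟨_, key, w, hw, a, Or.inl rfl⟩
  · exact ⟨_, key.symm, w, hw, a, Or.inr (inv_inv _)⟩

lemma mem_lineSet_of_isAxis {W : Set (FreeGroup (Fin n))} {ξ η : Boundary n}
    {u w g : FreeGroup (Fin n)} (h : IsAxis u ξ η) (hw : w ∈ W) (hu : u = g * w * g⁻¹) :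
    s(ξ, η) ∈ lineSet W := by
  refine ⟨w, hw, g, ξ, η, rfl, ?_, ?_⟩
  · have := h.2.1.mul_right g
    simpa only [hu, conj_pow, inv_mul_cancel_right] using this
  · have := h.2.2.mul_right g
    simpa only [hu, conj_inv, conj_pow, inv_mul_cancel_right] using this

/-- Conjugating `u` to its cyclically reduced core `v` makes all powers visible. The exponent is `m
+ 1` because for exponent zero the word `c c⁻¹` is not reduced. -/
lemma isAxis_toWord {u : FreeGroup (Fin n)} (hu : u ≠ 1) :
    ∃ c v : List (Fin n × Bool), v ≠ [] ∧ FreeGroup.IsCyclicallyReduced v ∧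
      ∀ m, (u ^ (m + 1)).toWord = c ++ (List.replicate (m + 1) v).flatten ++
        FreeGroup.invRev c := by
  have hr : FreeGroup.IsReduced u.toWord := FreeGroup.isReduced_toWord
  refine ⟨FreeGroup.reduceCyclically.conjugator u.toWord, FreeGroup.reduceCyclically u.toWord,
    ?_, FreeGroup.reduceCyclically.isCyclicallyReduced hr, fun m => ?_⟩
  · intro h
    apply hu
    have h2 := FreeGroup.reduceCyclically.conj_conjugator_reduceCyclically u.toWord
    rw [h, List.append_nil] at h2
    have h3 := congrArg FreeGroup.mk h2
    rw [← FreeGroup.mul_mk, ← FreeGroup.inv_mk, mul_inv_cancel, FreeGroup.mk_toWord] at h3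
    exact h3.symm
  · rw [FreeGroup.toWord_pow, FreeGroup.reduceCyclically.reduce_flatten_replicate_succ hr]

/-- The word `c` leads from the identity vertex to the axis. There the two ends part, one along `v`
and the other along the inverse of `v`. -/
lemma isAxis_letters {u : FreeGroup (Fin n)} {ξ η : Boundary n} (h : IsAxis u ξ η) :
    ∃ c v : List (Fin n × Bool), FreeGroup.IsCyclicallyReduced v ∧
      u.toWord = c ++ v ++ FreeGroup.invRev c ∧ (∀ i < c.length, ξ.1 i = η.1 i) ∧
      v.head? = some (ξ.1 c.length) ∧ v.getLast? = some (flip (η.1 c.length)) := by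
  obtain ⟨c, v, hv, hvc, hw⟩ := isAxis_toWord h.1
  refine ⟨c, v, hvc, by simpa using hw 0, ?_⟩
  obtain ⟨m, ⟨h1, h2⟩, hm⟩ := (((h.2.1 (c.length + 1)).and (h.2.2 (c.length + 1))).and
    (eventually_ge_atTop 1)).exists
  obtain ⟨m, rfl⟩ : ∃ k, m = k + 1 := ⟨m - 1, by omega⟩
  have hw1 := hw m
  have hw2 : (u⁻¹ ^ (m + 1)).toWord = c ++ FreeGroup.invRev (List.replicate (m + 1) v).flatten ++
        FreeGroup.invRev c := by
    rw [inv_pow, FreeGroup.toWord_inv, hw1]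
    simp [FreeGroup.invRev_append]
  refine ⟨fun i hi => ?_, ?_, ?_⟩
  · have e1 := h1 i (by omega)
    have e2 := h2 i (by omega)
    rw [hw1, List.append_assoc, List.getElem?_append_left hi] at e1
    rw [hw2, List.append_assoc, List.getElem?_append_left hi] at e2
    rw [e1] at e2
    exact Option.some_inj.1 e2
  · have e1 := h1 c.length (by omega)
    obtain ⟨a, L, rfl⟩ := List.exists_cons_of_ne_nil hv
    rw [hw1, List.append_assoc, List.getElem?_append_right le_rfl] at e1
    simpa [List.replicate_succ] using e1
  · have e2 := h2 c.length (by omega)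
    rcases List.eq_nil_or_concat v with hv' | ⟨L, a, rfl⟩
    · exact absurd hv' hv
    rw [hw2, List.append_assoc, List.getElem?_append_right le_rfl] at e2
    simp [List.replicate_succ', FreeGroup.invRev] at e2
    simp [← e2, flip]

lemma IsAxis.ne {u : FreeGroup (Fin n)} {ξ η : Boundary n} (h : IsAxis u ξ η) : ξ ≠ η := by
  rintro rfl
  obtain ⟨c, v, hv, -, -, h1, h2⟩ := isAxis_letters h
  have := hv.2 _ h2 _ h1
  simp [flip] at this

lemma IsAxis.smul_left {u : FreeGroup (Fin n)} {ξ η : Boundary n} (h : IsAxis u ξ η) :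
    u • ξ = ξ := by
  have h1 := h.2.1.smul u
  have h2 : Tends (fun m => u * u ^ m) ξ := by
    simpa only [← pow_succ'] using h.2.1.comp (tendsto_add_atTop_nat 1)
  exact h1.unique h2

/-- An isometry of the tree maps a ray to a ray, and two rays with the same end coincide from some
vertex on, up to a shift. -/
lemma exists_mul_pre (u : FreeGroup (Fin n)) (ξ : Boundary n) :
    ∃ K K' : ℕ, ∀ k, u * pre ξ (K + k) = pre (u • ξ) (K' + k) := by
  induction u using reduced_induction with
  | one => exact ⟨0, 0, fun k => by simp⟩
  | mul y g _ ih =>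
    obtain ⟨K, K', h⟩ := ih
    have h2 : ∃ a b : ℕ, ∀ k, ltr y * pre (g • ξ) (a + k) = pre (ltr y • g • ξ) (b + k) := by
      by_cases hy : (g • ξ).1 0 = flip y
      · refine ⟨1, 0, fun k => ?_⟩
        rw [ltr_smul_eq_tail hy, add_comm 1 k, pre_succ', hy]
        simp
      · refine ⟨0, 1, fun k => ?_⟩
        rw [add_comm 1 k, pre_succ', ltr_smul_zero hy, zero_add]
        congr 2
        apply Subtype.ext
        funext i
        exact (ltr_smul_succ hy i).symm
    obtain ⟨a, b, h2⟩ := h2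
    refine ⟨K + a, b + K', fun k => ?_⟩
    rw [mul_assoc, add_assoc, h, mul_smul, ← add_assoc, add_comm K' a, add_assoc, h2, add_assoc]

lemma pow_mul_pre {u : FreeGroup (Fin n)} {ξ : Boundary n} {K d : ℕ}
    (h : ∀ k, u * pre ξ (K + k) = pre ξ (K + k + d)) (m : ℕ) :
    u ^ m * pre ξ K = pre ξ (K + m * d) := by
  induction m with
  | zero => simp
  | succ m ih => rw [pow_succ', mul_assoc, ih, h]; congr 1; ring

lemma tends_pow_of_mul_pre {u : FreeGroup (Fin n)} {ξ : Boundary n} {K d : ℕ} (hd : 0 < d)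
    (h : ∀ k, u * pre ξ (K + k) = pre ξ (K + k + d)) : Tends (fun m => u ^ m) ξ := by
  have h1 : Tends (fun m => u ^ m * pre ξ K) ξ := by
    simp only [pow_mul_pre h]
    apply (tends_pre ξ).comp
    refine tendsto_atTop_mono (fun m => ?_) tendsto_id
    have : m * 1 ≤ m * d := Nat.mul_le_mul_left m hd
    simp only [id]
    omega
  simpa using h1.mul_right (pre ξ K)⁻¹

/-- Since `u` fixes `ξ`, it shifts the ray to `ξ` eventually. Shift zero would give `u = 1`, and a
shift backwards would make `ξ` attracting for `u⁻¹`, hence equal to `η`. -/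
lemma IsAxis.exists_translation {u : FreeGroup (Fin n)} {ξ η : Boundary n} (h : IsAxis u ξ η) :
    ∃ K d : ℕ, 0 < d ∧ ∀ k, u * pre ξ (K + k) = pre ξ (K + k + d) := by
  obtain ⟨K, K', hK⟩ := exists_mul_pre u ξ
  rw [h.smul_left] at hK
  rcases lt_trichotomy K K' with hlt | rfl | hlt
  · refine ⟨K, K' - K, by omega, fun k => ?_⟩
    rw [hK]
    congr 1
    omega
  · exact absurd (mul_eq_right.1 (hK 0)) h.1
  · exfalso
    apply h.ne
    refine Tends.unique (tends_pow_of_mul_pre (K := K') (d := K - K') (by omega) fun k => ?_)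
      h.2.2
    rw [inv_mul_eq_iff_eq_mul, ← hK]
    congr 2
    omega

/-- If `u` and `v` shift the ray to `ξ` by `d` and `d'`, then `u ^ d'` and `v ^ d` shift it equally
and are therefore equal. A common power has a single repelling point. -/
lemma IsAxis.unique_right {u v : FreeGroup (Fin n)} {ξ η η' : Boundary n} (h : IsAxis u ξ η)
    (h' : IsAxis v ξ η') : η = η' := by
  obtain ⟨K, d, hd, hK⟩ := h.exists_translation
  obtain ⟨K', d', hd', hK'⟩ := h'.exists_translation
  have e1 := pow_mul_pre (u := u) (ξ := ξ) (K := K + K') (d := d)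
    (fun k => by rw [add_assoc, hK]) d'
  have e2 := pow_mul_pre (u := v) (ξ := ξ) (K := K + K') (d := d')
    (fun k => by rw [show K + K' + k = K' + (K + k) by ring, hK']) d
  rw [mul_comm d d', ← e1] at e2
  have e3 : u ^ d' = v ^ d := (mul_right_cancel e2).symm
  have t : ∀ {a : ℕ}, 0 < a → Tendsto (fun m : ℕ => a * m) atTop atTop := fun ha =>
    tendsto_id.const_mul_atTop' ha
  have h1 := h.2.2.comp (t hd')
  have h2 := h'.2.2.comp (t hd)
  simp only [pow_mul, inv_pow, e3] at h1 h2
  exact h1.unique h2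

lemma ne_of_mem_lineSet {W : Set (FreeGroup (Fin n))} (hW : 1 ∉ W) {ξ η : Boundary n}
    (h : s(ξ, η) ∈ lineSet W) : ξ ≠ η := by
  obtain ⟨u, hu, -⟩ := exists_isAxis hW h
  exact hu.ne

lemma eq_of_mem_lineSet {W : Set (FreeGroup (Fin n))} (hW : 1 ∉ W) {ξ η η' : Boundary n}
    (h : s(ξ, η) ∈ lineSet W) (h' : s(ξ, η') ∈ lineSet W) : η = η' := by
  obtain ⟨u, hu, -⟩ := exists_isAxis hW h
  obtain ⟨v, hv, -⟩ := exists_isAxis hW h'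
  exact hu.unique_right hv

lemma norm_pow_le (u : FreeGroup (Fin n)) (m : ℕ) : (u ^ m).norm ≤ m * u.norm := by
  induction m with
  | zero => simp
  | succ m ih =>
    rw [pow_succ, add_mul, one_mul]
    exact (FreeGroup.norm_mul_le _ _).trans (by omega)

lemma norm_pow_of_isCyclicallyReduced {u : FreeGroup (Fin n)}
    (h : FreeGroup.IsCyclicallyReduced u.toWord) (m : ℕ) : (u ^ m).norm = m * u.norm := by
  rw [FreeGroup.norm, FreeGroup.toWord_pow, (h.flatten_replicate m).isReduced.reduce_eq]
  simp [FreeGroup.norm]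

lemma norm_le_norm_conj {u : FreeGroup (Fin n)} (h : FreeGroup.IsCyclicallyReduced u.toWord)
    (g : FreeGroup (Fin n)) : u.norm ≤ (g * u * g⁻¹).norm := by
  by_contra! hlt
  set v := g * u * g⁻¹ with hv
  -- Lengths of powers of `u` grow exactly linearly, and conjugation costs at most `2 * g.norm`. At
  -- this exponent a saving of one letter per factor exceeds that cost.
  set m := 2 * g.norm + 1
  have h1 : u ^ m = g⁻¹ * v ^ m * g := by rw [hv, conj_pow]; group
  have h2 : (u ^ m).norm ≤ g.norm + m * v.norm + g.norm := by
    rw [h1]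
    refine (FreeGroup.norm_mul_le _ _).trans ?_
    have := FreeGroup.norm_mul_le g⁻¹ (v ^ m)
    rw [FreeGroup.norm_inv_eq] at this
    have := norm_pow_le v m
    omega
  rw [norm_pow_of_isCyclicallyReduced h] at h2
  have h3 : m * (v.norm + 1) ≤ m * u.norm := Nat.mul_le_mul_left _ hlt
  rw [mul_add] at h3
  omega

lemma IsAxis.isCyclicallyReduced {u : FreeGroup (Fin n)} {ξ η : Boundary n} (h : IsAxis u ξ η)
    (hne : ξ.1 0 ≠ η.1 0) : FreeGroup.IsCyclicallyReduced u.toWord ∧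
      u.toWord.head? = some (ξ.1 0) ∧ u.toWord.getLast? = some (flip (η.1 0)) := by
  obtain ⟨c, v, hv, hw, h1, h2, h3⟩ := isAxis_letters h
  have hc : c = [] := by
    by_contra hc
    exact hne (h1 0 (List.length_pos_iff.2 hc))
  subst hc
  have : u.toWord = v := by simpa using hw
  rw [this]
  exact ⟨hv, h2, h3⟩

lemma exists_isAxis_of_isCyclicallyReduced {u : FreeGroup (Fin n)} (hu : u ≠ 1)
    (h : FreeGroup.IsCyclicallyReduced u.toWord) : ∃ ξ η, IsAxis u ξ η := by
  have key : ∀ u : FreeGroup (Fin n), u ≠ 1 → FreeGroup.IsCyclicallyReduced u.toWord →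
      ∃ ξ, Tends (fun m => u ^ m) ξ := by
    intro u hu h
    apply exists_tends
    intro k
    have hpos : 0 < u.norm := Nat.pos_of_ne_zero fun h0 => hu (FreeGroup.norm_eq_zero.1 h0)
    have hlen : k < (u ^ (k + 1)).toWord.length := by
      have h1 := norm_pow_of_isCyclicallyReduced h (k + 1)
      have h2 : (k + 1) * 1 ≤ (k + 1) * u.norm := Nat.mul_le_mul_left _ hpos
      rw [FreeGroup.norm] at h1
      omega
    refine ⟨(u ^ (k + 1)).toWord[k], ?_⟩
    filter_upwards [eventually_ge_atTop (k + 1)] with m hm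
    obtain ⟨j, rfl⟩ := Nat.exists_eq_add_of_le hm
    have : (u ^ (k + 1 + j)).toWord = (u ^ (k + 1)).toWord ++ (u ^ j).toWord := by
      have e : ∀ m, (u ^ m).toWord = (List.replicate m u.toWord).flatten := fun m => by
        rw [FreeGroup.toWord_pow, (h.flatten_replicate m).isReduced.reduce_eq]
      rw [e, e, e, List.replicate_add (k + 1) j, List.flatten_append]
    rw [this, List.getElem?_append_left hlen, List.getElem?_eq_getElem hlen]
  obtain ⟨ξ, hξ⟩ := key u hu h
  obtain ⟨η, hη⟩ := key u⁻¹ (inv_ne_one.2 hu) (by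
    rw [FreeGroup.toWord_inv, FreeGroup.isCyclicallyReduced_iff]
    refine ⟨?_, ?_⟩
    · rw [← FreeGroup.toWord_inv]; exact FreeGroup.isReduced_toWord
    · intro a ha b hb hab
      simp only [FreeGroup.invRev, List.head?_reverse, List.getLast?_reverse, List.head?_map,
        List.getLast?_map, Option.mem_def, Option.map_eq_some_iff] at ha hb
      obtain ⟨a', ha', rfl⟩ := ha
      obtain ⟨b', hb', rfl⟩ := hb
      simp only at hab ⊢
      rw [h.2 b' hb' a' ha' hab.symm])
  exact ⟨ξ, η, hu, hξ, hη⟩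

lemma finite_norm_le (M : ℕ) : {g : FreeGroup (Fin n) | g.norm ≤ M}.Finite :=
  (List.finite_length_le (Fin n × Bool) M).preimage FreeGroup.toWord_injective.injOn

lemma IsAxis.unique {u : FreeGroup (Fin n)} {ξ η ξ' η' : Boundary n} (h : IsAxis u ξ η)
    (h' : IsAxis u ξ' η') : ξ = ξ' ∧ η = η' :=
  ⟨h.2.1.unique h'.2.1, h.2.2.unique h'.2.2⟩

/-- A line through the identity vertex is the axis of a cyclically reduced conjugate of some `w` or
`w⁻¹`. Such a conjugate is shortest in its class, so its length is bounded over the finite set `W`.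
-/
lemma finite_crossing {W : Set (FreeGroup (Fin n))} (hW : 1 ∉ W) (hfin : W.Finite) :
    {p : Boundary n × Boundary n | s(p.1, p.2) ∈ lineSet W ∧ p.1.1 0 ≠ p.2.1 0}.Finite := by
  obtain ⟨M, hM⟩ : ∃ M, ∀ w ∈ W, w.norm ≤ M := by
    obtain ⟨M, hM⟩ := (hfin.image FreeGroup.norm).bddAbove
    exact ⟨M, fun w hw => hM ⟨w, hw, rfl⟩⟩
  have key : ∀ p ∈ {p : Boundary n × Boundary n | s(p.1, p.2) ∈ lineSet W ∧ p.1.1 0 ≠ p.2.1 0},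
      ∃ u : FreeGroup (Fin n), u.norm ≤ M ∧ IsAxis u p.1 p.2 := by
    rintro ⟨ξ, η⟩ ⟨h, hne⟩
    obtain ⟨u, hu, w, hw, g, hg⟩ := exists_isAxis hW h
    have hc := (hu.isCyclicallyReduced hne).1
    have hc' := (hu.symm.isCyclicallyReduced hne.symm).1
    refine ⟨u, le_trans ?_ (hM w hw), hu⟩
    rcases hg with hg | hg
    · have := norm_le_norm_conj hc g⁻¹
      rwa [hg, show g⁻¹ * (g * w * g⁻¹) * g⁻¹⁻¹ = w by group, ← hg] at this
    · have := norm_le_norm_conj hc' g⁻¹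
      rw [hg, show g⁻¹ * (g * w * g⁻¹) * g⁻¹⁻¹ = w by group, ← hg, FreeGroup.norm_inv_eq] at this
      exact this
  choose! f hf using key
  refine Set.Finite.of_finite_image ((finite_norm_le M).subset ?_) (f := f) ?_
  · rintro _ ⟨p, hp, rfl⟩
    exact (hf p hp).1
  · intro p hp q hq hpq
    have h1 := (hf p hp).2
    rw [hpq] at h1
    have := h1.unique (hf q hq).2
    exact Prod.ext this.1 this.2

/-- North-south dynamics, locally uniformly in `x`: points near `x` leave the word of `u⁻¹ ^ i` at a
bounded place, so `u ^ i` loses boundedly many letters in acting on them. -/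
lemma IsAxis.tendsto_smul {u : FreeGroup (Fin n)} {ξ η x : Boundary n} (h : IsAxis u ξ η)
    (hx : x ≠ η) {E : Set (Boundary n)} (hE : E ∈ 𝓝 ξ) :
    ∃ N ∈ 𝓝 x, ∀ᶠ i in atTop, ∀ y ∈ N, u ^ i • y ∈ E := by
  obtain ⟨M, hM⟩ := exists_cyl_subset hE
  obtain ⟨k, hk⟩ : ∃ k, x.1 k ≠ η.1 k := by
    by_contra! hk
    exact hx (Subtype.ext (funext hk))
  refine ⟨cyl x (k + 1), cyl_mem_nhds _ _, ?_⟩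
  filter_upwards [h.2.1 (M + (k + 1)), h.2.2 (k + 1)] with i h1 h2 y hy
  apply hM
  have hn := h1.le_norm
  have h3 := agree_smul_of_not_agree (u ^ i) y (k + 1) (by omega) (by
    intro h4
    rw [← inv_pow] at h4
    have e1 := h4 k (by omega)
    rw [h2 k (by omega), hy k (by omega)] at e1
    exact hk (Option.some_inj.1 e1).symm)
  intro j hj
  have e1 := h3 j (by omega)
  rw [h1 j (by omega)] at e1
  exact (Option.some_inj.1 e1).symm

end LinePattern

end

/-! ### Automorphisms act on the boundary. -/

section

open Filter Topology

namespace LinePattern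

variable {n : ℕ}

lemma norm_mk_of_isReduced {L : List (Fin n × Bool)} (h : FreeGroup.IsReduced L) :
    (FreeGroup.mk L).norm = L.length := by
  rw [FreeGroup.norm, FreeGroup.toWord_mk, h.reduce_eq]

lemma exists_norm_le_mul (φ : FreeGroup (Fin n) →* FreeGroup (Fin n)) :
    ∃ L, 1 ≤ L ∧ (∀ y, (φ (ltr y)).norm ≤ L) ∧ ∀ g, (φ g).norm ≤ L * g.norm := by
  obtain ⟨L, hL⟩ := (Set.finite_range fun y : Fin n × Bool => (φ (ltr y)).norm).bddAbove
  have hL' : ∀ y, (φ (ltr y)).norm ≤ L + 1 := fun y =>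
    (hL (Set.mem_range_self y)).trans (Nat.le_succ L)
  refine ⟨L + 1, by omega, hL', fun g => ?_⟩
  induction g using reduced_induction with
  | one => simp
  | mul y g hg ih =>
    have hn : (ltr y * g).norm = g.norm + 1 := by
      rw [FreeGroup.norm, FreeGroup.norm, toWord_ltr_mul hg, List.length_cons]
    rw [hn, map_mul, mul_add, mul_one]
    have := FreeGroup.norm_mul_le (φ (ltr y)) (φ g)
    have := hL' y
    omega

/-- Appending a letter to `g` multiplies `φ g` on the right by an element of length at most `L`,
while long words have long images. Once the image has length `R + L`, later letters cannot reach its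
first `R` letters. -/
lemma exists_agree_map (φ : FreeGroup (Fin n) ≃* FreeGroup (Fin n)) (R : ℕ) :
    ∃ K, ∀ (g : FreeGroup (Fin n)) (ξ : Boundary n), Agree K g ξ →
      R ≤ (φ (pre ξ K)).norm ∧ ∀ i < R, (φ g).toWord[i]? = (φ (pre ξ K)).toWord[i]? := by
  obtain ⟨L, hL1, hL, -⟩ := exists_norm_le_mul φ.toMonoidHom
  obtain ⟨L', hL1', -, hL'⟩ := exists_norm_le_mul φ.symm.toMonoidHom
  have hlow : ∀ g : FreeGroup (Fin n), L' * (R + L) ≤ g.norm → R + L ≤ (φ g).norm := by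
    intro g hg
    have := hL' (φ g)
    simp only [MulEquiv.toMonoidHom_eq_coe, MonoidHom.coe_coe, MulEquiv.symm_apply_apply] at this
    exact Nat.le_of_mul_le_mul_left (hg.trans this) hL1'
  have key : ∀ A B : List (Fin n × Bool), FreeGroup.IsReduced (A ++ B) →
      L' * (R + L) ≤ A.length → ∀ i < R,
        (φ (FreeGroup.mk (A ++ B))).toWord[i]? = (φ (FreeGroup.mk A)).toWord[i]? := by
    intro A B hAB hA i hi
    induction B using List.reverseRecOn with
    | nil => simp
    | append_singleton B y ih =>
      have hred : FreeGroup.IsReduced (A ++ B) :=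
        hAB.infix ⟨[], [y], by simp⟩
      rw [← ih hred]
      have e : FreeGroup.mk (A ++ (B ++ [y])) = FreeGroup.mk (A ++ B) * ltr y := by
        rw [ltr, FreeGroup.mul_mk, List.append_assoc]
      rw [e, map_mul, getElem?_mul_right]
      have h1 := hlow (FreeGroup.mk (A ++ B)) (by
        rw [norm_mk_of_isReduced hred, List.length_append]; omega)
      have := hL y
      simp only [MulEquiv.toMonoidHom_eq_coe, MonoidHom.coe_coe] at this
      omega
  refine ⟨L' * (R + L), fun g ξ h => ⟨?_, ?_⟩⟩
  · have := hlow (pre ξ (L' * (R + L))) (by simp)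
    omega
  · obtain ⟨B, hB⟩ := agree_iff_prefix.2 h
    have := key (List.ofFn fun i : Fin (L' * (R + L)) => ξ.1 i) B
      (by rw [hB]; exact FreeGroup.isReduced_toWord) (by simp)
    rw [hB, FreeGroup.mk_toWord] at this
    exact this

lemma exists_tends_map (φ : FreeGroup (Fin n) ≃* FreeGroup (Fin n)) (ξ : Boundary n) :
    ∃ η, Tends (fun m => φ (pre ξ m)) η := by
  apply exists_tends
  intro k
  obtain ⟨K, hK⟩ := exists_agree_map φ (k + 1)
  have hlen : k < (φ (pre ξ K)).toWord.length := (hK _ ξ (agree_pre ξ K)).1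
  refine ⟨(φ (pre ξ K)).toWord[k], ?_⟩
  filter_upwards [tends_pre ξ K] with m hm
  rw [(hK _ ξ hm).2 k (by omega), List.getElem?_eq_getElem hlen]

/-- The map of boundaries induced by an automorphism. -/
noncomputable def boundaryMap (φ : FreeGroup (Fin n) ≃* FreeGroup (Fin n)) (ξ : Boundary n) :
    Boundary n := (exists_tends_map φ ξ).choose

lemma exists_agree_boundaryMap (φ : FreeGroup (Fin n) ≃* FreeGroup (Fin n)) (R : ℕ) :
    ∃ K, ∀ (g : FreeGroup (Fin n)) (ξ : Boundary n), Agree K g ξ →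
      Agree R (φ g) (boundaryMap φ ξ) := by
  obtain ⟨K, hK⟩ := exists_agree_map φ R
  refine ⟨K, fun g ξ h i hi => ?_⟩
  obtain ⟨m, h1, h2⟩ := (((exists_tends_map φ ξ).choose_spec R).and (tends_pre ξ K)).exists
  rw [(hK g ξ h).2 i hi, ← (hK _ ξ h2).2 i hi, h1 i hi]
  rfl

lemma Tends.map {u : ℕ → FreeGroup (Fin n)} {ξ : Boundary n} (h : Tends u ξ)
    (φ : FreeGroup (Fin n) ≃* FreeGroup (Fin n)) :
    Tends (fun m => φ (u m)) (boundaryMap φ ξ) := fun R => by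
  obtain ⟨K, hK⟩ := exists_agree_boundaryMap φ R
  exact (h K).mono fun m hm => hK _ _ hm

lemma boundaryMap_symm_boundaryMap (φ : FreeGroup (Fin n) ≃* FreeGroup (Fin n))
    (ξ : Boundary n) : boundaryMap φ.symm (boundaryMap φ ξ) = ξ := by
  have := ((tends_pre ξ).map φ).map φ.symm
  simp only [MulEquiv.symm_apply_apply] at this
  exact this.unique (tends_pre ξ)

lemma continuous_boundaryMap (φ : FreeGroup (Fin n) ≃* FreeGroup (Fin n)) :
    Continuous (boundaryMap φ) := by
  rw [continuous_iff_continuousAt]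
  intro ξ N hN
  obtain ⟨R, hR⟩ := exists_cyl_subset hN
  obtain ⟨K, hK⟩ := exists_agree_boundaryMap φ R
  rw [mem_map]
  refine mem_of_superset (cyl_mem_nhds ξ K) fun η hη => hR fun i hi => ?_
  have h1 : Agree K (pre ξ K) η := fun j hj => by
    rw [agree_pre ξ K j hj, hη j hj]
  have e := hK _ _ h1 i hi
  rw [hK _ _ (agree_pre ξ K) i hi] at e
  exact (Option.some_inj.1 e).symm

/-- The homeomorphism of boundaries induced by an automorphism. -/
noncomputable def boundaryHomeo (φ : FreeGroup (Fin n) ≃* FreeGroup (Fin n)) :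
    Boundary n ≃ₜ Boundary n where
  toFun := boundaryMap φ
  invFun := boundaryMap φ.symm
  left_inv := boundaryMap_symm_boundaryMap φ
  right_inv := boundaryMap_symm_boundaryMap φ.symm
  continuous_toFun := continuous_boundaryMap φ
  continuous_invFun := continuous_boundaryMap φ.symm

lemma boundaryMap_mem_lineSet (φ : FreeGroup (Fin n) ≃* FreeGroup (Fin n))
    {W : Set (FreeGroup (Fin n))} {ξ η : Boundary n} (h : s(ξ, η) ∈ lineSet W) :
    s(boundaryMap φ ξ, boundaryMap φ η) ∈ lineSet (φ '' W) := by
  obtain ⟨w, hw, g, ξ', η', he, h1, h2⟩ := h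
  have key : s(boundaryMap φ ξ', boundaryMap φ η') ∈ lineSet (φ '' W) := by
    refine ⟨φ w, ⟨w, hw, rfl⟩, φ g, _, _, rfl, ?_, ?_⟩
    · simpa using h1.map φ
    · simpa using h2.map φ
  rcases Sym2.eq_iff.1 he with ⟨rfl, rfl⟩ | ⟨rfl, rfl⟩
  · exact key
  · rwa [Sym2.eq_swap]

/-- The decomposition space does not depend on the basis. -/
lemma nonempty_homeomorph {F : Type*} [Group F] (B B' : FreeGroupBasis (Fin n) F) (W : Set F) :
    Nonempty (DecompositionSpace B W ≃ₜ DecompositionSpace B' W) := by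
  set φ : FreeGroup (Fin n) ≃* FreeGroup (Fin n) := B.repr.symm.trans B'.repr with hφ
  have hW : B'.repr '' W = φ '' (B.repr '' W) := by
    rw [Set.image_image]; simp [hφ]
  have hW' : B.repr '' W = φ.symm '' (B'.repr '' W) := by
    rw [Set.image_image]; simp [hφ]
  have hl : ∀ ξ η : Boundary n, s(ξ, η) ∈ lines B W ↔
      s(boundaryHomeo φ ξ, boundaryHomeo φ η) ∈ lines B' W := by
    intro ξ η
    rw [lines_eq, lines_eq]
    constructor
    · intro h
      rw [hW]
      exact boundaryMap_mem_lineSet φ h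
    · intro h
      rw [hW']
      have := boundaryMap_mem_lineSet φ.symm h
      have e := (boundaryHomeo φ).symm_apply_apply
      change s((boundaryHomeo φ).symm _, (boundaryHomeo φ).symm _) ∈ _ at this
      rwa [e, e] at this
  refine ⟨⟨Quot.congr (ra := fun ξ η : Boundary n => s(ξ, η) ∈ lines B W)
    (rb := fun ξ η : Boundary n => s(ξ, η) ∈ lines B' W) (boundaryHomeo φ).toEquiv hl, ?_, ?_⟩⟩
  · rw [isQuotientMap_quot_mk.continuous_iff]
    exact continuous_quot_mk.comp (boundaryHomeo φ).continuous
  · rw [isQuotientMap_quot_mk.continuous_iff]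
    exact continuous_quot_mk.comp (boundaryHomeo φ).symm.continuous

end LinePattern

end

/-! ### Whitehead automorphisms and the removal of cut vertices. -/

section

open Filter Topology

namespace LinePattern

variable {n : ℕ}

/-- Adjacency in the Whitehead graph of the pattern generated by `W`. -/
def WAdj (W : Set (FreeGroup (Fin n))) (x y : Fin n × Bool) : Prop :=
  x ≠ y ∧ ∃ ξ η : Boundary n, s(ξ, η) ∈ lineSet W ∧ ξ.1 0 = x ∧ η.1 0 = y

lemma WAdj.symm {W : Set (FreeGroup (Fin n))} {x y : Fin n × Bool} (h : WAdj W x y) :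
    WAdj W y x := by
  obtain ⟨hne, ξ, η, hl, hx, hy⟩ := h
  exact ⟨hne.symm, η, ξ, by rwa [Sym2.eq_swap], hy, hx⟩

section Graph

variable {F : Type*} [Group F] (B : FreeGroupBasis (Fin n) F) (W : Set F)

lemma whiteheadGraph_adj_iff (x y : Fin n × Bool) :
    (whiteheadGraph B W).Adj x y ↔ WAdj (B.repr '' W) x y := by
  constructor
  · rintro ⟨l, hl, hne, ξ, η, rfl, hx, hy⟩
    exact ⟨hne, ξ, η, by rwa [← lines_eq], hx, hy⟩
  · rintro ⟨hne, ξ, η, hl, hx, hy⟩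
    exact ⟨s(ξ, η), by rwa [lines_eq], hne, ξ, η, rfl, hx, hy⟩

lemma whiteheadGraph_deleteVerts_adj_iff (v x y : Fin n × Bool) :
    ((whiteheadGraph B W).deleteVerts {v}).Adj x y ↔
      WAdj (B.repr '' W) x y ∧ x ≠ v ∧ y ≠ v := by
  rw [← whiteheadGraph_adj_iff]
  simp only [Graph.Adj, Graph.deleteVerts_isLink, Set.mem_singleton_iff, exists_and_right]

end Graph

section Automorphism

variable (x : Fin n × Bool) (C : Set (Fin n × Bool))

open Classical in
/-- The exponent of `x` in front of the letter `y` in a Whitehead automorphism. -/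
noncomputable def wexp (y : Fin n × Bool) : ℤ := if y ∈ C then 1 else 0

/-- A Whitehead endomorphism: a letter `y` is multiplied by `x ^ k` on the left if `y` is in `C`,
and by `x ^ (-k)` on the right if its inverse is in `C`. -/
noncomputable def whiteheadHom (k : ℤ) : FreeGroup (Fin n) →* FreeGroup (Fin n) :=
  FreeGroup.lift fun i => ltr x ^ (k * wexp C (i, true)) * FreeGroup.of i *
    ltr x ^ (-(k * wexp C (i, false)))

variable {x C}

lemma whiteheadHom_ltr (k : ℤ) (y : Fin n × Bool) : whiteheadHom x C k (ltr y) =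
    ltr x ^ (k * wexp C y) * ltr y * ltr x ^ (-(k * wexp C (flip y))) := by
  have h : ∀ i, whiteheadHom x C k (ltr (i, true)) =
      ltr x ^ (k * wexp C (i, true)) * ltr (i, true) * ltr x ^ (-(k * wexp C (i, false))) := by
    intro i
    change FreeGroup.lift _ (FreeGroup.of i) = _
    rw [FreeGroup.lift_apply_of]
    rfl
  obtain ⟨i, b⟩ := y
  cases b
  · have e : ltr (i, false) = (ltr (i, true))⁻¹ := ltr_flip (i, true)
    rw [e, map_inv, h]
    simp [flip, mul_assoc]
  · exact h i

lemma wexp_eq_zero {y : Fin n × Bool} (h : y ∉ C) : wexp C y = 0 := if_neg h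

lemma wexp_eq_one {y : Fin n × Bool} (h : y ∈ C) : wexp C y = 1 := if_pos h

lemma whiteheadHom_self (hx : x ∉ C) (hx' : flip x ∉ C) (k : ℤ) :
    whiteheadHom x C k (ltr x) = ltr x := by
  rw [whiteheadHom_ltr, wexp_eq_zero hx, wexp_eq_zero hx']
  simp

lemma hom_ext_ltr {H : Type*} [Group H] {f g : FreeGroup (Fin n) →* H}
    (h : ∀ y, f (ltr y) = g (ltr y)) : f = g :=
  FreeGroup.ext_hom _ _ fun i => h (i, true)

lemma whiteheadHom_comp (hx : x ∉ C) (hx' : flip x ∉ C) (k : ℤ) :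
    (whiteheadHom x C (-k)).comp (whiteheadHom x C k) = MonoidHom.id _ := by
  apply hom_ext_ltr
  intro y
  rw [MonoidHom.comp_apply, whiteheadHom_ltr, map_mul, map_mul, map_zpow, map_zpow,
    whiteheadHom_self hx hx', whiteheadHom_ltr, MonoidHom.id_apply]
  group

/-- A Whitehead automorphism. -/
noncomputable def whiteheadAut (hx : x ∉ C) (hx' : flip x ∉ C) :
    FreeGroup (Fin n) ≃* FreeGroup (Fin n) :=
  MonoidHom.toMulEquiv (whiteheadHom x C 1) (whiteheadHom x C (-1))
    (whiteheadHom_comp hx hx' 1) (by simpa using whiteheadHom_comp hx hx' (-1))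

open Classical in
/-- The part of the image of `y` that remains in front of the letter `z`. -/
noncomputable def wpiece (x : Fin n × Bool) (C : Set (Fin n × Bool)) (y z : Fin n × Bool) :
    FreeGroup (Fin n) :=
  ltr x ^ (-wexp (insert x C) y) * whiteheadHom x C 1 (ltr y) * ltr x ^ wexp (insert x C) z

open Classical in
/-- The number of letters produced in front of `z` from a letter `y` is at most `1`, up to a
correction that cancels along a cyclic word. -/
def WGood (x : Fin n × Bool) (C : Set (Fin n × Bool)) (y z : Fin n × Bool) : Prop :=
  (wpiece x C y z).norm + (if y = x then 1 else 0) ≤ 1 + (if z = x then 1 else 0)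

open Classical in
/-- The strict form of `WGood`. -/
def WStrict (x : Fin n × Bool) (C : Set (Fin n × Bool)) (y z : Fin n × Bool) : Prop :=
  (wpiece x C y z).norm + (if y = x then 1 else 0) < 1 + (if z = x then 1 else 0)

/-- A turn has the ends `flip y` and `z`, and by hypothesis an end in `C` forces the other into
`insert x C`. For `y` other than `x` and its inverse, the power of `x` after `y` cancels unless `z =
x` and `flip y ∉ C`, and then the term for `z = x` pays for it. A turn between `x` and `C` leaves a
letter to spare. -/
lemma wgood_and_wstrict (hx : x ∉ C) (hx' : flip x ∉ C) {y z : Fin n × Bool} (hyz : z ≠ flip y)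
    (h1 : flip y ∈ C → z ∈ insert x C) (h2 : z ∈ C → flip y ∈ insert x C) :
    WGood x C y z ∧ ((flip y = x ∧ z ∈ C) ∨ (flip y ∈ C ∧ z = x) → WStrict x C y z) := by
  have hxZ : wexp (insert x C) x = 1 := wexp_eq_one (Set.mem_insert _ _)
  have hxx : flip x ≠ x := flip_ne x
  have hxZ' : wexp (insert x C) (flip x) = 0 := wexp_eq_zero (by simp [hx', hxx])
  rw [WGood, WStrict, wpiece]
  by_cases hyx : y = x
  · subst hyx
    have hzC : z ∉ C := fun h => by simpa [hxx, hx'] using h2 h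
    rw [whiteheadHom_self hx hx', hxZ]
    have e : ltr y ^ (-1 : ℤ) * ltr y * ltr y ^ wexp (insert y C) z =
      ltr y ^ wexp (insert y C) z := by simp
    rw [e]
    refine ⟨?_, ?_⟩
    · by_cases hz : z = y
      · subst hz
        rw [hxZ]
        simp [norm_ltr]
      · rw [wexp_eq_zero (by simp [hz, hzC])]
        simp
    · rintro (⟨h, -⟩ | ⟨h, -⟩)
      · exact absurd h hxx
      · exact absurd h hx'
  by_cases hyx' : y = flip x
  · subst hyx'
    rw [flip_flip] at *
    rw [ltr_flip, map_inv, whiteheadHom_self hx hx', hxZ']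
    by_cases hzC : z ∈ C
    · rw [wexp_eq_one (Set.mem_insert_of_mem _ hzC)]
      simp [hyz, hxx]
    · rw [wexp_eq_zero (by simp [hyz, hzC])]
      simp [hyz, hxx, hzC, norm_ltr, hx]
  · have hyx2 : flip y ≠ x := fun h => hyx' (by rw [← h, flip_flip])
    have e1 : wexp (insert x C) y = wexp C y := by
      by_cases hy : y ∈ C
      · rw [wexp_eq_one hy, wexp_eq_one (Set.mem_insert_of_mem _ hy)]
      · rw [wexp_eq_zero hy, wexp_eq_zero (by simp [hy, hyx])]
    rw [whiteheadHom_ltr, e1]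
    have e : ltr x ^ (-wexp C y) * (ltr x ^ (1 * wexp C y) * ltr y *
        ltr x ^ (-(1 * wexp C (flip y)))) * ltr x ^ wexp (insert x C) z =
        ltr y * ltr x ^ (-wexp C (flip y) + wexp (insert x C) z) := by
      rw [zpow_add]; group
    rw [e]
    by_cases hy : flip y ∈ C
    · rw [wexp_eq_one hy, wexp_eq_one (h1 hy)]
      simp only [neg_add_cancel, zpow_zero, mul_one, norm_ltr, hyx, if_false, hy, hyx2]
      refine ⟨by omega, fun h => ?_⟩
      have : z = x := by tauto
      simp [this]
    · have hzC : z ∉ C := fun h => by simpa [hyx2, hy] using h2 h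
      rw [wexp_eq_zero hy]
      simp only [neg_zero, zero_add, hyx, if_false, hy, hyx2, false_and, or_self, false_imp_iff,
        and_true, add_zero]
      by_cases hz : z = x
      · subst hz
        rw [hxZ]
        have := FreeGroup.norm_mul_le (ltr y) (ltr z)
        rw [norm_ltr, norm_ltr] at this
        simpa using this
      · rw [wexp_eq_zero (by simp [hz, hzC])]
        simp [norm_ltr]

-- Inserting powers of `x` and their inverses between consecutive letters splits the image into
-- pieces. The correction terms in `WGood` telescope when the bounds are added.
open Classical in
lemma norm_whiteheadHom_le (L : List (Fin n × Bool)) (s h : Fin n × Bool)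
    (hc : (L ++ [s]).IsChain (WGood x C)) (hh : (L ++ [s]).head? = some h) :
    (ltr x ^ (-wexp (insert x C) h) * whiteheadHom x C 1 (FreeGroup.mk L) *
      ltr x ^ wexp (insert x C) s).norm + (if h = x then 1 else 0) ≤
      L.length + (if s = x then 1 else 0) := by
  induction L generalizing h with
  | nil =>
    simp only [List.nil_append, List.head?_cons, Option.some_inj] at hh
    subst hh
    have : (FreeGroup.mk [] : FreeGroup (Fin n)) = 1 := rfl
    simp [this]
  | cons y L ih =>
    simp only [List.cons_append, List.head?_cons, Option.some_inj] at hh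
    subst hh
    obtain ⟨z, hz⟩ : ∃ z, (L ++ [s]).head? = some z := by
      cases L <;> exact ⟨_, rfl⟩
    have hc' := List.isChain_cons.1 hc
    have h1 := ih z hc'.2 hz
    have h2 : WGood x C y z := hc'.1 z hz
    rw [WGood] at h2
    have e : ltr x ^ (-wexp (insert x C) y) * whiteheadHom x C 1 (FreeGroup.mk (y :: L)) *
        ltr x ^ wexp (insert x C) s = wpiece x C y z *
        (ltr x ^ (-wexp (insert x C) z) * whiteheadHom x C 1 (FreeGroup.mk L) *
        ltr x ^ wexp (insert x C) s) := by
      rw [mk_cons, map_mul, wpiece]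
      group
    rw [e, List.length_cons]
    have := FreeGroup.norm_mul_le (wpiece x C y z)
      (ltr x ^ (-wexp (insert x C) z) * whiteheadHom x C 1 (FreeGroup.mk L) *
        ltr x ^ wexp (insert x C) s)
    omega

end Automorphism

lemma pre_inv_smul_of_ne {ξ η : Boundary n} (h : ξ.1 0 ≠ η.1 0) (k : ℕ) :
    ((pre ξ (k + 1))⁻¹ • η).1 0 = flip (ξ.1 k) := by
  induction k with
  | zero =>
    rw [pre_succ, pre_zero, one_mul, ← ltr_flip]
    exact ltr_smul_zero (by simpa using h.symm)
  | succ k ih =>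
    rw [pre_succ, mul_inv_rev, mul_smul, ← ltr_flip]
    apply ltr_smul_zero
    rw [ih, flip_flip]
    exact (ξ.succ_ne k).symm

/-- Translating a later vertex of the line to the identity vertex shows the turn made there as an
edge of the Whitehead graph. -/
lemma wadj_of_line {W : Set (FreeGroup (Fin n))} {ξ η : Boundary n} (hl : s(ξ, η) ∈ lineSet W)
    (h : ξ.1 0 ≠ η.1 0) (k : ℕ) : WAdj W (flip (ξ.1 k)) (ξ.1 (k + 1)) := by
  refine ⟨fun h2 => ξ.succ_ne k h2.symm, (pre ξ (k + 1))⁻¹ • η, (pre ξ (k + 1))⁻¹ • ξ, ?_, ?_, ?_⟩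
  · rw [Sym2.eq_swap]
    exact smul_mem_lineSet hl _
  · exact pre_inv_smul_of_ne h k
  · rw [pre_inv_smul]

lemma IsAxis.agree {u : FreeGroup (Fin n)} {ξ η : Boundary n} (h : IsAxis u ξ η)
    (hc : FreeGroup.IsCyclicallyReduced u.toWord) : Agree u.norm u ξ := by
  obtain ⟨m, h1, hm⟩ := ((h.2.1 u.norm).and (eventually_ge_atTop 1)).exists
  obtain ⟨m, rfl⟩ : ∃ k, m = k + 1 := ⟨m - 1, by omega⟩
  intro i hi
  rw [← h1 i hi, FreeGroup.toWord_pow, (hc.flatten_replicate _).isReduced.reduce_eq,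
    List.replicate_succ, List.flatten_cons, List.getElem?_append_left hi]

lemma wgood_of_wadj {W : Set (FreeGroup (Fin n))} {x : Fin n × Bool} {C : Set (Fin n × Bool)}
    (hx : x ∉ C) (hx' : flip x ∉ C) (hC : ∀ y z, WAdj W y z → y ∈ C → z ∈ insert x C)
    {y z : Fin n × Bool} (h : WAdj W (flip y) z) :
    WGood x C y z ∧ ((flip y = x ∧ z ∈ C) ∨ (flip y ∈ C ∧ z = x) → WStrict x C y z) :=
  wgood_and_wstrict hx hx' h.1.symm (hC _ _ h) (hC _ _ h.symm)

/-- A Whitehead automorphism for a set `C` of vertices that is joined to other vertices only at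
`x` does not increase the length of a cyclic word, and decreases it if the last turn of the cyclic
word joins `x` to `C`. -/
lemma exists_conj_norm_le {W : Set (FreeGroup (Fin n))} {x : Fin n × Bool}
    {C : Set (Fin n × Bool)} (hx : x ∉ C) (hx' : flip x ∉ C)
    (hC : ∀ y z, WAdj W y z → y ∈ C → z ∈ insert x C) {u : FreeGroup (Fin n)} {ξ η : Boundary n}
    (hu : IsAxis u ξ η) (hl : s(ξ, η) ∈ lineSet W) (hne : ξ.1 0 ≠ η.1 0) :
    ∃ g, (g * whiteheadAut hx hx' u * g⁻¹).norm ≤ u.norm ∧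
      ((η.1 0 = x ∧ ξ.1 0 ∈ C) ∨ (η.1 0 ∈ C ∧ ξ.1 0 = x) →
        (g * whiteheadAut hx hx' u * g⁻¹).norm < u.norm) := by
  classical
  obtain ⟨hc, hhead, hlast⟩ := hu.isCyclicallyReduced hne
  have hag := hu.agree hc
  obtain ⟨L, hL⟩ := List.getLast?_eq_some_iff.1 hlast
  have hchain : (L ++ [flip (η.1 0)]).IsChain (WGood x C) := by
    rw [← hL, List.isChain_iff_getElem]
    intro i hi
    have e1 := hag i (by rw [FreeGroup.norm]; omega)
    have e2 := hag (i + 1) (by rw [FreeGroup.norm]; omega)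
    rw [List.getElem?_eq_getElem (by omega), Option.some_inj] at e1 e2
    rw [e1, e2]
    exact (wgood_of_wadj hx hx' hC (wadj_of_line hl hne i)).1
  have h1 := norm_whiteheadHom_le L _ (ξ.1 0) hchain (by rw [← hL, hhead])
  have h2 := wgood_of_wadj hx hx' hC (y := flip (η.1 0)) (z := ξ.1 0) ⟨by
    rw [flip_flip]; exact hne.symm, η, ξ, by rwa [Sym2.eq_swap], by rw [flip_flip], rfl⟩
  rw [flip_flip] at h2
  have hlen : u.norm = L.length + 1 := by rw [FreeGroup.norm, hL]; simp
  have hu2 : u = FreeGroup.mk L * ltr (flip (η.1 0)) := by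
    rw [ltr, FreeGroup.mul_mk, ← hL, FreeGroup.mk_toWord]
  -- Conjugation by this power of `x` closes the telescoping product: the remaining factor is the
  -- piece of the turn from the last letter back to the first.
  refine ⟨ltr x ^ (-wexp (insert x C) (ξ.1 0)), ?_⟩
  have e : ltr x ^ (-wexp (insert x C) (ξ.1 0)) * whiteheadAut hx hx' u *
      (ltr x ^ (-wexp (insert x C) (ξ.1 0)))⁻¹ =
      (ltr x ^ (-wexp (insert x C) (ξ.1 0)) * whiteheadHom x C 1 (FreeGroup.mk L) *
      ltr x ^ wexp (insert x C) (flip (η.1 0))) * wpiece x C (flip (η.1 0)) (ξ.1 0) := by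
    change _ * whiteheadHom x C 1 u * _ = _
    rw [hu2, map_mul, wpiece]
    group
  rw [e, hlen]
  have h3 := FreeGroup.norm_mul_le (ltr x ^ (-wexp (insert x C) (ξ.1 0)) *
    whiteheadHom x C 1 (FreeGroup.mk L) * ltr x ^ wexp (insert x C) (flip (η.1 0)))
    (wpiece x C (flip (η.1 0)) (ξ.1 0))
  refine ⟨?_, fun h => ?_⟩
  · have := h2.1
    rw [WGood] at this
    omega
  · have := h2.2 h
    rw [WStrict] at this
    omega

/-- The smallest length of a conjugate. -/
noncomputable def conjNorm (w : FreeGroup (Fin n)) : ℕ :=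
  sInf (Set.range fun g => (g * w * g⁻¹).norm)

lemma conjNorm_le (w g : FreeGroup (Fin n)) : conjNorm w ≤ (g * w * g⁻¹).norm :=
  Nat.sInf_le ⟨g, rfl⟩

lemma conjNorm_eq {w g : FreeGroup (Fin n)}
    (h : FreeGroup.IsCyclicallyReduced (g * w * g⁻¹).toWord) :
    conjNorm w = (g * w * g⁻¹).norm := by
  refine le_antisymm (conjNorm_le _ _) (le_csInf (Set.range_nonempty _) ?_)
  rintro _ ⟨a, rfl⟩
  have := norm_le_norm_conj h (a * g⁻¹)
  rwa [show a * g⁻¹ * (g * w * g⁻¹) * (a * g⁻¹)⁻¹ = a * w * a⁻¹ by group] at this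

lemma conjNorm_conj_le (w g : FreeGroup (Fin n)) (φ : FreeGroup (Fin n) ≃* FreeGroup (Fin n))
    (a : FreeGroup (Fin n)) : conjNorm (φ w) ≤ (a * φ (g * w * g⁻¹) * a⁻¹).norm := by
  have := conjNorm_le (φ w) (a * φ g)
  convert this using 2
  simp [mul_assoc]

lemma exists_conj_isCyclicallyReduced {w : FreeGroup (Fin n)} (hw : w ≠ 1) :
    ∃ g, FreeGroup.IsCyclicallyReduced (g * w * g⁻¹).toWord := by
  obtain ⟨c, v, -, hv, h⟩ := isAxis_toWord hw
  have h0 := congrArg FreeGroup.mk (h 0)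
  simp only [zero_add, pow_one, FreeGroup.mk_toWord, List.replicate_one, List.flatten_singleton,
    ← FreeGroup.mul_mk, ← FreeGroup.inv_mk] at h0
  refine ⟨(FreeGroup.mk c)⁻¹, ?_⟩
  have e : (FreeGroup.mk c)⁻¹ * w * (FreeGroup.mk c)⁻¹⁻¹ = FreeGroup.mk v := by
    rw [h0]; group
  rwa [e, FreeGroup.toWord_mk, hv.isReduced.reduce_eq]

lemma IsAxis.ne_of_isCyclicallyReduced {u : FreeGroup (Fin n)} {ξ η : Boundary n}
    (h : IsAxis u ξ η) (hc : FreeGroup.IsCyclicallyReduced u.toWord) : ξ.1 0 ≠ η.1 0 := by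
  intro h2
  have hpos : 0 < u.norm := Nat.pos_of_ne_zero fun h0 => h.1 (FreeGroup.norm_eq_zero.1 h0)
  have e1 := h.agree hc 0 hpos
  have hc' : FreeGroup.IsCyclicallyReduced u⁻¹.toWord := by
    rw [FreeGroup.isCyclicallyReduced_iff]
    refine ⟨FreeGroup.isReduced_toWord, ?_⟩
    rw [FreeGroup.toWord_inv]
    intro a ha b hb hab
    simp only [FreeGroup.invRev, List.head?_reverse, List.getLast?_reverse, List.head?_map,
      List.getLast?_map, Option.mem_def, Option.map_eq_some_iff] at ha hb
    obtain ⟨a', ha', rfl⟩ := ha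
    obtain ⟨b', hb', rfl⟩ := hb
    simp only at hab ⊢
    rw [hc.2 b' hb' a' ha' hab.symm]
  have e2 := h.symm.agree hc' 0 (by rwa [FreeGroup.norm_inv_eq])
  rw [← List.head?_eq_getElem?] at e1 e2
  rw [FreeGroup.toWord_inv] at e2
  simp only [FreeGroup.invRev, List.head?_reverse, List.getLast?_map,
    Option.map_eq_some_iff] at e2
  obtain ⟨a, ha, e3⟩ := e2
  have := hc.2 a ha _ e1
  rw [h2, ← e3] at this
  simp at this

section

variable {F : Type*} [Group F]

/-- The total length of the conjugacy classes of the elements of a finite set. -/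
noncomputable def complexity (B : FreeGroupBasis (Fin n) F) (W : Finset F) : ℕ :=
  ∑ w ∈ W, conjNorm (B.repr w)

lemma exists_complexity_lt (B : FreeGroupBasis (Fin n) F) (W : Finset F) (hW : (1 : F) ∉ W)
    {x : Fin n × Bool} {C : Set (Fin n × Bool)} (hx : x ∉ C) (hx' : flip x ∉ C)
    (hC : ∀ y z, WAdj (B.repr '' W) y z → y ∈ C → z ∈ insert x C)
    (hex : ∃ y ∈ C, WAdj (B.repr '' W) x y) :
    ∃ B' : FreeGroupBasis (Fin n) F, complexity B' W < complexity B W := by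
  have h1 : (1 : FreeGroup (Fin n)) ∉ B.repr '' W := by
    rintro ⟨w, hw, h⟩
    rw [map_eq_one_iff B.repr B.repr.injective] at h
    exact hW (h ▸ hw)
  refine ⟨⟨B.repr.trans (whiteheadAut hx hx')⟩, Finset.sum_lt_sum (fun w hw => ?_) ?_⟩
  · have hw1 : B.repr w ≠ 1 := fun h => h1 ⟨w, hw, h⟩
    obtain ⟨g, hg⟩ := exists_conj_isCyclicallyReduced hw1
    have hu1 : g * B.repr w * g⁻¹ ≠ 1 := fun h => hw1 (conj_eq_one_iff.1 h)
    obtain ⟨ξ, η, hu⟩ := exists_isAxis_of_isCyclicallyReduced hu1 hg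
    obtain ⟨a, ha, -⟩ := exists_conj_norm_le hx hx' hC hu
      (mem_lineSet_of_isAxis hu ⟨w, hw, rfl⟩ rfl) (hu.ne_of_isCyclicallyReduced hg)
    rw [conjNorm_eq hg]
    exact (conjNorm_conj_le _ g _ a).trans ha
  · obtain ⟨y, hy, hne, ξ, η, hl, hξ, hη⟩ := hex
    have key : ∀ (ξ η : Boundary n) (w : F) (g u : FreeGroup (Fin n)), w ∈ W → IsAxis u ξ η →
        u = g * B.repr w * g⁻¹ → ξ.1 0 ≠ η.1 0 →
        (η.1 0 = x ∧ ξ.1 0 ∈ C) ∨ (η.1 0 ∈ C ∧ ξ.1 0 = x) →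
        conjNorm (whiteheadAut hx hx' (B.repr w)) < conjNorm (B.repr w) := by
      intro ξ η w g u hw hu hg hne h
      have hc := (hu.isCyclicallyReduced hne).1
      obtain ⟨a, -, ha⟩ := exists_conj_norm_le hx hx' hC hu
        (mem_lineSet_of_isAxis hu ⟨w, hw, rfl⟩ hg) hne
      rw [hg] at hc ha
      rw [conjNorm_eq hc]
      exact (conjNorm_conj_le _ g _ a).trans_lt (ha h)
    have hne' : ξ.1 0 ≠ η.1 0 := by rw [hξ, hη]; exact hne
    obtain ⟨u, hu, _, ⟨w, hw, rfl⟩, g, hg | hg⟩ := exists_isAxis h1 hl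
    · exact ⟨w, hw, key ξ η w g u hw hu hg hne' (Or.inr ⟨hη ▸ hy, hξ⟩)⟩
    · exact ⟨w, hw, key η ξ w g u⁻¹ hw hu.symm hg hne'.symm (Or.inl ⟨hξ, hη ▸ hy⟩)⟩

/-- Whitehead's theorem: some basis has a Whitehead graph without cut vertices. -/
theorem exists_forall_not_isCutVertex (B₀ : FreeGroupBasis (Fin n) F) {W : Set F}
    (hfin : W.Finite) (hW : (1 : F) ∉ W) :
    ∃ B : FreeGroupBasis (Fin n) F, ∀ v, ¬ (whiteheadGraph B W).IsCutVertex v := by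
  lift W to Finset F using hfin
  obtain ⟨B, -, hB⟩ := WellFounded.has_min (measure fun B : FreeGroupBasis (Fin n) F =>
    complexity B W).wf Set.univ ⟨B₀, Set.mem_univ _⟩
  refine ⟨B, ?_⟩
  rintro x ⟨-, a, -, b, -, hax, hbx, hab, hnab⟩
  set D := ((whiteheadGraph B (W : Set F)).deleteVerts {x}).Adj with hD
  have hDsymm : ∀ y z, Relation.ReflTransGen D y z → Relation.ReflTransGen D z y := by
    intro y z h
    have : Std.Symm D := ⟨fun p q hpq => Graph.Adj.symm hpq⟩
    exact Relation.ReflTransGen.stdSymm.symm _ _ h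
  -- If the part `C` of `a` missed `flip x`, it would define a Whitehead automorphism that lowers
  -- the minimal complexity. So each of the two separated parts contains `flip x`, and they
  -- coincide.
  have key : ∀ a b : Fin n × Bool, a ≠ x → b ≠ x →
      Relation.ReflTransGen (whiteheadGraph B (W : Set F)).Adj a b →
      ¬ Relation.ReflTransGen D a b → Relation.ReflTransGen D a (flip x) := by
    intro a b hax hbx hab hnab
    by_contra hflip
    have hC : ∀ y z, WAdj (B.repr '' W) y z → y ∈ {y | Relation.ReflTransGen D a y ∧ y ≠ x} →
        z ∈ insert x {y | Relation.ReflTransGen D a y ∧ y ≠ x} := by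
      rintro y z hyz ⟨hy, hyx⟩
      by_cases hz : z = x
      · exact Or.inl hz
      · exact Or.inr ⟨hy.tail
          ((whiteheadGraph_deleteVerts_adj_iff B _ x y z).2 ⟨hyz, hyx, hz⟩), hz⟩
    -- Without an edge from `x` to `C`, the set `C` would be the entire connected component of `a`,
    -- and `b` would lie in it.
    have hex : ∃ y ∈ {y | Relation.ReflTransGen D a y ∧ y ≠ x}, WAdj (B.repr '' W) x y := by
      by_contra! hno
      have hall : ∀ c, Relation.ReflTransGen (whiteheadGraph B (W : Set F)).Adj a c →
          Relation.ReflTransGen D a c ∧ c ≠ x := by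
        intro c hc
        induction hc with
        | refl => exact ⟨.refl, hax⟩
        | tail _ h2 ih =>
          have h3 := (whiteheadGraph_adj_iff B _ _ _).1 h2
          rcases hC _ _ h3 ih with h4 | h4
          · subst h4
            exact absurd h3.symm (hno _ ih)
          · exact h4
      exact hnab (hall b hab).1
    obtain ⟨B', hB'⟩ := exists_complexity_lt B W hW (x := x)
      (C := {y | Relation.ReflTransGen D a y ∧ y ≠ x}) (fun h => h.2 rfl)
      (fun h => hflip h.1) hC hex
    exact hB B' (Set.mem_univ _) hB'
  have h1 := key a b hax hbx hab hnab
  have hba : Relation.ReflTransGen (whiteheadGraph B (W : Set F)).Adj b a := by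
    have : Std.Symm (whiteheadGraph B (W : Set F)).Adj := ⟨fun p q hpq => Graph.Adj.symm hpq⟩
    exact Relation.ReflTransGen.stdSymm.symm _ _ hab
  have h2 := key b a hbx hax hba fun h => hnab (hDsymm _ _ h)
  exact hnab (h1.trans (hDsymm _ _ h2))

end

end LinePattern

end

/-! ### Cyclic orders from a circular Whitehead graph. -/

section

open Filter Topology

namespace LinePattern

/-- A sign in a ring. -/
def IsSign {R : Type*} [Ring R] (s : R) : Prop := s = 1 ∨ s = -1

lemma IsSign.mul_self {R : Type*} [Ring R] {s : R} (h : IsSign s) : s * s = 1 := by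
  rcases h with rfl | rfl <;> simp

lemma IsSign.mul {R : Type*} [Ring R] {s t : R} (hs : IsSign s) (ht : IsSign t) :
    IsSign (s * t) := by
  rcases hs with rfl | rfl <;> rcases ht with rfl | rfl <;> simp [IsSign]

lemma IsSign.neg {R : Type*} [Ring R] {s : R} (hs : IsSign s) : IsSign (-s) := by
  rcases hs with rfl | rfl <;> simp [IsSign]

lemma IsSign.mul_ne_zero {R : Type*} [Ring R] {s x : R} (hs : IsSign s) (hx : x ≠ 0) :
    s * x ≠ 0 := by
  intro h
  apply hx
  have := congrArg (s * ·) h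
  simpa [← mul_assoc, hs.mul_self] using this

variable {n : ℕ}

/-- The lines of the pattern generated by `W` that pass through the identity vertex join
cyclically adjacent components, with respect to a cyclic order `pos` of the components, and there
is exactly one line for each pair of adjacent components. -/
structure IsCyclicPattern (W : Set (FreeGroup (Fin n))) (pos : Fin n × Bool ≃ ZMod (2 * n)) :
    Prop where
  adj : ∀ {ξ η : Boundary n}, s(ξ, η) ∈ lineSet W → ξ.1 0 ≠ η.1 0 →
    IsSign (pos (η.1 0) - pos (ξ.1 0))
  exists_line : ∀ y {s : ZMod (2 * n)}, IsSign s → ∃ ξ η : Boundary n, s(ξ, η) ∈ lineSet W ∧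
    ξ.1 0 = y ∧ pos (η.1 0) = pos y + s
  unique : ∀ {ξ η ξ' η' : Boundary n}, s(ξ, η) ∈ lineSet W → s(ξ', η') ∈ lineSet W →
    ξ.1 0 ≠ η.1 0 → ξ.1 0 = ξ'.1 0 → η.1 0 = η'.1 0 → ξ = ξ' ∧ η = η'

/-- The two neighbours of a vertex of the polygon are distinct. This fails for two sides, hence `2 ≤
n`. -/
lemma one_ne_neg_one (hn : 2 ≤ n) : (1 : ZMod (2 * n)) ≠ -1 := by
  intro h
  have h2 : ((2 : ℕ) : ZMod (2 * n)) = 0 := by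
    push_cast
    linear_combination h
  rw [ZMod.natCast_eq_zero_iff] at h2
  have := Nat.le_of_dvd (by norm_num) h2
  omega

lemma exists_isCyclicPattern {F : Type*} [Group F] (hn : 2 ≤ n) {B : FreeGroupBasis (Fin n) F}
    {W : Set F} (h : (whiteheadGraph B W).IsCircle) :
    ∃ pos, IsCyclicPattern (B.repr '' W) pos := by
  obtain ⟨m, hm, v, e, hlink⟩ := h
  have hm2 : m = 2 * n := by
    have : NeZero m := ⟨by omega⟩
    have h1 := Nat.card_congr v
    change Nat.card (ZMod m) = Nat.card (Set.univ : Set (Fin n × Bool)) at h1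
    rw [Nat.card_zmod, Nat.card_univ, Nat.card_prod] at h1
    simp at h1
    omega
  subst hm2
  let pos : Fin n × Bool ≃ ZMod (2 * n) := (Equiv.Set.univ _).symm.trans v.symm
  have hv : ∀ i, pos (v i) = i := fun i => v.symm_apply_apply i
  have key : ∀ {ξ η : Boundary n}, s(ξ, η) ∈ lineSet (B.repr '' W) → ξ.1 0 ≠ η.1 0 →
      ∃ i, (e i : Sym2 (Boundary n)) = s(ξ, η) ∧ ((pos (ξ.1 0) = i ∧ pos (η.1 0) = i + 1) ∨
        (pos (η.1 0) = i ∧ pos (ξ.1 0) = i + 1)) := by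
    intro ξ η hl hne
    have hl2 : (whiteheadGraph B W).IsLink s(ξ, η) (ξ.1 0) (η.1 0) :=
      ⟨by rwa [lines_eq], hne, ξ, η, rfl, rfl, rfl⟩
    obtain ⟨i, hi⟩ := e.surjective ⟨s(ξ, η), hl2.edge_mem⟩
    have hi' : (e i : Sym2 (Boundary n)) = s(ξ, η) := congrArg Subtype.val hi
    refine ⟨i, hi', ?_⟩
    have h1 := hlink i
    rw [hi'] at h1
    obtain ⟨-, -, ξ', η', he, h2, h3⟩ := h1
    rcases Sym2.eq_iff.1 he with ⟨rfl, rfl⟩ | ⟨rfl, rfl⟩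
    · left
      rw [h2, h3]
      exact ⟨hv _, hv _⟩
    · right
      rw [h2, h3]
      exact ⟨hv _, hv _⟩
  refine ⟨pos, ⟨fun hl hne => ?_, fun y s hs => ?_, fun {ξ η ξ' η'} hl hl' hne h1 h2 => ?_⟩⟩
  · obtain ⟨i, -, ⟨h1, h2⟩ | ⟨h1, h2⟩⟩ := key hl hne
    · left; rw [h1, h2]; ring
    · right; rw [h1, h2]; ring
  · have hex : ∀ i, ∃ ξ η : Boundary n, s(ξ, η) ∈ lineSet (B.repr '' W) ∧
        pos (ξ.1 0) = i ∧ pos (η.1 0) = i + 1 := by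
      intro i
      obtain ⟨hl, -, ξ, η, he, h1, h2⟩ := hlink i
      exact ⟨ξ, η, by rwa [← lines_eq, ← he], by rw [h1, hv], by rw [h2, hv]⟩
    rcases hs with rfl | rfl
    · obtain ⟨ξ, η, hl, h1, h2⟩ := hex (pos y)
      exact ⟨ξ, η, hl, pos.injective h1, h2⟩
    · obtain ⟨ξ, η, hl, h1, h2⟩ := hex (pos y - 1)
      exact ⟨η, ξ, by rwa [Sym2.eq_swap], pos.injective (by rw [h2]; ring), by rw [h1]; ring⟩
  · obtain ⟨i, hi, hi'⟩ := key hl hne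
    obtain ⟨j, hj, hj'⟩ := key hl' (by rwa [← h1, ← h2])
    rw [← h1, ← h2] at hj'
    have hij : i = j := by
      have h12 := one_ne_neg_one hn
      rcases hi' with ⟨a, b⟩ | ⟨a, b⟩ <;> rcases hj' with ⟨c, d⟩ | ⟨c, d⟩
      · rw [← a, ← c]
      · exfalso
        apply h12
        linear_combination c - b - d + a
      · exfalso
        apply h12
        linear_combination c - b - d + a
      · rw [← a, ← c]
    rw [← hij, hi] at hj
    rcases Sym2.eq_iff.1 hj with h | ⟨rfl, -⟩
    · exact h
    · exact absurd h2.symm hne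

namespace IsCyclicPattern

variable {W : Set (FreeGroup (Fin n))} {pos : Fin n × Bool ≃ ZMod (2 * n)}

lemma line_tail {ξ η : Boundary n} (hl : s(ξ, η) ∈ lineSet W) :
    s(tail ξ, (ltr (ξ.1 0))⁻¹ • η) ∈ lineSet W := by
  rw [← ltr_inv_smul_eq_tail]
  exact smul_mem_lineSet hl _

lemma zero_of_ne {ξ η : Boundary n} (hne : ξ.1 0 ≠ η.1 0) :
    ((ltr (ξ.1 0))⁻¹ • η).1 0 = flip (ξ.1 0) := by
  rw [← ltr_flip]
  exact ltr_smul_zero (by rw [flip_flip]; exact hne.symm)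

/-- The change of orientation along the edge with label `y`. -/
lemma exists_turn (hn : 2 ≤ n) (h : IsCyclicPattern W pos) (y : Fin n × Bool) :
    ∃ t, IsSign t ∧ ∀ ξ η : Boundary n, s(ξ, η) ∈ lineSet W → ξ.1 0 = y → η.1 0 ≠ y →
      pos (ξ.1 1) = pos (flip y) - (pos (η.1 0) - pos y) * t := by
  have h12 := one_ne_neg_one hn
  have hne : ∀ {s : ZMod (2 * n)} {a : Fin n × Bool}, IsSign s → pos a = pos y + s → a ≠ y := by
    rintro s a hs ha rfl
    have h0 : s = 0 := by linear_combination -ha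
    have := hs.mul_self
    rw [h0, mul_zero] at this
    apply h12
    linear_combination -2 * this
  obtain ⟨α, β, hl, hα, hβ⟩ := h.exists_line y (Or.inl rfl : IsSign (1 : ZMod (2 * n)))
  obtain ⟨α', β', hl', hα', hβ'⟩ := h.exists_line y (Or.inr rfl : IsSign (-1 : ZMod (2 * n)))
  have hβy : β.1 0 ≠ y := hne (Or.inl rfl) hβ
  have hβy' : β'.1 0 ≠ y := hne (Or.inr rfl) hβ'
  have hsgn : ∀ {ξ η : Boundary n}, s(ξ, η) ∈ lineSet W → ξ.1 0 = y → η.1 0 ≠ y →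
      IsSign (pos (ξ.1 1) - pos (flip y)) := by
    intro ξ η hl hξ hη
    have h1 := line_tail hl
    have h2 := zero_of_ne (ξ := ξ) (η := η) (by rw [hξ]; exact hη.symm)
    have h3 := h.adj h1 (by rw [h2]; exact ξ.succ_ne 0)
    rw [h2, hξ] at h3
    have := h3.neg
    rwa [neg_sub] at this
  -- The two lines crossing the edge leave its far end on opposite sides. Leaving on the same side,
  -- they would be the same line by `unique`, although they started on different sides.
  have hsum : pos (α'.1 1) - pos (flip y) = -(pos (α.1 1) - pos (flip y)) := by
    by_contra hcon
    have heq : α.1 1 = α'.1 1 := by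
      apply pos.injective
      rcases hsgn hl hα hβy with e | e <;> rcases hsgn hl' hα' hβy' with e' | e'
      · linear_combination e - e'
      · exact absurd (by rw [e, e']) hcon
      · exact absurd (by rw [e, e', neg_neg]) hcon
      · linear_combination e - e'
    have h2 := zero_of_ne (ξ := α) (η := β) (by rw [hα]; exact hβy.symm)
    have h2' := zero_of_ne (ξ := α') (η := β') (by rw [hα']; exact hβy'.symm)
    have h3 := h.unique (line_tail hl) (line_tail hl') (by rw [h2]; exact α.succ_ne 0) heq
      (by rw [h2, h2', hα, hα'])
    have h4 : β = β' := by
      have := h3.2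
      rw [hα, hα'] at this
      exact smul_left_cancel _ this
    rw [h4, hβ'] at hβ
    apply h12
    linear_combination -hβ
  -- The sign is chosen so that `t = 1` when the cyclic orders at the two ends fit into one oriented
  -- planar picture: a line following the next direction at one end follows the previous one at the
  -- other.
  refine ⟨-(pos (α.1 1) - pos (flip y)), (hsgn hl hα hβy).neg, fun ξ η hl2 hξ hη => ?_⟩
  rcases h.adj hl2 (by rw [hξ]; exact hη.symm) with e | e
  · rw [hξ] at e
    have : η.1 0 = β.1 0 := pos.injective (by linear_combination e - hβ)
    have h3 := h.unique hl2 hl (by rw [hξ]; exact hη.symm) (by rw [hξ, hα]) this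
    rw [h3.1, e]
    ring
  · rw [hξ] at e
    have : η.1 0 = β'.1 0 := pos.injective (by linear_combination e - hβ')
    have h3 := h.unique hl2 hl' (by rw [hξ]; exact hη.symm) (by rw [hξ, hα']) this
    rw [h3.1, e]
    linear_combination hsum

end IsCyclicPattern

end LinePattern

end

/-! ### Boundary points as expansions in base `2 * n - 1`. -/

section

open Filter Topology

namespace LinePattern

variable {n : ℕ}

section Digits

variable (pos : Fin n × Bool ≃ ZMod (2 * n)) (τ : Fin n × Bool → ZMod (2 * n))

/-- The orientation at the `k`-th vertex of a ray, when it is `o` at the first one. -/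
def orient (o : ZMod (2 * n)) (ξ : Boundary n) (k : ℕ) : ZMod (2 * n) :=
  o * ∏ i ∈ Finset.range k, τ (ξ.1 i)

lemma orient_succ (o : ZMod (2 * n)) (ξ : Boundary n) (k : ℕ) :
    orient τ o ξ (k + 1) = orient τ (o * τ (ξ.1 0)) (tail ξ) k := by
  rw [orient, orient, Finset.prod_range_succ', mul_assoc, mul_comm (τ (ξ.1 0))]
  rfl

/-- The position of the `k + 1`-st letter of a ray relative to the edge through which the ray
arrives. -/
def turn (o : ZMod (2 * n)) (ξ : Boundary n) (k : ℕ) : ZMod (2 * n) :=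
  orient τ o ξ (k + 1) * (pos (ξ.1 (k + 1)) - pos (flip (ξ.1 k)))

lemma turn_succ (o : ZMod (2 * n)) (ξ : Boundary n) (k : ℕ) :
    turn pos τ o ξ (k + 1) = turn pos τ (o * τ (ξ.1 0)) (tail ξ) k := by
  rw [turn, orient_succ]; rfl

lemma turn_zero (o : ZMod (2 * n)) (ξ : Boundary n) :
    turn pos τ o ξ 0 = o * τ (ξ.1 0) * (pos (ξ.1 1) - pos (flip (ξ.1 0))) := by
  simp [turn, orient]

/-- The digits of a boundary point in base `2 * n - 1`. -/
def dig (hn : 2 ≤ n) (o : ZMod (2 * n)) (ξ : Boundary n) (k : ℕ) : Fin (2 * n - 1) :=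
  ⟨(turn pos τ o ξ k).val - 1, by
    have : NeZero (2 * n) := ⟨by omega⟩
    have := ZMod.val_lt (turn pos τ o ξ k)
    omega⟩

lemma dig_succ (hn : 2 ≤ n) (o : ZMod (2 * n)) (ξ : Boundary n) (k : ℕ) :
    dig pos τ hn o ξ (k + 1) = dig pos τ hn (o * τ (ξ.1 0)) (tail ξ) k := by
  simp only [dig, turn_succ]

variable {pos τ}

lemma turn_ne_zero (hτ : ∀ y, IsSign (τ y)) {o : ZMod (2 * n)} (ho : IsSign o) (ξ : Boundary n)
    (k : ℕ) : turn pos τ o ξ k ≠ 0 := by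
  induction k generalizing o ξ with
  | zero =>
    rw [turn_zero]
    apply (ho.mul (hτ _)).mul_ne_zero
    rw [sub_ne_zero, pos.injective.ne_iff]
    exact ξ.succ_ne 0
  | succ k ih =>
    rw [turn_succ]
    exact ih (ho.mul (hτ _)) _

lemma dig_add_one (hn : 2 ≤ n) (hτ : ∀ y, IsSign (τ y)) {o : ZMod (2 * n)} (ho : IsSign o)
    (ξ : Boundary n) (k : ℕ) : (dig pos τ hn o ξ k : ℕ) + 1 = (turn pos τ o ξ k).val := by
  have h := turn_ne_zero (pos := pos) hτ ho ξ k
  rw [← ZMod.val_ne_zero] at h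
  simp only [dig]
  omega

lemma cast_dig_add_one (hn : 2 ≤ n) (hτ : ∀ y, IsSign (τ y)) {o : ZMod (2 * n)} (ho : IsSign o)
    (ξ : Boundary n) (k : ℕ) : ((dig pos τ hn o ξ k : ℕ) : ZMod (2 * n)) + 1 =
      turn pos τ o ξ k := by
  have : NeZero (2 * n) := ⟨by omega⟩
  have h := congrArg (Nat.cast : ℕ → ZMod (2 * n)) (dig_add_one (pos := pos) hn hτ ho ξ k)
  rwa [ZMod.natCast_zmod_val, Nat.cast_add, Nat.cast_one] at h

lemma eq_of_turn_eq (hτ : ∀ y, IsSign (τ y)) {o : ZMod (2 * n)} (ho : IsSign o) {ξ η : Boundary n}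
    (h0 : ξ.1 0 = η.1 0) (h : turn pos τ o ξ 0 = turn pos τ o η 0) : ξ.1 1 = η.1 1 := by
  rw [turn_zero, turn_zero, ← h0] at h
  have h2 := congrArg (o * τ (ξ.1 0) * ·) h
  simp only [← mul_assoc _ _ (_ - _), (ho.mul (hτ (ξ.1 0))).mul_self, one_mul] at h2
  exact pos.injective (sub_left_inj.1 h2)

lemma eq_of_dig_eq (hn : 2 ≤ n) (hτ : ∀ y, IsSign (τ y)) {o : ZMod (2 * n)} (ho : IsSign o)
    {ξ η : Boundary n} (h0 : ξ.1 0 = η.1 0)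
    (h : ∀ k, dig pos τ hn o ξ k = dig pos τ hn o η k) : ξ = η := by
  apply Subtype.ext
  funext k
  induction k generalizing o ξ η with
  | zero => exact h0
  | succ k ih =>
    have h1 : ξ.1 1 = η.1 1 := eq_of_turn_eq (pos := pos) hτ ho h0 (by
      rw [← cast_dig_add_one hn hτ ho, ← cast_dig_add_one hn hτ ho, h])
    refine ih (ho.mul (hτ (ξ.1 0))) (ξ := tail ξ) (η := tail η) h1 fun k => ?_
    have := h (k + 1)
    rwa [dig_succ, dig_succ, ← h0] at this

lemma exists_dig_eq (hn : 2 ≤ n) (hτ : ∀ y, IsSign (τ y)) {o : ZMod (2 * n)} (ho : IsSign o)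
    (y : Fin n × Bool) (d : ℕ → Fin (2 * n - 1)) :
    ∃ ξ : Boundary n, ξ.1 0 = y ∧ ∀ k, dig pos τ hn o ξ k = d k := by
  -- The state is the current orientation together with the current letter. The next letter is found
  -- by solving the definition of `turn` for it.
  let st : ℕ → ZMod (2 * n) × (Fin n × Bool) := fun k =>
    Nat.rec (o, y) (fun k p => (p.1 * τ p.2,
      pos.symm (pos (flip p.2) + p.1 * τ p.2 * (((d k : ℕ) : ZMod (2 * n)) + 1)))) k
  have hs : ∀ k, IsSign (st k).1 := by
    intro k
    induction k with
    | zero => exact ho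
    | succ k ih => exact ih.mul (hτ _)
  have hpos : ∀ k, pos (st (k + 1)).2 =
      pos (flip (st k).2) + (st (k + 1)).1 * (((d k : ℕ) : ZMod (2 * n)) + 1) := fun k =>
    pos.apply_symm_apply _
  have hval : ∀ k, (((d k : ℕ) : ZMod (2 * n)) + 1).val = d k + 1 := by
    intro k
    have h1 := (d k).2
    have e : ((d k : ℕ) : ZMod (2 * n)) + 1 = ((d k + 1 : ℕ) : ZMod (2 * n)) := by push_cast; rfl
    rw [e, ZMod.val_cast_of_lt (by omega)]
  have hne : ∀ k, ((d k : ℕ) : ZMod (2 * n)) + 1 ≠ 0 := by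
    intro k h
    have := hval k
    rw [h, ZMod.val_zero] at this
    omega
  let ξ : Boundary n := ⟨fun k => (st k).2, fun k h => by
    have h1 := hpos k
    rw [show (st (k + 1)).2 = flip (st k).2 from h, left_eq_add] at h1
    exact (hs (k + 1)).mul_ne_zero (hne k) h1⟩
  refine ⟨ξ, rfl, fun k => Fin.ext ?_⟩
  have hor : ∀ k, orient τ o ξ k = (st k).1 := by
    intro k
    induction k with
    | zero => simp [orient]; rfl
    | succ k ih =>
      rw [orient, Finset.prod_range_succ, ← mul_assoc]
      change orient τ o ξ k * _ = _
      rw [ih]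
  have ht : turn pos τ o ξ k = ((d k : ℕ) : ZMod (2 * n)) + 1 := by
    rw [turn, hor]
    change (st (k + 1)).1 * (pos (st (k + 1)).2 - pos (flip (st k).2)) = _
    rw [hpos]
    linear_combination (((d k : ℕ) : ZMod (2 * n)) + 1) * (hs (k + 1)).mul_self
  have := dig_add_one (pos := pos) hn hτ ho ξ k
  rw [ht, hval] at this
  omega

/-- The number in `[0, 1]` with the given digits. -/
noncomputable def digVal (pos : Fin n × Bool ≃ ZMod (2 * n)) (τ : Fin n × Bool → ZMod (2 * n))
    (hn : 2 ≤ n) (o : ZMod (2 * n)) (ξ : Boundary n) : ℝ :=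
  Real.ofDigits (dig pos τ hn o ξ)

end Digits

lemma ofDigits_eq_div {b : ℕ} (d : ℕ → Fin b) :
    Real.ofDigits d = ((d 0 : ℕ) + Real.ofDigits fun k => d (k + 1)) / b := by
  rw [Real.ofDigits_eq_sum_add_ofDigits d 1]
  simp [Real.ofDigitsTerm]
  ring

lemma eq_zero_of_ofDigits_eq_zero {b : ℕ} {d : ℕ → Fin b} (h : Real.ofDigits d = 0) (k : ℕ) :
    (d k : ℕ) = 0 := by
  induction k generalizing d with
  | zero =>
    have hb : (0 : ℝ) < b := by exact_mod_cast Fin.pos (d 0)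
    rw [ofDigits_eq_div, div_eq_zero_iff] at h
    have h1 := Real.ofDigits_nonneg fun k => d (k + 1)
    have h2 : (0 : ℝ) ≤ (d 0 : ℕ) := Nat.cast_nonneg _
    have h3 : ((d 0 : ℕ) : ℝ) = 0 := by
      rcases h with h | h <;> linarith
    exact_mod_cast h3
  | succ k ih =>
    have hb : (0 : ℝ) < b := by exact_mod_cast Fin.pos (d 0)
    apply ih (d := fun k => d (k + 1))
    rw [ofDigits_eq_div, div_eq_zero_iff] at h
    have h1 := Real.ofDigits_nonneg fun k => d (k + 1)
    have h2 : (0 : ℝ) ≤ (d 0 : ℕ) := Nat.cast_nonneg _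
    rcases h with h | h <;> linarith

lemma eq_last_of_ofDigits_eq_one {b : ℕ} {d : ℕ → Fin b} (h : Real.ofDigits d = 1) (k : ℕ) :
    (d k : ℕ) + 1 = b := by
  have key : ∀ d : ℕ → Fin b, Real.ofDigits d = 1 →
      (d 0 : ℕ) + 1 = b ∧ Real.ofDigits (fun k => d (k + 1)) = 1 := by
    intro d h
    have hb : (0 : ℝ) < b := by exact_mod_cast Fin.pos (d 0)
    rw [ofDigits_eq_div, div_eq_one_iff_eq hb.ne'] at h
    have h1 := Real.ofDigits_le_one fun k => d (k + 1)
    have h2 : ((d 0 : ℕ) : ℝ) + 1 ≤ b := by exact_mod_cast (d 0).2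
    refine ⟨?_, by linarith⟩
    have h3 : ((d 0 : ℕ) : ℝ) + 1 = b := by linarith
    exact_mod_cast h3
  induction k generalizing d with
  | zero => exact (key d h).1
  | succ k ih => exact ih (key d h).2

lemma ofDigits_eq_zero {b : ℕ} {d : ℕ → Fin b} (h : ∀ k, (d k : ℕ) = 0) :
    Real.ofDigits d = 0 := by
  simp [Real.ofDigits, Real.ofDigitsTerm, h]

lemma ofDigits_eq_one {b : ℕ} (hb : 1 < b) {d : ℕ → Fin b} (h : ∀ k, (d k : ℕ) + 1 = b) :
    Real.ofDigits d = 1 := by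
  rw [← Real.ofDigits_const_last_eq_one' hb]
  congr 1
  funext k
  apply Fin.ext
  have := h k
  simp only
  omega

namespace IsCyclicPattern

variable {W : Set (FreeGroup (Fin n))} {pos : Fin n × Bool ≃ ZMod (2 * n)}
  {τ : Fin n × Bool → ZMod (2 * n)}

/-- The sign `τ y` describes how the cyclic order changes along the edge labelled `y`. -/
def IsTurning (W : Set (FreeGroup (Fin n))) (pos : Fin n × Bool ≃ ZMod (2 * n))
    (τ : Fin n × Bool → ZMod (2 * n)) : Prop :=
  (∀ y, IsSign (τ y)) ∧ ∀ ξ η : Boundary n, s(ξ, η) ∈ lineSet W → ξ.1 0 ≠ η.1 0 →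
    pos (ξ.1 1) = pos (flip (ξ.1 0)) - (pos (η.1 0) - pos (ξ.1 0)) * τ (ξ.1 0)

lemma exists_isTurning (hn : 2 ≤ n) (h : IsCyclicPattern W pos) : ∃ τ, IsTurning W pos τ := by
  choose τ hτ hτ' using h.exists_turn hn
  exact ⟨τ, hτ, fun ξ η hl hne => hτ' _ ξ η hl rfl hne.symm⟩

/-- The turns along a line are constant. -/
lemma turn_line (h : IsCyclicPattern W pos) (hτ : IsTurning W pos τ) {ξ η : Boundary n}
    (hl : s(ξ, η) ∈ lineSet W) (hne : ξ.1 0 ≠ η.1 0) {o s : ZMod (2 * n)}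
    (ho : o = s * (pos (η.1 0) - pos (ξ.1 0))) (k : ℕ) : turn pos τ o ξ k = -s := by
  induction k generalizing ξ η o with
  | zero =>
    rw [turn_zero, hτ.2 ξ η hl hne, ho]
    linear_combination (-s * (pos (η.1 0) - pos (ξ.1 0)) * (pos (η.1 0) - pos (ξ.1 0))) *
      (hτ.1 (ξ.1 0)).mul_self - s * (h.adj hl hne).mul_self
  | succ k ih =>
    rw [turn_succ]
    have h0 := zero_of_ne hne
    refine ih (line_tail hl) (by rw [h0]; exact ξ.succ_ne 0) ?_
    rw [h0, ho, show (tail ξ).1 0 = ξ.1 1 from rfl, hτ.2 ξ η hl hne]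
    ring

/-- With this orientation every turn along the line is `-1`, which gives the largest digit `2 * n -
2`. The opposite orientation gives turns `1` and digits `0`. -/
lemma digVal_line_eq_one (hn : 2 ≤ n) (h : IsCyclicPattern W pos) (hτ : IsTurning W pos τ)
    {ξ η : Boundary n} (hl : s(ξ, η) ∈ lineSet W) (hne : ξ.1 0 ≠ η.1 0) {o : ZMod (2 * n)}
    (ho : o = pos (η.1 0) - pos (ξ.1 0)) : digVal pos τ hn o ξ = 1 := by
  apply ofDigits_eq_one (by omega)
  intro k
  have hs : IsSign o := ho ▸ h.adj hl hne
  rw [dig_add_one hn hτ.1 hs, h.turn_line hτ hl hne (s := 1) (by rw [ho, one_mul])]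
  obtain ⟨j, hj⟩ : ∃ j, 2 * n = j + 1 := ⟨2 * n - 1, by omega⟩
  rw [hj]
  exact ZMod.val_neg_one j

lemma digVal_line_eq_zero (hn : 2 ≤ n) (h : IsCyclicPattern W pos) (hτ : IsTurning W pos τ)
    {ξ η : Boundary n} (hl : s(ξ, η) ∈ lineSet W) (hne : ξ.1 0 ≠ η.1 0) {o : ZMod (2 * n)}
    (ho : o = -(pos (η.1 0) - pos (ξ.1 0))) : digVal pos τ hn o ξ = 0 := by
  apply ofDigits_eq_zero
  intro k
  have hs : IsSign o := ho ▸ (h.adj hl hne).neg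
  have h1 := dig_add_one (pos := pos) hn hτ.1 hs ξ k
  rw [h.turn_line hτ hl hne (s := -1) (by rw [ho]; ring), neg_neg] at h1
  have : Fact (1 < 2 * n) := ⟨by omega⟩
  rw [ZMod.val_one] at h1
  omega

lemma eq_of_digVal (hn : 2 ≤ n) (hτ : IsTurning W pos τ) {o : ZMod (2 * n)} (ho : IsSign o)
    {ξ η : Boundary n} (h0 : ξ.1 0 = η.1 0) {c : ℝ} (hc : c = 0 ∨ c = 1)
    (h1 : digVal pos τ hn o ξ = c) (h2 : digVal pos τ hn o η = c) : ξ = η := by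
  refine eq_of_dig_eq (pos := pos) hn hτ.1 ho h0 fun k => Fin.ext ?_
  rcases hc with rfl | rfl
  · rw [eq_zero_of_ofDigits_eq_zero h1, eq_zero_of_ofDigits_eq_zero h2]
  · have e1 := eq_last_of_ofDigits_eq_one h1 k
    have e2 := eq_last_of_ofDigits_eq_one h2 k
    omega

/-- Two adjacent boundary points with extreme digits are the endpoints of a line. -/
lemma mem_lineSet_of_digVal (hn : 2 ≤ n) (h : IsCyclicPattern W pos) (hτ : IsTurning W pos τ)
    {o : ZMod (2 * n)} (ho : IsSign o) {ξ η : Boundary n} (h0 : pos (η.1 0) = pos (ξ.1 0) + o)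
    (h1 : digVal pos τ hn o ξ = 1) (h2 : digVal pos τ hn o η = 0) : s(ξ, η) ∈ lineSet W := by
  obtain ⟨α, β, hl, hα, hβ⟩ := h.exists_line (ξ.1 0) ho
  have hβ' : β.1 0 = η.1 0 := pos.injective (by rw [hβ, h0])
  have hne : α.1 0 ≠ β.1 0 := by
    intro he
    rw [← he, hα, left_eq_add] at hβ
    have h12 := one_ne_neg_one hn
    have := ho.mul_self
    rw [hβ, mul_zero] at this
    apply h12
    linear_combination -2 * this
  have e1 : α = ξ := eq_of_digVal hn hτ ho hα (Or.inr rfl)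
    (h.digVal_line_eq_one hn hτ hl hne (by rw [hβ, hα]; ring)) h1
  have e2 : β = η := eq_of_digVal hn hτ ho hβ' (Or.inl rfl)
    (h.digVal_line_eq_zero hn hτ (by rwa [Sym2.eq_swap]) hne.symm (by rw [hβ, hα]; ring)) h2
  rwa [← e1, ← e2]

lemma digVal_eq_div (hn : 2 ≤ n) (o : ZMod (2 * n)) (ξ : Boundary n) :
    digVal pos τ hn o ξ = ((dig pos τ hn o ξ 0 : ℕ) + digVal pos τ hn (o * τ (ξ.1 0)) (tail ξ)) /
      (2 * n - 1 : ℕ) := by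
  rw [digVal, ofDigits_eq_div]
  simp only [dig_succ]
  rfl

lemma digVal_nonneg (hn : 2 ≤ n) (o : ZMod (2 * n)) (ξ : Boundary n) :
    0 ≤ digVal pos τ hn o ξ := Real.ofDigits_nonneg _

lemma digVal_le_one (hn : 2 ≤ n) (o : ZMod (2 * n)) (ξ : Boundary n) :
    digVal pos τ hn o ξ ≤ 1 := Real.ofDigits_le_one _

/-- The endpoints of a line have the same value. -/
lemma digVal_eq_of_line (hn : 2 ≤ n) (h1 : 1 ∉ W) (h : IsCyclicPattern W pos)
    (hτ : IsTurning W pos τ) {o : ZMod (2 * n)} (ho : IsSign o) {ξ η : Boundary n}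
    (hl : s(ξ, η) ∈ lineSet W) (h0 : ξ.1 0 = η.1 0) :
    digVal pos τ hn o ξ = digVal pos τ hn o η := by
  obtain ⟨k, hk⟩ : ∃ k, ξ.1 k ≠ η.1 k := by
    by_contra! hk
    exact ne_of_mem_lineSet h1 hl (Subtype.ext (funext hk))
  induction k generalizing o ξ η with
  | zero => exact absurd h0 hk
  | succ k ih =>
    have hl' : s(tail ξ, tail η) ∈ lineSet W := by
      have := line_tail hl
      rwa [h0, ltr_inv_smul_eq_tail] at this
    have ho' := ho.mul (hτ.1 (ξ.1 0))
    rw [digVal_eq_div hn o ξ, digVal_eq_div hn o η, ← h0]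
    by_cases h01 : ξ.1 1 = η.1 1
    · rw [ih ho' hl' h01 hk]
      have : dig pos τ hn o ξ 0 = dig pos τ hn o η 0 := by
        apply Fin.ext
        simp only [dig, turn_zero, h0, h01]
      rw [this]
    -- The line splits after the first letter, into adjacent directions. The first digits are
    -- consecutive, and the tails have the values `1` and `0`.
    · have key : ∀ {ξ η : Boundary n}, s(tail ξ, tail η) ∈ lineSet W → ξ.1 0 = η.1 0 →
          ξ.1 1 ≠ η.1 1 → o * τ (ξ.1 0) = pos (η.1 1) - pos (ξ.1 1) →
          ((dig pos τ hn o ξ 0 : ℕ) : ℝ) + digVal pos τ hn (o * τ (ξ.1 0)) (tail ξ) =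
          (dig pos τ hn o η 0 : ℕ) + digVal pos τ hn (o * τ (ξ.1 0)) (tail η) := by
        intro ξ η hl h0 h01 hs
        have ho' := ho.mul (hτ.1 (ξ.1 0))
        rw [h.digVal_line_eq_one hn hτ hl h01 hs, h.digVal_line_eq_zero hn hτ
          (by rwa [Sym2.eq_swap]) (Ne.symm h01) (hs.trans (neg_sub _ _).symm), add_zero]
        have e1 := dig_add_one (pos := pos) hn hτ.1 ho ξ 0
        have e2 := dig_add_one (pos := pos) hn hτ.1 ho η 0
        have e3 : turn pos τ o η 0 = turn pos τ o ξ 0 + 1 := by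
          rw [turn_zero, turn_zero, ← h0]
          linear_combination -(o * τ (ξ.1 0)) * hs + ho'.mul_self
        have hfact : Fact (1 < 2 * n) := ⟨by omega⟩
        have hNZ : NeZero (2 * n) := ⟨by omega⟩
        have hne := turn_ne_zero (pos := pos) hτ.1 ho η 0
        -- Adding one does not wrap around, because the resulting turn would be zero, which means
        -- backtracking.
        have hlt : (turn pos τ o ξ 0).val + (1 : ZMod (2 * n)).val < 2 * n := by
          rw [ZMod.val_one]
          have h1 := ZMod.val_lt (turn pos τ o ξ 0)
          by_contra hcon
          apply hne
          rw [e3, ← ZMod.natCast_zmod_val (turn pos τ o ξ 0), ← Nat.cast_one, ← Nat.cast_add,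
            show (turn pos τ o ξ 0).val + 1 = 2 * n by omega, ZMod.natCast_self]
        rw [e3, ZMod.val_add_of_lt hlt, ZMod.val_one] at e2
        have e4 : (dig pos τ hn o η 0 : ℕ) = (dig pos τ hn o ξ 0 : ℕ) + 1 := by omega
        rw [e4]
        push_cast
        ring
      have hsgn : IsSign (pos (η.1 1) - pos (ξ.1 1)) := h.adj hl' h01
      have hcases : o * τ (ξ.1 0) = pos (η.1 1) - pos (ξ.1 1) ∨
          o * τ (ξ.1 0) = pos (ξ.1 1) - pos (η.1 1) := by
        rcases ho' with e | e <;> rcases hsgn with e' | e'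
        · left; rw [e, e']
        · right; rw [e]; linear_combination e'
        · right; rw [e]; linear_combination e'
        · left; rw [e, e']
      congr 1
      rcases hcases with hs | hs
      · exact key hl' h0 h01 hs
      · have := key (by rwa [Sym2.eq_swap]) h0.symm (Ne.symm h01) (by rwa [← h0])
        rw [← h0] at this
        exact this.symm

/-- Two boundary points with the same first letter and the same value are the endpoints of a
line. -/
lemma eq_or_line_of_digVal_eq (hn : 2 ≤ n) (h : IsCyclicPattern W pos)
    (hτ : IsTurning W pos τ) {o : ZMod (2 * n)} (ho : IsSign o) {ξ η : Boundary n}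
    (h0 : ξ.1 0 = η.1 0) (heq : digVal pos τ hn o ξ = digVal pos τ hn o η) :
    ξ = η ∨ s(ξ, η) ∈ lineSet W := by
  by_cases hall : ∀ k, dig pos τ hn o ξ k = dig pos τ hn o η k
  · exact Or.inl (eq_of_dig_eq hn hτ.1 ho h0 hall)
  right
  push Not at hall
  obtain ⟨k, hk⟩ := hall
  induction k using Nat.strong_induction_on generalizing o ξ η with
  | _ k ih =>
  have ho' := ho.mul (hτ.1 (ξ.1 0))
  have hb : (0 : ℝ) < (2 * n - 1 : ℕ) := by
    exact_mod_cast (by omega : 0 < 2 * n - 1)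
  have hsm : s(tail ξ, tail η) ∈ lineSet W → s(ξ, η) ∈ lineSet W := by
    intro hl
    have := smul_mem_lineSet hl (ltr (ξ.1 0))
    rwa [ltr_smul_tail, h0, ltr_smul_tail] at this
  by_cases hd : dig pos τ hn o ξ 0 = dig pos τ hn o η 0
  · cases k with
    | zero => exact absurd hd hk
    | succ k =>
      apply hsm
      refine ih k (by omega) ho' ?_ ?_ ?_
      · refine eq_of_turn_eq (pos := pos) hτ.1 ho h0 ?_
        rw [← cast_dig_add_one hn hτ.1 ho, ← cast_dig_add_one hn hτ.1 ho, hd]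
      · rw [digVal_eq_div, digVal_eq_div (ξ := η), div_left_inj' hb.ne', hd, ← h0] at heq
        linarith
      · rwa [dig_succ, dig_succ, ← h0] at hk
  -- When the first digits differ, tails in `[0, 1]` can compensate only if the digits are
  -- consecutive and the tails are exactly `1` and `0`.
  · have key : ∀ {ξ η : Boundary n}, ξ.1 0 = η.1 0 →
        digVal pos τ hn o ξ = digVal pos τ hn o η →
        dig pos τ hn o ξ 0 < dig pos τ hn o η 0 → s(tail ξ, tail η) ∈ lineSet W := by
      intro ξ η h0 heq hlt
      have ho' := ho.mul (hτ.1 (ξ.1 0))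
      rw [digVal_eq_div, digVal_eq_div (ξ := η), div_left_inj' hb.ne', ← h0] at heq
      have a1 := digVal_le_one (pos := pos) (τ := τ) hn (o * τ (ξ.1 0)) (tail ξ)
      have a2 := digVal_nonneg (pos := pos) (τ := τ) hn (o * τ (ξ.1 0)) (tail η)
      have hlt' : (dig pos τ hn o ξ 0 : ℕ) + 1 ≤ (dig pos τ hn o η 0 : ℕ) := hlt
      have hltR : ((dig pos τ hn o ξ 0 : ℕ) : ℝ) + 1 ≤ (dig pos τ hn o η 0 : ℕ) := by
        exact_mod_cast hlt'
      have hdig : (dig pos τ hn o η 0 : ℕ) = (dig pos τ hn o ξ 0 : ℕ) + 1 := by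
        have : ((dig pos τ hn o η 0 : ℕ) : ℝ) = (dig pos τ hn o ξ 0 : ℕ) + 1 := by linarith
        exact_mod_cast this
      refine h.mem_lineSet_of_digVal hn hτ ho' ?_ (by linarith) (by linarith)
      have e1 := cast_dig_add_one (pos := pos) hn hτ.1 ho ξ 0
      have e2 := cast_dig_add_one (pos := pos) hn hτ.1 ho η 0
      rw [hdig, turn_zero, ← h0] at e2
      rw [turn_zero] at e1
      push_cast at e2
      change pos (η.1 1) = pos (ξ.1 1) + _
      have hsq := ho'.mul_self
      have e3 : o * τ (ξ.1 0) * (pos (η.1 1) - pos (ξ.1 1)) = 1 := by linear_combination e1 - e2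
      linear_combination (o * τ (ξ.1 0)) * e3 - (pos (η.1 1) - pos (ξ.1 1)) * hsq
    apply hsm
    rcases lt_or_gt_of_ne hd with hlt | hlt
    · exact key h0 heq hlt
    · rw [Sym2.eq_swap]; exact key h0.symm heq.symm hlt

end IsCyclicPattern

end LinePattern

end

/-! ### The homeomorphism from the decomposition space to a circle. -/

section

open Filter Topology

namespace LinePattern

namespace IsCyclicPattern

variable {n : ℕ} {W : Set (FreeGroup (Fin n))} {pos : Fin n × Bool ≃ ZMod (2 * n)}
  {τ : Fin n × Bool → ZMod (2 * n)}

lemma continuous_digVal (hn : 2 ≤ n) (o : ZMod (2 * n)) : Continuous (digVal pos τ hn o) := by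
  refine Real.continuous_ofDigits.comp (continuous_pi fun k => IsLocallyConstant.continuous ?_)
  rw [IsLocallyConstant.iff_eventually_eq]
  intro ξ
  filter_upwards [cyl_mem_nhds ξ (k + 2)] with η hη
  have h1 : orient τ o η (k + 1) = orient τ o ξ (k + 1) := by
    rw [orient, orient]
    congr 1
    refine Finset.prod_congr rfl fun i hi => ?_
    rw [hη i (by have := Finset.mem_range.1 hi; omega)]
  simp only [dig, turn, h1, hη k (by omega), hη (k + 1) (by omega)]

/-- The map from the boundary to a circle of length `2 * n`, under which the component at position
`i` is sent to the arc from `i` to `i + 1`. -/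
noncomputable def circleMap (pos : Fin n × Bool ≃ ZMod (2 * n)) (τ : Fin n × Bool → ZMod (2 * n))
    (hn : 2 ≤ n) (ξ : Boundary n) : AddCircle ((2 * n : ℕ) : ℝ) :=
  (((pos (ξ.1 0)).val + digVal pos τ hn 1 ξ : ℝ) : AddCircle ((2 * n : ℕ) : ℝ))

lemma continuous_circleMap (hn : 2 ≤ n) : Continuous (circleMap pos τ hn) := by
  refine (AddCircle.continuous_mk' _).comp (Continuous.add ?_ (continuous_digVal hn 1))
  have h : Continuous fun y : Fin n × Bool => ((pos y).val : ℝ) := continuous_of_discreteTopology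
  exact h.comp ((continuous_apply 0).comp continuous_subtype_val)

lemma circleMap_eq_iff (hn : 2 ≤ n) {ξ η : Boundary n} :
    circleMap pos τ hn ξ = circleMap pos τ hn η ↔
      ∃ m : ℤ, digVal pos τ hn 1 ξ - digVal pos τ hn 1 η = m ∧
        pos (η.1 0) - pos (ξ.1 0) = m := by
  have hNZ : NeZero (2 * n) := ⟨by omega⟩
  rw [circleMap, circleMap, ← sub_eq_zero, ← AddCircle.coe_sub, AddCircle.coe_eq_zero_iff]
  constructor
  · rintro ⟨k, hk⟩
    refine ⟨k * (2 * n : ℕ) - (pos (ξ.1 0)).val + (pos (η.1 0)).val, ?_, ?_⟩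
    · rw [zsmul_eq_mul] at hk
      push_cast at hk ⊢
      linarith
    · rw [Int.cast_add, Int.cast_sub, Int.cast_mul, Int.cast_natCast, Int.cast_natCast,
        Int.cast_natCast, ZMod.natCast_self, ZMod.natCast_zmod_val, ZMod.natCast_zmod_val]
      ring
  · rintro ⟨m, h1, h2⟩
    have h3 : (((pos (η.1 0)).val - (pos (ξ.1 0)).val - m : ℤ) : ZMod (2 * n)) = 0 := by
      rw [Int.cast_sub, Int.cast_sub, Int.cast_natCast, Int.cast_natCast,
        ZMod.natCast_zmod_val, ZMod.natCast_zmod_val, h2, sub_self]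
    rw [ZMod.intCast_zmod_eq_zero_iff_dvd] at h3
    obtain ⟨c, hc⟩ := h3
    refine ⟨-c, ?_⟩
    have h4 := congrArg (Int.cast : ℤ → ℝ) hc
    rw [zsmul_eq_mul]
    push_cast at h4 ⊢
    linarith

lemma circleMap_surjective (hn : 2 ≤ n) (hτ : IsTurning W pos τ) :
    Function.Surjective (circleMap pos τ hn) := by
  have hNZ : NeZero (2 * n) := ⟨by omega⟩
  intro x
  obtain ⟨r, rfl⟩ := QuotientAddGroup.mk_surjective x
  obtain ⟨d, -, hd⟩ := Real.ofDigits_SurjOn (b := 2 * n - 1) (by omega)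
    (show Int.fract r ∈ Set.Icc (0 : ℝ) 1 from ⟨Int.fract_nonneg r, (Int.fract_lt_one r).le⟩)
  obtain ⟨ξ, h0, hξ⟩ := exists_dig_eq (pos := pos) hn hτ.1 (Or.inl rfl)
    (pos.symm (⌊r⌋ : ZMod (2 * n))) d
  refine ⟨ξ, ?_⟩
  change _ = ((r : ℝ) : AddCircle ((2 * n : ℕ) : ℝ))
  rw [circleMap, ← sub_eq_zero, ← AddCircle.coe_sub, AddCircle.coe_eq_zero_iff, digVal,
    show dig pos τ hn 1 ξ = d from funext hξ, hd, h0, Equiv.apply_symm_apply]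
  have h3 : ((((⌊r⌋ : ZMod (2 * n)).val : ℤ) - ⌊r⌋ : ℤ) : ZMod (2 * n)) = 0 := by
    rw [Int.cast_sub, Int.cast_natCast, ZMod.natCast_zmod_val, sub_self]
  rw [ZMod.intCast_zmod_eq_zero_iff_dvd] at h3
  obtain ⟨c, hc⟩ := h3
  refine ⟨c, ?_⟩
  have h4 := congrArg (Int.cast : ℤ → ℝ) hc
  have h5 := Int.floor_add_fract r
  rw [zsmul_eq_mul]
  push_cast at h4 ⊢
  linarith

lemma circleMap_eq_of_line (hn : 2 ≤ n) (h1 : 1 ∉ W) (h : IsCyclicPattern W pos)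
    (hτ : IsTurning W pos τ) {ξ η : Boundary n} (hl : s(ξ, η) ∈ lineSet W) :
    circleMap pos τ hn ξ = circleMap pos τ hn η := by
  rw [circleMap_eq_iff]
  by_cases h0 : ξ.1 0 = η.1 0
  · exact ⟨0, by rw [h.digVal_eq_of_line hn h1 hτ (Or.inl rfl) hl h0]; simp, by rw [h0]; simp⟩
  have hl' : s(η, ξ) ∈ lineSet W := by rwa [Sym2.eq_swap]
  rcases h.adj hl h0 with hs | hs
  · refine ⟨1, ?_, by rw [hs]; simp⟩
    rw [h.digVal_line_eq_one hn hτ hl h0 hs.symm,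
      h.digVal_line_eq_zero hn hτ hl' (Ne.symm h0) (by rw [neg_sub, hs])]
    simp
  · refine ⟨-1, ?_, by rw [hs]; simp⟩
    rw [h.digVal_line_eq_zero hn hτ hl h0 (by rw [hs, neg_neg]),
      h.digVal_line_eq_one hn hτ hl' (Ne.symm h0) (by rw [← neg_sub, hs, neg_neg])]
    simp

lemma eq_or_line_of_circleMap_eq (hn : 2 ≤ n) (h : IsCyclicPattern W pos)
    (hτ : IsTurning W pos τ) {ξ η : Boundary n}
    (heq : circleMap pos τ hn ξ = circleMap pos τ hn η) : ξ = η ∨ s(ξ, η) ∈ lineSet W := by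
  obtain ⟨m, hm, hm'⟩ := (circleMap_eq_iff hn).1 heq
  have a1 := digVal_le_one (pos := pos) (τ := τ) hn 1 ξ
  have a2 := digVal_nonneg (pos := pos) (τ := τ) hn 1 ξ
  have b1 := digVal_le_one (pos := pos) (τ := τ) hn 1 η
  have b2 := digVal_nonneg (pos := pos) (τ := τ) hn 1 η
  have hm1 : m ≤ 1 := by
    have : (m : ℝ) ≤ (1 : ℤ) := by rw [← hm]; push_cast; linarith
    exact_mod_cast this
  have hm2 : -1 ≤ m := by
    have : ((-1 : ℤ) : ℝ) ≤ m := by rw [← hm]; push_cast; linarith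
    exact_mod_cast this
  -- For `m = 0` both points lie in one component; for `m = ±1` they lie over the common endpoint of
  -- two adjacent arcs.
  obtain rfl | rfl | rfl : m = -1 ∨ m = 0 ∨ m = 1 := by omega
  · right
    rw [Sym2.eq_swap]
    push_cast at hm hm'
    exact h.mem_lineSet_of_digVal hn hτ (Or.inl rfl) (by linear_combination -hm')
      (by linarith) (by linarith)
  · rw [Int.cast_zero, sub_eq_zero] at hm hm'
    exact h.eq_or_line_of_digVal_eq hn hτ (Or.inl rfl) (pos.injective hm'.symm) hm
  · right
    push_cast at hm hm'
    exact h.mem_lineSet_of_digVal hn hτ (Or.inl rfl) (by linear_combination hm')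
      (by linarith) (by linarith)

end IsCyclicPattern

open IsCyclicPattern in
/-- If the Whitehead graph is a circle, then so is the decomposition space. -/
theorem nonempty_homeomorph_circle {F : Type*} [Group F] {n : ℕ} (hn : 2 ≤ n)
    {B : FreeGroupBasis (Fin n) F} {W : Set F} (hW : (1 : F) ∉ W)
    (h : (whiteheadGraph B W).IsCircle) : Nonempty (DecompositionSpace B W ≃ₜ Circle) := by
  obtain ⟨pos, hp⟩ := exists_isCyclicPattern hn h
  obtain ⟨τ, hτ⟩ := hp.exists_isTurning hn
  have h1 : 1 ∉ B.repr '' W := by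
    rintro ⟨w, hw, hw1⟩
    rw [map_eq_one_iff _ B.repr.injective] at hw1
    exact hW (hw1 ▸ hw)
  let f : DecompositionSpace B W → AddCircle ((2 * n : ℕ) : ℝ) :=
    Quot.lift (circleMap pos τ hn) fun ξ η hl =>
      hp.circleMap_eq_of_line hn h1 hτ (by rwa [← lines_eq])
  have hf : Continuous f := continuous_quot_lift _ (continuous_circleMap hn)
  have hinj : Function.Injective f := by
    rintro ⟨ξ⟩ ⟨η⟩ he
    rcases hp.eq_or_line_of_circleMap_eq hn hτ he with rfl | hl
    · rfl
    · exact Quot.sound (by rwa [lines_eq])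
  have hsurj : Function.Surjective f := fun x => by
    obtain ⟨ξ, hξ⟩ := circleMap_surjective hn hτ x
    exact ⟨Quot.mk _ ξ, hξ⟩
  have hT : ((2 * n : ℕ) : ℝ) ≠ 0 := by
    exact_mod_cast (by omega : 2 * n ≠ 0)
  have : Fact (0 < ((2 * n : ℕ) : ℝ)) := ⟨by exact_mod_cast (by omega : 0 < 2 * n)⟩
  -- A continuous bijection from a compact space to a Hausdorff space is a homeomorphism.
  exact ⟨(Continuous.homeoOfEquivCompactToT2 (f := Equiv.ofBijective f ⟨hinj, hsurj⟩) hf).trans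
    (AddCircle.homeomorphCircle hT)⟩

end LinePattern

end

/-! ### Cut sets of the circle. -/

section

open Filter Topology

lemma isCutSet_image_iff {X Y : Type*} [TopologicalSpace X] [TopologicalSpace Y] (e : X ≃ₜ Y)
    (S : Set X) : IsCutSet (e '' S) ↔ IsCutSet S := by
  rw [IsCutSet, IsCutSet, ← Set.image_compl_eq e.bijective, e.isPreconnected_image]

lemma IsMinimalCutSet.image {X Y : Type*} [TopologicalSpace X] [TopologicalSpace Y] (e : X ≃ₜ Y)
    {S : Set X} (h : IsMinimalCutSet S) : IsMinimalCutSet (e '' S) := by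
  refine ⟨(isCutSet_image_iff e S).2 h.1, fun T hT hcut => ?_⟩
  refine h.2 (e.symm '' T) ?_ ((isCutSet_image_iff e.symm T).2 hcut)
  have := e.symm.injective.image_strictMono hT
  rwa [← Set.image_comp, e.symm_comp_self, Set.image_id] at this

lemma encard_eq_two_of_homeomorph {X Y : Type*} [TopologicalSpace X] [TopologicalSpace Y]
    (e : X ≃ₜ Y) (h : ∀ S : Set Y, IsMinimalCutSet S → S.encard = 2) (S : Set X)
    (hS : IsMinimalCutSet S) : S.encard = 2 := by
  rw [← h _ (hS.image e), e.injective.encard_image]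

namespace AddCircle

lemma exists_Ioo_rep (s : ℝ) {y : AddCircle (1 : ℝ)} (hy : y ≠ (s : AddCircle (1 : ℝ))) :
    ∃ t ∈ Set.Ioo s (s + 1), (t : AddCircle (1 : ℝ)) = y := by
  have hfact : Fact ((0 : ℝ) < 1) := ⟨one_pos⟩
  have h1 : y ∈ ((↑) : ℝ → AddCircle (1 : ℝ)) '' Set.Ico s (s + 1) := by
    rw [AddCircle.coe_image_Ico_eq]; trivial
  obtain ⟨t, ht, rfl⟩ := h1
  refine ⟨t, ⟨lt_of_le_of_ne ht.1 ?_, ht.2⟩, rfl⟩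
  rintro rfl
  exact hy rfl

lemma isCutSet_pair {a b : AddCircle (1 : ℝ)} (hab : a ≠ b) : IsCutSet {a, b} := by
  have hfact : Fact ((0 : ℝ) < 1) := ⟨one_pos⟩
  obtain ⟨s, rfl⟩ := QuotientAddGroup.mk_surjective a
  obtain ⟨t, ⟨hst, hts⟩, rfl⟩ := exists_Ioo_rep s hab.symm
  have hinj : ∀ {x y : ℝ}, x ∈ Set.Ico s (s + 1) → y ∈ Set.Ico s (s + 1) →
      (x : AddCircle (1 : ℝ)) = y → x = y := fun hx hy h =>
    (AddCircle.coe_eq_coe_iff_of_mem_Ico hx hy).1 h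
  have hne : ∀ x ∈ Set.Ioo s (s + 1), x ≠ t → (x : AddCircle (1 : ℝ)) ∈
      ({(s : AddCircle (1 : ℝ)), (t : AddCircle (1 : ℝ))} : Set (AddCircle (1 : ℝ)))ᶜ := by
    rintro x ⟨hx1, hx2⟩ hxt (h | h)
    · exact hx1.ne' (hinj ⟨hx1.le, hx2⟩ ⟨le_rfl, by linarith⟩ h)
    · exact hxt (hinj ⟨hx1.le, hx2⟩ ⟨hst.le, hts⟩ h)
  intro hpre
  have hopen : ∀ u v : ℝ, IsOpen (((↑) : ℝ → AddCircle (1 : ℝ)) '' Set.Ioo u v) := fun u v =>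
    QuotientAddGroup.isOpenMap_coe _ isOpen_Ioo
  obtain ⟨z, -, ⟨x, hx, rfl⟩, y, hy, hxy⟩ := hpre _ _ (hopen s t) (hopen t (s + 1))
    (by
      intro z hz
      obtain ⟨x, hx, rfl⟩ := exists_Ioo_rep s (y := z) (fun h => hz (Or.inl h))
      rcases lt_trichotomy x t with h | rfl | h
      · exact Or.inl ⟨x, ⟨hx.1, h⟩, rfl⟩
      · exact absurd (Or.inr rfl) hz
      · exact Or.inr ⟨x, ⟨h, hx.2⟩, rfl⟩)
    ⟨(((s + t) / 2 : ℝ) : AddCircle (1 : ℝ)),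
      hne _ ⟨by linarith, by linarith⟩ (by intro h; linarith), _, ⟨by linarith, by linarith⟩, rfl⟩
    ⟨(((t + (s + 1)) / 2 : ℝ) : AddCircle (1 : ℝ)),
      hne _ ⟨by linarith, by linarith⟩ (by intro h; linarith), _, ⟨by linarith, by linarith⟩, rfl⟩
  have := hinj ⟨by linarith [hy.1], hy.2⟩ ⟨hx.1.le, by linarith [hx.2]⟩ hxy
  linarith [hx.2, hy.1]

/-- Two points of the complement that lie in no connected part of it divide the circle into two
arcs. Each arc meets `S`, and the arcs share only the two chosen points. -/
lemma exists_ne_of_isCutSet {S : Set (AddCircle (1 : ℝ))} (hS : IsCutSet S) :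
    ∃ a ∈ S, ∃ b ∈ S, a ≠ b := by
  have hfact : Fact ((0 : ℝ) < 1) := ⟨one_pos⟩
  obtain ⟨x, hx, y, hy, hxy⟩ : ∃ x ∈ Sᶜ, ∃ y ∈ Sᶜ, ∀ t ⊆ Sᶜ, x ∈ t → y ∈ t →
      ¬ IsPreconnected t := by
    by_contra! h
    exact hS (isPreconnected_of_forall_pair fun x hx y hy => by
      obtain ⟨t, h1, h2, h3, h4⟩ := h x hx y hy
      exact ⟨t, h1, h2, h3, h4⟩)
  obtain ⟨s, rfl⟩ := QuotientAddGroup.mk_surjective x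
  have hne : y ≠ (s : AddCircle (1 : ℝ)) := by
    rintro rfl
    exact hxy {_} (Set.singleton_subset_iff.2 hx) rfl rfl isPreconnected_singleton
  obtain ⟨t, ⟨hst, hts⟩, rfl⟩ := exists_Ioo_rep s hne
  have hs1 : ((s + 1 : ℝ) : AddCircle (1 : ℝ)) = s := by simp
  have key : ∀ u v : ℝ, u ≤ v → (u : AddCircle (1 : ℝ)) ∉ S → (v : AddCircle (1 : ℝ)) ∉ S →
      ¬ (((↑) : ℝ → AddCircle (1 : ℝ)) '' Set.Icc u v ⊆ Sᶜ) →
      ∃ r ∈ Set.Ioo u v, (r : AddCircle (1 : ℝ)) ∈ S := by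
    intro u v huv hu hv h
    rw [Set.not_subset] at h
    obtain ⟨_, ⟨r, hr, rfl⟩, hrS⟩ := h
    rw [Set.notMem_compl_iff] at hrS
    refine ⟨r, ⟨lt_of_le_of_ne hr.1 ?_, lt_of_le_of_ne hr.2 ?_⟩, hrS⟩
    · rintro rfl; exact hu hrS
    · rintro rfl; exact hv hrS
  have hpre : ∀ u v : ℝ, IsPreconnected (((↑) : ℝ → AddCircle (1 : ℝ)) '' Set.Icc u v) :=
    fun u v => isPreconnected_Icc.image _ (AddCircle.continuous_mk' 1).continuousOn
  obtain ⟨r, hr, hrS⟩ := key s t hst.le hx hy fun h => hxy _ h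
    ⟨s, ⟨le_rfl, hst.le⟩, rfl⟩ ⟨t, ⟨hst.le, le_rfl⟩, rfl⟩ (hpre _ _)
  obtain ⟨r', hr', hrS'⟩ := key t (s + 1) hts.le hy (by rw [hs1]; exact hx) fun h => hxy _ h
    ⟨s + 1, ⟨hts.le, le_rfl⟩, hs1⟩ ⟨t, ⟨le_rfl, hts.le⟩, rfl⟩ (hpre _ _)
  refine ⟨_, hrS, _, hrS', fun h => ?_⟩
  have := (AddCircle.coe_eq_coe_iff_of_mem_Ico (a := s)
    ⟨hr.1.le, by linarith [hr.2]⟩ ⟨by linarith [hr'.1], hr'.2⟩).1 h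
  linarith [hr.2, hr'.1]

lemma encard_of_isMinimalCutSet (S : Set (AddCircle (1 : ℝ))) (hS : IsMinimalCutSet S) :
    S.encard = 2 := by
  obtain ⟨a, ha, b, hb, hab⟩ := exists_ne_of_isCutSet hS.1
  have hsub : {a, b} ⊆ S := Set.insert_subset ha (Set.singleton_subset_iff.2 hb)
  have : {a, b} = S := by
    by_contra hne
    exact hS.2 _ (hsub.ssubset_of_ne hne) (isCutSet_pair hab)
  rw [← this, Set.encard_pair hab]

end AddCircle

end

/-! ### Colourings of the boundary that respect the lines. -/

section

open Filter Topology

namespace LinePattern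

variable {n : ℕ} {W : Set (FreeGroup (Fin n))}

/-- The boundary points whose first letter is `z`. -/
def half (z : Fin n × Bool) : Set (Boundary n) := {ξ | ξ.1 0 = z}

lemma isClopen_half (z : Fin n × Bool) : IsClopen (half z) :=
  (isClopen_discrete {z}).preimage (continuous_letter 0)

/-- A map that is locally constant on an open set `A` and constant on the pairs of endpoints of
lines in `A`. -/
def IsLineColoring (W : Set (FreeGroup (Fin n))) (A : Set (Boundary n)) (c : Boundary n → Bool) :
    Prop :=
  (∀ ξ ∈ A, ∀ᶠ η in 𝓝 ξ, c η = c ξ) ∧ ∀ ξ ∈ A, ∀ η ∈ A, s(ξ, η) ∈ lineSet W → c ξ = c η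

lemma IsLineColoring.mono {A A' : Set (Boundary n)} {c : Boundary n → Bool}
    (h : IsLineColoring W A c) (hA : A' ⊆ A) : IsLineColoring W A' c :=
  ⟨fun ξ hξ => h.1 ξ (hA hξ), fun ξ hξ η hη => h.2 ξ (hA hξ) η (hA hη)⟩

lemma IsLineColoring.comp_smul {A : Set (Boundary n)} {c : Boundary n → Bool}
    (h : IsLineColoring W A c) (g : FreeGroup (Fin n)) :
    IsLineColoring W {ξ | g • ξ ∈ A} fun ξ => c (g • ξ) :=
  ⟨fun _ hξ => (continuous_const_smul g).continuousAt.eventually (h.1 _ hξ),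
    fun _ hξ _ hη hl => h.2 _ hξ _ hη (smul_mem_lineSet hl g)⟩

/-- The Whitehead graph stays connected when a vertex is deleted. -/
def ConnectedOff (W : Set (FreeGroup (Fin n))) : Prop :=
  ∀ v x y, x ≠ v → y ≠ v →
    Relation.ReflTransGen (fun a b => WAdj W a b ∧ a ≠ v ∧ b ≠ v) x y

/-- A colouring is constant on the shadow `g • half z`. -/
def ConstOn (c : Boundary n → Bool) (g : FreeGroup (Fin n)) (z : Fin n × Bool) : Prop :=
  ∀ ξ ∈ half z, ∀ η ∈ half z, c (g • ξ) = c (g • η)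

/-- Lines carry the colour from one shadow behind the next vertex to another. These shadows are the
vertices of the Whitehead graph other than `flip z`, and they remain connected to each other. -/
lemma constOn_of_forall (hW : ConnectedOff W) {c : Boundary n → Bool} {g : FreeGroup (Fin n)}
    {z : Fin n × Bool} (hc : IsLineColoring W {ξ | g⁻¹ • ξ ∈ half z} c)
    (h : ∀ z', z' ≠ flip z → ConstOn c (g * ltr z) z') : ConstOn c g z := by
  intro ξ hξ η hη
  have key : ∀ b, Relation.ReflTransGen (fun a b => WAdj W a b ∧ a ≠ flip z ∧ b ≠ flip z)
      (ξ.1 1) b → ∀ ζ ∈ half b, b ≠ flip z → c (g • ltr z • ζ) = c (g • ξ) := by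
    have e : g • ξ = (g * ltr z) • tail ξ := by
      rw [mul_smul, ← show ξ.1 0 = z from hξ, ltr_smul_tail]
    intro b hb
    induction hb with
    | refl =>
      intro ζ hζ hz
      rw [← mul_smul, e]
      exact h _ hz ζ hζ (tail ξ) rfl
    | tail _ hab ih =>
      intro ζ hζ hz
      obtain ⟨⟨-, α, β, hl, hα, hβ⟩, ha, hb⟩ := hab
      rw [← ih α hα ha, ← mul_smul, h _ hz ζ hζ β hβ, ← mul_smul]
      have hα' : α.1 0 ≠ flip z := by rwa [hα]
      have hβ' : β.1 0 ≠ flip z := by rwa [hβ]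
      refine hc.2 _ ?_ _ ?_ ?_
      · simpa [mul_smul, half] using ltr_smul_zero hβ'
      · simpa [mul_smul, half] using ltr_smul_zero hα'
      · rw [Sym2.eq_swap]
        exact smul_mem_lineSet hl _
  have hz1 : ξ.1 1 ≠ flip z := by rw [← show ξ.1 0 = z from hξ]; exact ξ.succ_ne 0
  have hz2 : η.1 1 ≠ flip z := by rw [← show η.1 0 = z from hη]; exact η.succ_ne 0
  have := key _ (hW _ _ _ hz1 hz2) (tail η) rfl hz2
  rw [← show η.1 0 = z from hη, ltr_smul_tail] at this
  exact this.symm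

lemma half_subset {g : FreeGroup (Fin n)} {z z' : Fin n × Bool} (hz : z' ≠ flip z) :
    {ξ : Boundary n | (g * ltr z)⁻¹ • ξ ∈ half z'} ⊆ {ξ | g⁻¹ • ξ ∈ half z} := by
  intro ξ hξ
  have h1 : ((g * ltr z)⁻¹ • ξ).1 0 = z' := hξ
  have e : g⁻¹ • ξ = ltr z • (g * ltr z)⁻¹ • ξ := by
    rw [mul_inv_rev, mul_smul, smul_inv_smul]
  change (g⁻¹ • ξ).1 0 = z
  rw [e]
  exact ltr_smul_zero (by rwa [h1])

/-- A line-respecting colouring of the shadow of a vertex is constant. -/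
lemma IsLineColoring.constOn (hW : ConnectedOff W) {c : Boundary n → Bool}
    {g : FreeGroup (Fin n)} {z : Fin n × Bool}
    (hc : IsLineColoring W {ξ | g⁻¹ • ξ ∈ half z} c) : ConstOn c g z := by
  by_contra hnot
  -- A shadow that is not monochromatic contains a smaller one of the same kind, and so on along a
  -- ray. At the end of the ray this contradicts local constancy.
  let S := {p : FreeGroup (Fin n) × (Fin n × Bool) //
    IsLineColoring W {ξ | p.1⁻¹ • ξ ∈ half p.2} c ∧ ¬ ConstOn c p.1 p.2}
  have step : ∀ p : S, ∃ q : S, q.1.1 = p.1.1 * ltr p.1.2 ∧ q.1.2 ≠ flip p.1.2 := by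
    rintro ⟨⟨g, z⟩, h1, h2⟩
    have : ∃ z', z' ≠ flip z ∧ ¬ ConstOn c (g * ltr z) z' := by
      by_contra! h3
      exact h2 (constOn_of_forall hW h1 h3)
    obtain ⟨z', hz, h3⟩ := this
    exact ⟨⟨⟨g * ltr z, z'⟩, h1.mono (half_subset hz), h3⟩, rfl, hz⟩
  choose f hf using step
  let s : ℕ → S := fun k => f^[k] ⟨⟨g, z⟩, hc, hnot⟩
  have hs : ∀ k, s (k + 1) = f (s k) := fun k => Function.iterate_succ_apply' f k _
  let ξ : Boundary n := ⟨fun k => (s k).1.2, fun k => by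
    change (s (k + 1)).1.2 ≠ _
    rw [hs]
    exact (hf (s k)).2⟩
  have hpre : ∀ k, (s k).1.1 = g * pre ξ k := by
    intro k
    induction k with
    | zero => simp [s]
    | succ k ih => rw [hs, (hf (s k)).1, ih, pre_succ, mul_assoc]
  have hmem : g • ξ ∈ {ξ | g⁻¹ • ξ ∈ half z} := by
    change g⁻¹ • g • ξ ∈ half z
    rw [inv_smul_smul]
    rfl
  have hev := (continuous_const_smul g).continuousAt.eventually (hc.1 _ hmem)
  obtain ⟨k, hk⟩ := exists_cyl_subset hev
  apply (s k).2.2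
  have key : ∀ η ∈ half (s k).1.2, c ((s k).1.1 • η) = c (g • ξ) := by
    intro η hη
    rw [hpre, mul_smul]
    apply hk
    have := (pre_inv_smul_zero_iff ξ (pre ξ k • η) k).1 (by rw [inv_smul_smul]; exact hη)
    exact fun i hi => this i hi.le
  intro η hη η' hη'
  rw [key η hη, key η' hη']

/-- The endpoints with first letter `v` of lines with other endpoint in a different component. -/
def cross (W : Set (FreeGroup (Fin n))) (v : Fin n × Bool) : Set (Boundary n) :=
  {ξ | ξ.1 0 = v ∧ ∃ η, s(ξ, η) ∈ lineSet W ∧ η.1 0 ≠ v}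

lemma finite_cross (h1 : 1 ∉ W) (hfin : W.Finite) (v : Fin n × Bool) : (cross W v).Finite := by
  refine ((finite_crossing h1 hfin).image Prod.fst).subset ?_
  rintro ξ ⟨hξ, η, hl, hη⟩
  exact ⟨(ξ, η), ⟨hl, by rw [hξ]; exact hη.symm⟩, rfl⟩

lemma IsAxis.eventually_smul_mem {u : FreeGroup (Fin n)} {p q : Boundary n} (h : IsAxis u p q)
    {A E : Set (Boundary n)} (hA : IsCompact A) (hq : q ∉ A) (hE : E ∈ 𝓝 p) :
    ∀ᶠ i in atTop, ∀ y ∈ A, u ^ i • y ∈ E := by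
  refine hA.induction_on (p := fun A => ∀ᶠ i in atTop, ∀ y ∈ A, u ^ i • y ∈ E) (by simp)
    (fun s t hst ht => ht.mono fun i hi y hy => hi y (hst hy))
    (fun s t hs ht => (hs.and ht).mono fun i hi y hy => hy.elim (hi.1 y) (hi.2 y))
    fun x hx => ?_
  obtain ⟨N, hN, h2⟩ := h.tendsto_smul (x := x) (fun e => hq (e ▸ hx)) hE
  exact ⟨N, mem_nhdsWithin_of_mem_nhds hN, h2⟩

lemma IsAxis.pow {u : FreeGroup (Fin n)} {p q : Boundary n} (h : IsAxis u p q) {I : ℕ}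
    (hI : 0 < I) : IsAxis (u ^ I) p q := by
  have t : Tendsto (fun m : ℕ => I * m) atTop atTop := tendsto_id.const_mul_atTop' hI
  have h1 := h.2.1.comp t
  have h2 := h.2.2.comp t
  simp only [pow_mul] at h1 h2
  refine ⟨fun h3 => ?_, h1, by simpa [inv_pow] using h2⟩
  rw [h3] at h1
  obtain ⟨m, hm⟩ := (h1 1).exists
  have := hm.le_norm
  simp at this

/-- A colouring near the endpoint `p` of a line, both of whose colours occur arbitrarily close to
`p`, yields a non-constant colouring of the complement of the endpoints of the line. -/
lemma exists_coloring_of_mixed (hW : ConnectedOff W) {u : FreeGroup (Fin n)} {p q : Boundary n}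
    (h : IsAxis u p q) {E₀ : Set (Boundary n)} (hE₀ : E₀ ∈ 𝓝 p) {c : Boundary n → Bool}
    (hc : IsLineColoring W (E₀ \ {p}) c) (hmix : ∀ b, ¬ ∀ᶠ y in 𝓝[≠] p, c y = b) :
    ∃ c', IsLineColoring W {p, q}ᶜ c' ∧ ∃ x ∈ ({p, q}ᶜ : Set (Boundary n)),
      ∃ y ∈ ({p, q}ᶜ : Set (Boundary n)), c' x ≠ c' y := by
  have hpq := h.ne
  obtain ⟨E, hE, hEp, hEq, hEE⟩ : ∃ E : Set (Boundary n), IsClopen E ∧ p ∈ E ∧ q ∉ E ∧ E ⊆ E₀ := by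
    obtain ⟨k, hk⟩ := exists_cyl_subset (inter_mem hE₀ (isOpen_compl_singleton.mem_nhds hpq))
    exact ⟨cyl p k, isClopen_cyl p k, mem_cyl_self p k, fun hq => (hk hq).2 rfl,
      fun y hy => (hk hy).1⟩
  -- A suitable power of `u` maps the clopen neighbourhood `E` of `p` into itself.
  obtain ⟨I, hI, hI0⟩ := ((h.eventually_smul_mem hE.isClosed.isCompact hEq
    (hE.isOpen.mem_nhds hEp)).and (eventually_gt_atTop 0)).exists
  have hw := h.pow hI0
  clear h
  revert hI hw
  generalize u ^ I = w
  intro hI hw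
  have hp : ∀ i, w ^ i • p = p := fun i => by
    induction i with
    | zero => simp
    | succ i ih => rw [pow_succ, mul_smul, hw.smul_left, ih]
  -- A small shadow around `x` is carried into `E₀ \ {p}` by high powers of `w`, where shadows are
  -- monochromatic. The neighbourhood `N` does not depend on the power.
  have huni : ∀ x, x ≠ p → x ≠ q →
      ∃ N ∈ 𝓝 x, ∀ᶠ i in atTop, ∀ y ∈ N, c (w ^ i • y) = c (w ^ i • x) := by
    intro x hxp hxq
    obtain ⟨N, hN, hev⟩ := hw.tendsto_smul hxq hE₀
    obtain ⟨k, hk⟩ := exists_cyl_subset (inter_mem hN (isOpen_compl_singleton.mem_nhds hxp))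
    refine ⟨cyl x (k + 1), cyl_mem_nhds _ _, hev.mono fun i hi y hy => ?_⟩
    have hcol : IsLineColoring W {ξ | (w ^ i * pre x k)⁻¹ • ξ ∈ half (x.1 k)} c := by
      refine hc.mono fun ξ hξ => ?_
      change ((w ^ i * pre x k)⁻¹ • ξ).1 0 = x.1 k at hξ
      rw [mul_inv_rev, mul_smul, pre_inv_smul_zero_iff] at hξ
      have h1 := hk (fun j hj => hξ j hj.le)
      have h2 := hi _ h1.1
      rw [smul_inv_smul] at h2
      refine ⟨h2, fun h3 => h1.2 ?_⟩
      rw [Set.mem_singleton_iff] at h3 ⊢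
      rw [h3, inv_smul_eq_iff, hp]
    have := hcol.constOn hW ((pre x k)⁻¹ • y)
      ((pre_inv_smul_zero_iff x y k).2 fun j hj => hy j (by omega)) ((pre x k)⁻¹ • x)
      ((pre_inv_smul_zero_iff x x k).2 fun j hj => rfl)
    simpa [mul_smul] using this
  -- `K` consists of two consecutive fundamental shells, `E \ w E` and its image under `w`. It is
  -- compact, and consecutive translates of it overlap in a shell.
  let K : Set (Boundary n) := E ∩ {y | (w ^ 2)⁻¹ • y ∉ E}
  have hK : IsCompact K :=
    (hE.isClosed.inter ((hE.preimage (continuous_const_smul (w ^ 2)⁻¹)).compl.isClosed)).isCompact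
  have hKpq : K ⊆ {p, q}ᶜ := by
    rintro y ⟨hy1, hy2⟩ (rfl | rfl)
    · apply hy2
      rwa [inv_smul_eq_iff.2 (hp 2).symm]
    · exact hEq hy1
  -- If almost all translates `w ^ i K` were monochromatic, their overlaps would force one colour on
  -- a punctured neighbourhood of `p`, against `hmix`.
  have hfreq : ∃ᶠ i in atTop, ∃ x ∈ K, ∃ y ∈ K, c (w ^ i • x) = true ∧ c (w ^ i • y) = false := by
    intro hnot
    obtain ⟨I₀, hI₀⟩ := eventually_atTop.1 hnot
    have hKc : ∀ i ≥ I₀, ∀ x ∈ K, ∀ y ∈ K, c (w ^ i • x) = c (w ^ i • y) := by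
      intro i hi x hx y hy
      have h1 := hI₀ i hi
      push Not at h1
      have h2 := h1 x hx y hy
      have h3 := h1 y hy x hx
      revert h2 h3
      cases c (w ^ i • x) <;> cases c (w ^ i • y) <;> simp
    let Sh : Set (Boundary n) := E ∩ {y | w⁻¹ • y ∉ E}
    have hSh : Sh ⊆ K := fun y hy => ⟨hy.1, fun h1 => hy.2 (by
      have := hI _ h1
      rwa [pow_two, mul_inv_rev, mul_smul, smul_inv_smul] at this)⟩
    have hSh' : ∀ y ∈ Sh, w • y ∈ K := fun y hy => ⟨hI _ hy.1, fun h1 => hy.2 (by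
      rwa [pow_two, mul_inv_rev, mul_smul, inv_smul_smul] at h1)⟩
    -- Pull `z` back by `w` until just before it leaves `E`; it does leave, since `w⁻¹` attracts it
    -- to `q`.
    have hex : ∀ z ∈ E, z ≠ p → ∃ j, ∃ s ∈ Sh, z = w ^ j • s := by
      intro z hz hzp
      obtain ⟨N, hN, hev⟩ := hw.symm.tendsto_smul hzp (hE.compl.isOpen.mem_nhds hEq)
      have hex : ∃ j, w⁻¹ ^ j • z ∉ E := by
        obtain ⟨j, hj⟩ := hev.exists
        exact ⟨j, hj z (mem_of_mem_nhds hN)⟩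
      classical
      obtain ⟨j, hj⟩ : ∃ j, Nat.find hex = j + 1 := by
        refine ⟨Nat.find hex - 1, ?_⟩
        have : Nat.find hex ≠ 0 := fun h0 => by
          have := Nat.find_spec hex
          rw [h0] at this
          simp [hz] at this
        omega
      refine ⟨j, w⁻¹ ^ j • z, ⟨?_, ?_⟩, by simp⟩
      · have := Nat.find_min hex (m := j) (by omega)
        simpa using this
      · have := Nat.find_spec hex
        rwa [hj, pow_succ', mul_smul] at this
    have hconst : ∃ b, ∀ z ∈ E, z ≠ p → c (w ^ I₀ • z) = b := by
      by_cases hne : Sh.Nonempty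
      · obtain ⟨s₀, hs₀⟩ := hne
        refine ⟨c (w ^ I₀ • s₀), fun z hz hzp => ?_⟩
        obtain ⟨j, s, hs, rfl⟩ := hex z hz hzp
        rw [← mul_smul, ← pow_add, hKc (I₀ + j) (by omega) s (hSh hs) s₀ (hSh hs₀)]
        clear hz hzp
        induction j with
        | zero => rfl
        | succ j ih =>
          rw [← ih, ← add_assoc, pow_succ, mul_smul]
          exact hKc (I₀ + j) (by omega) _ (hSh' _ hs₀) _ (hSh hs₀)
      · refine ⟨true, fun z hz hzp => ?_⟩
        obtain ⟨j, s, hs, -⟩ := hex z hz hzp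
        exact absurd ⟨s, hs⟩ hne
    obtain ⟨b, hb⟩ := hconst
    apply hmix b
    rw [eventually_nhdsWithin_iff]
    have hnear : ∀ᶠ y in 𝓝 p, (w ^ I₀)⁻¹ • y ∈ E := by
      apply (continuous_const_smul (w ^ I₀)⁻¹).continuousAt.eventually
      apply hE.isOpen.mem_nhds
      change (w ^ I₀)⁻¹ • p ∈ E
      rwa [inv_smul_eq_iff.2 (hp I₀).symm]
    filter_upwards [hnear] with y hy hyp
    have := hb _ hy fun h1 => hyp (by
      rw [Set.mem_singleton_iff, ← hp I₀, ← h1, smul_inv_smul])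
    rwa [smul_inv_smul] at this
  have : Nonempty (Boundary n) := ⟨p⟩
  choose! xf hxf yf hyf hcx hcy using fun (i : ℕ) (hi : ∃ x ∈ K, ∃ y ∈ K,
    c (w ^ i • x) = true ∧ c (w ^ i • y) = false) => hi
  -- The new colouring is the limit of the colourings `c (w ^ i • ·)` along an ultrafilter on
  -- exponents for which `K` shows both colours. Limits `x` and `y` of points of either colour exist
  -- by compactness and keep their colours by `huni`.
  obtain ⟨𝒰, h𝒰1, h𝒰2⟩ : ∃ 𝒰 : Ultrafilter ℕ, (𝒰 : Filter ℕ) ≤ atTop ∧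
      ∀ᶠ i in (𝒰 : Filter ℕ), ∃ x ∈ K, ∃ y ∈ K,
        c (w ^ i • x) = true ∧ c (w ^ i • y) = false := by
    let S : Set ℕ := {i | ∃ x ∈ K, ∃ y ∈ K, c (w ^ i • x) = true ∧ c (w ^ i • y) = false}
    have hne : (atTop ⊓ 𝓟 S).NeBot := frequently_mem_iff_neBot.1 hfreq
    have h𝒰 := Ultrafilter.of_le (atTop ⊓ 𝓟 S)
    exact ⟨Ultrafilter.of (atTop ⊓ 𝓟 S), h𝒰.trans inf_le_left,
      h𝒰.trans inf_le_right (mem_principal_self S)⟩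
  obtain ⟨x, hxK, hx⟩ := hK.ultrafilter_le_nhds (𝒰.map xf)
    (le_principal_iff.2 (h𝒰2.mono fun i hi => hxf i hi))
  obtain ⟨y, hyK, hy⟩ := hK.ultrafilter_le_nhds (𝒰.map yf)
    (le_principal_iff.2 (h𝒰2.mono fun i hi => hyf i hi))
  classical
  have hmem : ∀ {ξ : Boundary n}, ξ ∈ ({p, q}ᶜ : Set (Boundary n)) → ξ ≠ p ∧ ξ ≠ q := by
    intro ξ hξ
    simpa [not_or] using hξ
  refine ⟨fun ξ => decide (∀ᶠ i in (𝒰 : Filter ℕ), c (w ^ i • ξ) = true), ⟨?_, ?_⟩,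
    x, hKpq hxK, y, hKpq hyK, ?_⟩
  · intro ξ hξ
    obtain ⟨N, hN, hev⟩ := huni ξ (hmem hξ).1 (hmem hξ).2
    filter_upwards [hN] with η hη
    apply decide_eq_decide.2
    exact eventually_congr ((hev.filter_mono h𝒰1).mono fun i hi => by rw [hi η hη])
  · intro ξ hξ η hη hl
    apply decide_eq_decide.2
    have hev : ∀ {ζ : Boundary n}, ζ ∈ ({p, q}ᶜ : Set (Boundary n)) →
        ∀ᶠ i in (𝒰 : Filter ℕ), w ^ i • ζ ∈ E₀ \ {p} := by
      intro ζ hζ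
      obtain ⟨N, hN, hev⟩ := hw.tendsto_smul (hmem hζ).2 hE₀
      refine (hev.filter_mono h𝒰1).mono fun i hi => ⟨hi ζ (mem_of_mem_nhds hN), fun h1 => ?_⟩
      apply (hmem hζ).1
      rw [Set.mem_singleton_iff, ← hp i] at h1
      exact smul_left_cancel _ h1
    exact eventually_congr (((hev hξ).and (hev hη)).mono fun i hi => by
      rw [hc.2 _ hi.1 _ hi.2 (smul_mem_lineSet hl _)])
  · have hx1 : ∀ᶠ i in (𝒰 : Filter ℕ), c (w ^ i • x) = true := by
      obtain ⟨N, hN, hev⟩ := huni x (hmem (hKpq hxK)).1 (hmem (hKpq hxK)).2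
      filter_upwards [hev.filter_mono h𝒰1, h𝒰2, hx hN] with i h1 h2 h3
      rw [← h1 _ h3]
      exact hcx i h2
    have hy1 : ∀ᶠ i in (𝒰 : Filter ℕ), c (w ^ i • y) = false := by
      obtain ⟨N, hN, hev⟩ := huni y (hmem (hKpq hyK)).1 (hmem (hKpq hyK)).2
      filter_upwards [hev.filter_mono h𝒰1, h𝒰2, hy hN] with i h1 h2 h3
      rw [← h1 _ h3]
      exact hcy i h2
    have hy2 : ¬ ∀ᶠ i in (𝒰 : Filter ℕ), c (w ^ i • y) = true := by
      intro h1
      obtain ⟨i, h2, h3⟩ := (h1.and hy1).exists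
      rw [h2] at h3
      exact absurd h3 (by simp)
    simp [hx1, hy2]

/-- The complement of the endpoints of any line has no non-constant colouring. -/
def NoCutLine (W : Set (FreeGroup (Fin n))) : Prop :=
  ∀ p q : Boundary n, s(p, q) ∈ lineSet W → ∀ c, IsLineColoring W {p, q}ᶜ c →
    ∀ x ∈ ({p, q}ᶜ : Set (Boundary n)), ∀ y ∈ ({p, q}ᶜ : Set (Boundary n)), c x = c y

/-- A colouring of one side of an edge without the lines crossing the edge is constant. -/
lemma IsLineColoring.eq_of_half (hW : ConnectedOff W) (h1 : 1 ∉ W) (hfin : W.Finite)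
    (hcut : NoCutLine W) {v : Fin n × Bool} {c : Boundary n → Bool}
    (hc : IsLineColoring W (half v \ cross W v) c) :
    ∀ x ∈ half v \ cross W v, ∀ y ∈ half v \ cross W v, c x = c y := by
  have hfc := finite_cross h1 hfin v
  -- Two colours accumulating at `p` would make the line ending there a cut line. So the colouring
  -- extends over the finitely many deleted points.
  have hmix : ∀ p ∈ cross W v, ∃ b, ∀ᶠ y in 𝓝[≠] p, c y = b := by
    rintro p ⟨hp, q, hl, -⟩
    by_contra hnot
    have hnot := not_exists.1 hnot
    have hE₀ : half v ∩ (cross W v \ {p})ᶜ ∈ 𝓝 p :=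
      inter_mem ((isClopen_half v).isOpen.mem_nhds hp)
        ((hfc.subset Set.sdiff_subset).isClosed.isOpen_compl.mem_nhds (by simp))
    obtain ⟨u, hu, -⟩ := exists_isAxis h1 hl
    obtain ⟨c', hc', x, hx, y, hy, hxy⟩ := exists_coloring_of_mixed hW hu hE₀ (c := c)
      (hc.mono fun ξ hξ => ⟨hξ.1.1, fun h2 => hξ.1.2 ⟨h2, hξ.2⟩⟩) hnot
    exact hxy (hcut p q hl c' hc' x hx y hy)
  choose! b hb using hmix
  classical
  let c' : Boundary n → Bool := fun ξ => if ξ ∈ cross W v then b ξ else c ξ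
  have hc' : IsLineColoring W (half v) c' := by
    refine ⟨fun ξ hξ => ?_, fun ξ hξ η hη hl => ?_⟩
    · by_cases hx : ξ ∈ cross W v
      · have h2 := hb ξ hx
        rw [eventually_nhdsWithin_iff] at h2
        have h3 : (cross W v \ {ξ})ᶜ ∈ 𝓝 ξ :=
          (hfc.subset Set.sdiff_subset).isClosed.isOpen_compl.mem_nhds (by simp)
        filter_upwards [h2, h3] with y hy1 hy2
        by_cases hyx : y = ξ
        · rw [hyx]
        · have hyc : y ∉ cross W v := fun h4 => hy2 ⟨h4, hyx⟩
          simp only [c', hx, hyc, if_true, if_false]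
          exact hy1 hyx
      · have h3 : (cross W v)ᶜ ∈ 𝓝 ξ := hfc.isClosed.isOpen_compl.mem_nhds hx
        filter_upwards [hc.1 ξ ⟨hξ, hx⟩, h3] with y hy1 hy2
        simp only [c', hx, if_neg hy2, if_false]
        exact hy1
    -- A line with both ends on this side avoids the filled-in points, since each of them already
    -- lies on a line that leaves the side.
    · have hn : ∀ {ξ η : Boundary n}, ξ ∈ half v → η ∈ half v → s(ξ, η) ∈ lineSet W →
          ξ ∉ cross W v := by
        rintro ξ η hξ hη hl ⟨-, η', hl', hη'⟩
        rw [← eq_of_mem_lineSet h1 hl hl'] at hη'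
        exact hη' hη
      have hx1 := hn hξ hη hl
      have hx2 := hn hη hξ (by rwa [Sym2.eq_swap])
      simp only [c', if_neg hx1, if_neg hx2]
      exact hc.2 ξ ⟨hξ, hx1⟩ η ⟨hη, hx2⟩ hl
  intro x hx y hy
  have h2 := (show IsLineColoring W {ξ | (1 : FreeGroup (Fin n))⁻¹ • ξ ∈ half v} c' by
    simpa using hc').constOn hW x hx.1 y hy.1
  simpa [c', if_neg hx.2, if_neg hy.2] using h2

end LinePattern

end

/-! ### Cut sets of the decomposition space. -/

section

open Filter Topology

namespace LinePattern

variable {n : ℕ} {F : Type*} [Group F] {B : FreeGroupBasis (Fin n) F} {W : Set F}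

/-- The projection of the boundary to the decomposition space. -/
def toSpace (B : FreeGroupBasis (Fin n) F) (W : Set F) (ξ : Boundary n) :
    DecompositionSpace B W := Quot.mk _ ξ

lemma toSpace_surjective : Function.Surjective (toSpace B W) := Quot.mk_surjective

lemma continuous_toSpace : Continuous (toSpace B W) := continuous_quot_mk

lemma toSpace_eq_of_line {ξ η : Boundary n} (h : s(ξ, η) ∈ lineSet (B.repr '' W)) :
    toSpace B W ξ = toSpace B W η :=
  Quot.sound (by rwa [lines_eq])

/-- The generated equivalence relation adds nothing but reflexivity, because no boundary point lies
on two lines. -/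
lemma toSpace_eq_iff (h1 : 1 ∉ B.repr '' W) {ξ η : Boundary n} :
    toSpace B W ξ = toSpace B W η ↔ ξ = η ∨ s(ξ, η) ∈ lineSet (B.repr '' W) := by
  refine ⟨fun h => ?_, ?_⟩
  · have h2 := Quot.eqvGen_exact h
    clear h
    induction h2 with
    | rel x y h => right; rwa [lines_eq] at h
    | refl x => exact Or.inl rfl
    | symm x y _ ih =>
      rcases ih with rfl | ih
      · exact Or.inl rfl
      · right; rwa [Sym2.eq_swap]
    | trans x y z _ _ ih1 ih2 =>
      rcases ih1 with rfl | ih1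
      · exact ih2
      rcases ih2 with rfl | ih2
      · exact Or.inr ih1
      left
      rw [Sym2.eq_swap] at ih1
      exact eq_of_mem_lineSet h1 ih1 ih2
  · rintro (rfl | h)
    · rfl
    · exact toSpace_eq_of_line h

lemma finite_toSpace_preimage (h1 : 1 ∉ B.repr '' W) {T : Set (DecompositionSpace B W)}
    (hT : T.Finite) : (toSpace B W ⁻¹' T).Finite := by
  refine hT.preimage' fun d _ => ?_
  obtain ⟨ξ, rfl⟩ := toSpace_surjective d
  by_cases h : ∃ η, s(ξ, η) ∈ lineSet (B.repr '' W)
  · obtain ⟨η, hη⟩ := h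
    refine (Set.toFinite {ξ, η}).subset fun ζ hζ => ?_
    rcases (toSpace_eq_iff h1).1 (Set.mem_singleton_iff.1 hζ).symm with rfl | h
    · exact Or.inl rfl
    · exact Or.inr (eq_of_mem_lineSet h1 h hη)
  · refine (Set.toFinite {ξ}).subset fun ζ hζ => ?_
    rcases (toSpace_eq_iff h1).1 (Set.mem_singleton_iff.1 hζ).symm with rfl | h'
    · rfl
    · exact absurd ⟨ζ, h'⟩ h

/-- Cut sets of the decomposition space in terms of colourings of the boundary. -/
lemma isCutSet_iff (h1 : 1 ∉ B.repr '' W) {T : Set (DecompositionSpace B W)} (hT : T.Finite) :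
    IsCutSet T ↔ ∃ c, IsLineColoring (B.repr '' W) (toSpace B W ⁻¹' T)ᶜ c ∧
      ∃ x ∈ (toSpace B W ⁻¹' T)ᶜ, ∃ y ∈ (toSpace B W ⁻¹' T)ᶜ, c x ≠ c y := by
  classical
  -- Points of `T` have finite preimages, so the complement is open and local constancy there can be
  -- tested in the whole boundary.
  have hopen : IsOpen (toSpace B W ⁻¹' T)ᶜ := (finite_toSpace_preimage h1 hT).isClosed.isOpen_compl
  rw [IsCutSet, IsPreconnected]
  constructor
  · intro h
    push Not at h
    obtain ⟨U, V, hU, hV, hUV, ⟨x, hx, hxU⟩, ⟨y, hy, hyV⟩, hemp⟩ := h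
    obtain ⟨x, rfl⟩ := toSpace_surjective x
    obtain ⟨y, rfl⟩ := toSpace_surjective y
    have hdisj : ∀ d, d ∉ T → d ∈ V → d ∉ U := fun d hd hdV hdU => by
      have : d ∈ Tᶜ ∩ (U ∩ V) := ⟨hd, hdU, hdV⟩
      rw [hemp] at this
      exact this
    refine ⟨fun ξ => decide (toSpace B W ξ ∈ U), ⟨fun ξ hξ => ?_, fun ξ _ η _ hl => ?_⟩,
      x, hx, y, hy, ?_⟩
    · by_cases hξU : toSpace B W ξ ∈ U
      · filter_upwards [(hU.preimage continuous_toSpace).mem_nhds hξU] with η hη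
        have hη' : toSpace B W η ∈ U := hη
        simp [hξU, hη']
      · have hξV : toSpace B W ξ ∈ V := (hUV hξ).resolve_left hξU
        filter_upwards [(hV.preimage continuous_toSpace).mem_nhds hξV, hopen.mem_nhds hξ]
          with η hη hηT
        have hη' : toSpace B W η ∉ U := hdisj _ hηT hη
        simp [hξU, hη']
    · simp only [toSpace_eq_of_line hl]
    · have := hdisj _ hy hyV
      simp [hxU, this]
  · rintro ⟨c, hc, x, hx, y, hy, hxy⟩ h
    have hresp : ∀ (b : Bool) (ξ η : Boundary n), s(ξ, η) ∈ lines B W →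
        (toSpace B W ξ ∉ T ∧ c ξ = b) = (toSpace B W η ∉ T ∧ c η = b) := by
      intro b ξ η hl
      rw [lines_eq] at hl
      rw [toSpace_eq_of_line hl]
      apply propext
      refine and_congr_right fun hη => ?_
      rw [hc.2 ξ (by rwa [Set.mem_compl_iff, Set.mem_preimage, toSpace_eq_of_line hl]) η hη hl]
    let U : Bool → Set (DecompositionSpace B W) := fun b =>
      {d | Quot.lift (fun ξ => toSpace B W ξ ∉ T ∧ c ξ = b) (hresp b) d}
    have hU : ∀ b, IsOpen (U b) := by
      intro b
      rw [← isQuotientMap_quot_mk.isOpen_preimage, isOpen_iff_mem_nhds]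
      rintro ξ ⟨hξ, hξb⟩
      filter_upwards [hc.1 ξ hξ, hopen.mem_nhds hξ] with η hη hηT
      exact ⟨hηT, hη.trans hξb⟩
    obtain ⟨d, -, hd1, hd2⟩ := h (U (c x)) (U (c y)) (hU _) (hU _)
      (by
        intro d hd
        obtain ⟨ξ, rfl⟩ := toSpace_surjective d
        by_cases hξ : c ξ = c x
        · exact Or.inl ⟨hd, hξ⟩
        · refine Or.inr ⟨hd, ?_⟩
          revert hξ hxy
          cases c ξ <;> cases c x <;> cases c y <;> simp)
      ⟨toSpace B W x, hx, hx, rfl⟩ ⟨toSpace B W y, hy, hy, rfl⟩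
    obtain ⟨ξ, rfl⟩ := toSpace_surjective d
    exact hxy (hd1.2.symm.trans hd2.2)

/-- The constant infinite word. -/
def constWord (z : Fin n × Bool) : Boundary n := ⟨fun _ => z, fun _ h => flip_ne z h.symm⟩

lemma exists_ne_of_two_le (hn : 2 ≤ n) (a b : Fin n × Bool) : ∃ y, y ≠ a ∧ y ≠ b := by
  have : ({a, b} : Finset (Fin n × Bool)).card < Fintype.card (Fin n × Bool) := by
    refine lt_of_le_of_lt Finset.card_le_two ?_
    simp
    omega
  obtain ⟨y, hy⟩ := Finset.exists_mem_notMem_of_card_lt_card (s := {a, b}) (t := Finset.univ) this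
  exact ⟨y, by simpa [not_or] using hy⟩

/-- There are at least four letters, so a prefix of `ξ` can be continued by one that is neither
cancelling nor the next letter of `ξ`. -/
lemma nhdsNE_neBot (hn : 2 ≤ n) (ξ : Boundary n) : (𝓝[≠] ξ).NeBot := by
  rw [← mem_closure_iff_nhdsWithin_neBot, mem_closure_iff_nhds]
  intro N hN
  obtain ⟨k, hk⟩ := exists_cyl_subset hN
  obtain ⟨y, hy1, hy2⟩ := exists_ne_of_two_le hn (flip (ξ.1 k)) (ξ.1 (k + 1))
  have hlast : (pre ξ (k + 1)).toWord.getLast? ≠ some (flip ((constWord y).1 0)) := by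
    rw [toWord_pre, List.ofFn_succ', List.concat_eq_append, List.getLast?_concat]
    intro h
    apply hy1
    have h2 : ξ.1 k = flip y := Option.some_inj.1 h
    rw [h2, flip_flip]
  obtain ⟨h1, h2⟩ := smul_append _ (constWord y) hlast
  rw [norm_pre] at h1 h2
  refine ⟨pre ξ (k + 1) • constWord y, hk fun i hi => ?_, fun h => ?_⟩
  · have e := h1 i (by omega)
    rw [agree_pre ξ (k + 1) i (by omega)] at e
    exact (Option.some_inj.1 e).symm
  · rw [Set.mem_singleton_iff] at h
    have := h2 0
    rw [h] at this
    exact hy2 this.symm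

lemma exists_mem_notMem_of_finite (hn : 2 ≤ n) {ξ : Boundary n} {N P : Set (Boundary n)}
    (hN : N ∈ 𝓝 ξ) (hP : P.Finite) : ∃ η ∈ N, η ∉ P := by
  have := nhdsNE_neBot hn ξ
  exact ((infinite_of_mem_nhds ξ hN).sdiff hP).nonempty

/-- The endpoints of the lines joining the component `v` to other components. -/
def crossEnds (W : Set (FreeGroup (Fin n))) (v : Fin n × Bool) : Set (Boundary n) :=
  {ξ | ξ ∈ cross W v ∨ ∃ η ∈ cross W v, s(ξ, η) ∈ lineSet W}

lemma mem_cross_of_mem_crossEnds {W : Set (FreeGroup (Fin n))} (h1 : 1 ∉ W) {v : Fin n × Bool}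
    {ξ : Boundary n} (h : ξ ∈ crossEnds W v) (hξ : ξ ∈ half v) : ξ ∈ cross W v := by
  rcases h with h | ⟨η, ⟨-, ζ, hl', hζ⟩, hl⟩
  · exact h
  · rw [Sym2.eq_swap] at hl
    rw [eq_of_mem_lineSet h1 hl' hl] at hζ
    exact absurd hξ hζ

lemma toSpace_preimage_image_cross (h1 : 1 ∉ B.repr '' W) (v : Fin n × Bool) :
    toSpace B W ⁻¹' (toSpace B W '' cross (B.repr '' W) v) = crossEnds (B.repr '' W) v := by
  ext ξ
  simp only [Set.mem_preimage, Set.mem_image, crossEnds, Set.mem_ofPred_eq]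
  constructor
  · rintro ⟨η, hη, h⟩
    rcases (toSpace_eq_iff h1).1 h with rfl | h
    · exact Or.inl hη
    · exact Or.inr ⟨η, hη, by rwa [Sym2.eq_swap]⟩
  · rintro (h | ⟨η, hη, h⟩)
    · exact ⟨ξ, h, rfl⟩
    · exact ⟨η, hη, (toSpace_eq_of_line h).symm⟩

/-- The edge `v` can be viewed from its other end: translation by `ltr v` identifies the lines
crossing the edge `flip v` with those crossing `v`. -/
lemma ltr_smul_mem_crossEnds {W : Set (FreeGroup (Fin n))} {v : Fin n × Bool}
    {ξ : Boundary n} : ξ ∈ cross W (flip v) → ltr v • ξ ∈ crossEnds W v := by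
  rintro ⟨hξ, η, hl, hη⟩
  refine Or.inr ⟨ltr v • η, ⟨ltr_smul_zero hη, ltr v • ξ, ?_, ?_⟩, smul_mem_lineSet hl _⟩
  · rw [Sym2.eq_swap]; exact smul_mem_lineSet hl _
  · rw [Ne, ltr_smul_zero_eq_iff, not_not]; exact hξ

/-- Under the connectivity hypotheses, a colouring of the boundary minus a proper subset of the
lines crossing an edge is constant. -/
lemma not_isCutSet_of_ssubset (hn : 2 ≤ n) (h1 : 1 ∉ B.repr '' W) (hfin : W.Finite)
    (hW : ConnectedOff (B.repr '' W)) (hcut : NoCutLine (B.repr '' W)) {v : Fin n × Bool}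
    {T : Set (DecompositionSpace B W)} (hT : T ⊂ toSpace B W '' cross (B.repr '' W) v) :
    ¬ IsCutSet T := by
  have hfc := finite_cross h1 (hfin.image B.repr)
  have hTfin : T.Finite := ((hfc v).image _).subset hT.1
  rw [isCutSet_iff h1 hTfin]
  rintro ⟨c, hc, x, hx, y, hy, hxy⟩
  have hsub : ∀ ξ, ξ ∉ crossEnds (B.repr '' W) v → ξ ∈ (toSpace B W ⁻¹' T)ᶜ := by
    intro ξ hξ h
    apply hξ
    rw [← toSpace_preimage_image_cross h1]
    exact hT.1 h
  have hEfin : (crossEnds (B.repr '' W) v).Finite := by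
    rw [← toSpace_preimage_image_cross h1]
    exact finite_toSpace_preimage h1 ((hfc v).image _)
  have side1 : ∀ x ∈ half v \ cross (B.repr '' W) v, ∀ y ∈ half v \ cross (B.repr '' W) v,
      c x = c y := by
    refine IsLineColoring.eq_of_half hW h1 (hfin.image B.repr) hcut (hc.mono fun ξ hξ => ?_)
    exact hsub ξ fun h => hξ.2 (mem_cross_of_mem_crossEnds h1 h hξ.1)
  have side2 : ∀ x, x ∉ half v → x ∉ crossEnds (B.repr '' W) v → ∀ y, y ∉ half v →
      y ∉ crossEnds (B.repr '' W) v → c x = c y := by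
    have hmem : ∀ x, x ∉ half v → x ∉ crossEnds (B.repr '' W) v →
        (ltr v)⁻¹ • x ∈ half (flip v) \ cross (B.repr '' W) (flip v) := by
      intro x hx hx'
      rw [← ltr_flip]
      refine ⟨ltr_smul_zero (by rw [flip_flip]; exact hx), fun h => hx' ?_⟩
      have := ltr_smul_mem_crossEnds h
      rwa [ltr_flip, smul_inv_smul] at this
    have key := IsLineColoring.eq_of_half (v := flip v) hW h1 (hfin.image B.repr) hcut
      (c := fun ξ => c (ltr v • ξ)) ((hc.comp_smul (ltr v)).mono fun ξ hξ => ?_)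
    · intro x hx hx' y hy hy'
      simpa using key _ (hmem x hx hx') _ (hmem y hy hy')
    · apply hsub
      intro h
      rcases h with h | ⟨η, hη, hl⟩
      · have h3 : (ltr v • ξ).1 0 = v := h.1
        rw [ltr_smul_zero_eq_iff] at h3
        exact h3 hξ.1
      · apply hξ.2
        refine ⟨hξ.1, (ltr v)⁻¹ • η, ?_, ?_⟩
        · simpa using smul_mem_lineSet hl (ltr v)⁻¹
        · have e : η = ltr v • (ltr v)⁻¹ • η := by simp
          have h4 : (ltr v • (ltr v)⁻¹ • η).1 0 = v := by rw [← e]; exact hη.1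
          exact ltr_smul_zero_eq_iff.1 h4
  -- Both sides of the edge are monochromatic. A crossing line outside `T` forces their colours to
  -- agree, and density extends this to the remaining points.
  obtain ⟨d, ⟨p, hp, rfl⟩, hdT⟩ := Set.exists_of_ssubset hT
  obtain ⟨hpv, q, hl, hq⟩ := hp
  have hqT : toSpace B W q ∉ T := by rwa [← toSpace_eq_of_line hl]
  obtain ⟨p', ⟨hp1, hp2⟩, hp3⟩ := exists_mem_notMem_of_finite hn
    (inter_mem (hc.1 p hdT) ((isClopen_half v).isOpen.mem_nhds hpv)) hEfin
  obtain ⟨q', ⟨hq1, hq2⟩, hq3⟩ := exists_mem_notMem_of_finite hn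
    (inter_mem (hc.1 q hqT) ((isClopen_half v).compl.isOpen.mem_nhds hq)) hEfin
  have hpq : c p' = c q' := by
    rw [hp1, hq1]; exact hc.2 p hdT q hqT hl
  have hall : ∀ x, x ∉ crossEnds (B.repr '' W) v → c x = c p' := by
    intro x hx
    by_cases hxv : x ∈ half v
    · exact side1 x ⟨hxv, fun h => hx (Or.inl h)⟩ p' ⟨hp2, fun h => hp3 (Or.inl h)⟩
    · rw [hpq]; exact side2 x hxv hx q' hq2 hq3
  have hall' : ∀ x ∈ (toSpace B W ⁻¹' T)ᶜ, c x = c p' := by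
    intro x hx
    obtain ⟨x', hx1, hx2⟩ := exists_mem_notMem_of_finite hn (hc.1 x hx) hEfin
    have hx1' : c x' = c x := hx1
    rw [← hx1', hall x' hx2]
  exact hxy ((hall' x hx).trans (hall' y hy).symm)

/-- Once all lines crossing the edge are removed, nothing links its two sides, and the indicator of
one side is a colouring. -/
lemma isCutSet_image_cross (hn : 2 ≤ n) (h1 : 1 ∉ B.repr '' W) (hfin : W.Finite)
    (v : Fin n × Bool) : IsCutSet (toSpace B W '' cross (B.repr '' W) v) := by
  classical
  have hfc := finite_cross h1 (hfin.image B.repr)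
  rw [isCutSet_iff h1 ((hfc v).image _), toSpace_preimage_image_cross h1]
  have hEfin : (crossEnds (B.repr '' W) v).Finite := by
    rw [← toSpace_preimage_image_cross h1]
    exact finite_toSpace_preimage h1 ((hfc v).image _)
  obtain ⟨x, hx, hx'⟩ := exists_mem_notMem_of_finite hn
    ((isClopen_half v).isOpen.mem_nhds (show constWord v ∈ half v from rfl)) hEfin
  obtain ⟨y, hy, hy'⟩ := exists_mem_notMem_of_finite hn
    ((isClopen_half (flip v)).isOpen.mem_nhds (show constWord (flip v) ∈ half (flip v) from rfl))
    hEfin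
  have hyv : y ∉ half v := fun h => flip_ne v (hy.symm.trans h)
  refine ⟨fun ξ => decide (ξ ∈ half v), ⟨fun ξ _ => ?_, fun ξ hξ η hη hl => ?_⟩,
    x, hx', y, hy', by simp [hx, hyv]⟩
  · by_cases h : ξ ∈ half v
    · filter_upwards [(isClopen_half v).isOpen.mem_nhds h] with η hη
      simp [h, hη]
    · filter_upwards [(isClopen_half v).compl.isOpen.mem_nhds h] with η hη
      simp [h, show η ∉ half v from hη]
  · apply decide_eq_decide.2
    constructor
    · intro h
      by_contra h2
      exact hξ (Or.inl ⟨h, η, hl, h2⟩)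
    · intro h
      by_contra h2
      exact hη (Or.inl ⟨h, ξ, by rwa [Sym2.eq_swap], h2⟩)

/-- The empty set has no proper subset, so as a cut set it would be minimal, with the wrong number
of elements. -/
lemma not_isCutSet_empty
    (h4 : ∀ S : Set (DecompositionSpace B W), IsMinimalCutSet S → S.encard = 2) :
    ¬ IsCutSet (∅ : Set (DecompositionSpace B W)) := by
  intro h
  have := h4 ∅ ⟨h, fun T hT => absurd (Set.empty_subset T) hT.2⟩
  simp at this

lemma not_isCutSet_singleton
    (h4 : ∀ S : Set (DecompositionSpace B W), IsMinimalCutSet S → S.encard = 2)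
    (d : DecompositionSpace B W) : ¬ IsCutSet {d} := by
  intro h
  have := h4 {d} ⟨h, fun T hT => by
    rw [Set.ssubset_singleton_iff] at hT
    subst hT
    exact not_isCutSet_empty h4⟩
  simp at this

lemma noCutLine_of_encard (h1 : 1 ∉ B.repr '' W)
    (h4 : ∀ S : Set (DecompositionSpace B W), IsMinimalCutSet S → S.encard = 2) :
    NoCutLine (B.repr '' W) := by
  intro p q hl c hc x hx y hy
  by_contra hxy
  have e : toSpace B W ⁻¹' {toSpace B W p} = {p, q} := by
    ext ξ
    rw [Set.mem_preimage, Set.mem_singleton_iff, eq_comm, toSpace_eq_iff h1]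
    refine or_congr eq_comm ⟨fun h => eq_of_mem_lineSet h1 h hl, ?_⟩
    rintro rfl
    exact hl
  apply not_isCutSet_singleton h4 (toSpace B W p)
  rw [isCutSet_iff h1 (Set.finite_singleton _), e]
  exact ⟨c, hc, x, hx, y, hy, hxy⟩

/-- A connected component of the Whitehead graph, pulled back by the first letter, is a colouring of
the whole boundary. Two components would disconnect the decomposition space. -/
lemma reflTransGen_wadj (h1 : 1 ∉ B.repr '' W)
    (h4 : ∀ S : Set (DecompositionSpace B W), IsMinimalCutSet S → S.encard = 2)
    (x y : Fin n × Bool) : Relation.ReflTransGen (WAdj (B.repr '' W)) x y := by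
  classical
  by_contra hxy
  apply not_isCutSet_empty h4
  rw [isCutSet_iff h1 Set.finite_empty]
  refine ⟨fun ξ => decide (Relation.ReflTransGen (WAdj (B.repr '' W)) x (ξ.1 0)), ⟨?_, ?_⟩,
    constWord x, by simp, constWord y, by simp, ?_⟩
  · intro ξ _
    filter_upwards [cyl_mem_nhds ξ 1] with η hη
    rw [hη 0 (by omega)]
  · intro ξ _ η _ hl
    apply decide_eq_decide.2
    by_cases h : ξ.1 0 = η.1 0
    · rw [h]
    · have hadj : WAdj (B.repr '' W) (ξ.1 0) (η.1 0) := ⟨h, ξ, η, hl, rfl, rfl⟩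
      exact ⟨fun h => h.tail hadj, fun h => h.tail hadj.symm⟩
  · have h2 : Relation.ReflTransGen (WAdj (B.repr '' W)) x ((constWord x).1 0) := .refl
    have h3 : ¬ Relation.ReflTransGen (WAdj (B.repr '' W)) x ((constWord y).1 0) := hxy
    simp [h2, h3]

lemma connectedOff_of_not_isCutVertex
    (hconn : ∀ x y, Relation.ReflTransGen (WAdj (B.repr '' W)) x y)
    (hcv : ∀ v, ¬ (whiteheadGraph B W).IsCutVertex v) : ConnectedOff (B.repr '' W) := by
  intro v x y hx hy
  by_contra hnot
  refine hcv v ⟨Set.mem_univ _, x, Set.mem_univ _, y, Set.mem_univ _, hx, hy, ?_, fun h => ?_⟩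
  · exact Relation.ReflTransGen.mono (fun a b h => (whiteheadGraph_adj_iff B W a b).2 h) _ _
      (hconn x y)
  · exact hnot (Relation.ReflTransGen.mono
      (fun a b h => (whiteheadGraph_deleteVerts_adj_iff B W v a b).1 h) _ _ h)

/-- If all minimal cut sets are pairs and there are no cut vertices, then every vertex of the
Whitehead graph has valence two. -/
lemma encard_cross (hn : 2 ≤ n) (h1 : 1 ∉ B.repr '' W) (hfin : W.Finite)
    (h4 : ∀ S : Set (DecompositionSpace B W), IsMinimalCutSet S → S.encard = 2)
    (hcv : ∀ v, ¬ (whiteheadGraph B W).IsCutVertex v) (v : Fin n × Bool) :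
    (cross (B.repr '' W) v).encard = 2 := by
  have hW := connectedOff_of_not_isCutVertex (reflTransGen_wadj h1 h4) hcv
  have h5 := h4 _ ⟨isCutSet_image_cross hn h1 hfin v, fun T hT =>
    not_isCutSet_of_ssubset hn h1 hfin hW (noCutLine_of_encard h1 h4) hT⟩
  rw [← h5]
  -- A line crossing the edge has only one end in the component `v`, so valence and number of points
  -- of the cut set agree.
  refine (Set.InjOn.encard_image ?_).symm
  intro ξ hξ η hη h
  rcases (toSpace_eq_iff h1).1 h with h | h
  · exact h
  · obtain ⟨-, ζ, hl, hζ⟩ := hξ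
    rw [← eq_of_mem_lineSet h1 h hl] at hζ
    exact absurd hη.1 hζ

end LinePattern

end

/-! ### Connected graphs of valence two are polygons. -/

section

open Filter Topology

namespace LinePattern

/-- A finite connected graph all of whose vertices have valence two, given by its darts `D` with
the edge reversal `p`, the exchange `b` of the two darts at a vertex, and the origin map `ν`, is a
polygon. -/
lemma exists_cycle {D V : Type*} [Finite D] [Nonempty D] (p b : D → D) (ν : D → V)
    (hp : ∀ d, p (p d) = d) (hb : ∀ d, b (b d) = d) (hbne : ∀ d, b d ≠ d)
    (hνb : ∀ d, ν (b d) = ν d) (hν : ∀ d d', ν d = ν d' → d' = d ∨ d' = b d)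
    (hνp : ∀ d, ν (p d) ≠ ν d)
    (hconn : ∀ S : Set V, S.Nonempty → (∀ d, ν d ∈ S → ν (p d) ∈ S) → S = Set.univ) :
    ∃ m, 1 ≤ m ∧ ∃ f : ZMod m → D, Function.Bijective (ν ∘ f) ∧
      (∀ i, f (i + 1) = b (p (f i))) ∧ (∀ d, ∃ i, d = f i ∨ d = p (f i)) ∧
      ∀ i j, f i ≠ p (f j) := by
  obtain ⟨d₀⟩ := ‹Nonempty D›
  -- Walk through the graph: traverse the edge, then leave along the other dart at the vertex
  -- reached.
  let σ : D → D := fun d => b (p d)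
  have hσ : Function.Injective σ := fun x y h => by
    have := congrArg (fun z => p (b z)) h
    simpa [σ, hp, hb] using this
  -- The walk never returns to a vertex by the wrong dart. Such a return can be shortened by a step
  -- at both ends, until `b` fixes a dart or an edge is a loop.
  have key : ∀ k x, b (σ^[k] x) ≠ x := by
    intro k
    induction k using Nat.strong_induction_on with
    | _ k ih =>
      intro x h
      match k, ih with
      | 0, _ => exact hbne x h
      | 1, _ =>
        simp only [Function.iterate_one, σ, hb] at h
        exact hνp x (by rw [h])
      | k + 2, ih =>
        refine ih k (by omega) (σ x) ?_
        rw [Function.iterate_succ_apply', Function.iterate_succ_apply] at h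
        refine Eq.trans ?_ (congrArg σ h)
        simp only [σ, hb, hp]
  have key2 : ∀ i j, b (σ^[i] d₀) ≠ σ^[j] d₀ := by
    intro i j h
    rcases le_total i j with hij | hij
    · obtain ⟨k, rfl⟩ := Nat.exists_eq_add_of_le hij
      apply key k (σ^[i] d₀)
      rw [← Function.iterate_add_apply, add_comm k i, ← h, hb]
    · obtain ⟨k, rfl⟩ := Nat.exists_eq_add_of_le hij
      apply key k (σ^[j] d₀)
      rw [← Function.iterate_add_apply, add_comm k j, h]
  have hper := hσ.mem_periodicPts d₀
  set m := Function.minimalPeriod σ d₀ with hm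
  have hmpos : 0 < m := Function.minimalPeriod_pos_of_mem_periodicPts hper
  have : NeZero m := ⟨hmpos.ne'⟩
  let f : ZMod m → D := fun i => σ^[i.val] d₀
  have hf : ∀ i, f (i + 1) = b (p (f i)) := by
    intro i
    change σ^[(i + 1).val] d₀ = σ (σ^[i.val] d₀)
    rw [← Function.iterate_succ_apply' σ, ZMod.val_add, ZMod.val_one_eq_one_mod, Nat.add_mod_mod]
    exact Function.iterate_mod_minimalPeriod_eq
  have hf' : ∀ i, p (f (i - 1)) = b (f i) := by
    intro i
    have := hf (i - 1)
    rw [sub_add_cancel] at this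
    rw [this, hb]
  have hinj : Function.Injective f := by
    intro i j h
    exact ZMod.val_injective m
      (Function.iterate_injOn_Iio_minimalPeriod (ZMod.val_lt i) (ZMod.val_lt j) h)
  -- The set of visited vertices is closed under adjacency, so connectedness makes it everything.
  have hsurj : Function.Surjective (ν ∘ f) := by
    rw [← Set.range_eq_univ]
    apply hconn _ (Set.range_nonempty _)
    rintro d ⟨i, hi⟩
    rcases hν _ _ hi with rfl | rfl
    · exact ⟨i + 1, by simp only [Function.comp, hf, hνb]⟩
    · refine ⟨i - 1, ?_⟩
      rw [← hf', hp]
      rfl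
  refine ⟨m, hmpos, f, ⟨fun i j h => ?_, hsurj⟩, hf, fun d => ?_, fun i j h => ?_⟩
  · rcases hν _ _ h with h2 | h2
    · exact (hinj h2).symm
    · exact absurd h2.symm (key2 _ _)
  · obtain ⟨i, hi⟩ := hsurj (ν d)
    rcases hν _ _ hi with h | h
    · exact ⟨i, Or.inl h⟩
    · exact ⟨i - 1, Or.inr (by rw [h, hf'])⟩
  · have h2 := hf' (j + 1)
    rw [add_sub_cancel_right] at h2
    rw [h2] at h
    exact key2 _ _ h.symm

variable {n : ℕ} {F : Type*} [Group F] {B : FreeGroupBasis (Fin n) F} {W : Set F}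

/-- A connected Whitehead graph in which all vertices have valence two is a circle. -/
lemma isCircle_of_encard_cross (hn : 2 ≤ n) (h1 : 1 ∉ B.repr '' W) (hfin : W.Finite)
    (hconn : ∀ x y, Relation.ReflTransGen (WAdj (B.repr '' W)) x y)
    (hdeg : ∀ v, (cross (B.repr '' W) v).encard = 2) : (whiteheadGraph B W).IsCircle := by
  -- A dart is an end of a line through the identity vertex, based at its first letter. Reversal
  -- passes to the other end of the line, and valence two provides the exchange at each vertex.
  let D := {ξ : Boundary n // ξ ∈ cross (B.repr '' W) (ξ.1 0)}
  have hp : ∀ d : D, ∃ d' : D, s(d.1, d'.1) ∈ lineSet (B.repr '' W) ∧ d'.1.1 0 ≠ d.1.1 0 := by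
    rintro ⟨ξ, -, η, hl, hη⟩
    exact ⟨⟨η, rfl, ξ, by rwa [Sym2.eq_swap], hη.symm⟩, hl, hη⟩
  have hb : ∀ d : D, ∃ d' : D, d' ≠ d ∧ d'.1.1 0 = d.1.1 0 ∧
      ∀ e : D, e.1.1 0 = d.1.1 0 → e = d ∨ e = d' := by
    rintro ⟨ξ, hξ⟩
    obtain ⟨x, y, hxy, he⟩ := Set.encard_eq_two.1 (hdeg (ξ.1 0))
    have key : ∀ x y : Boundary n, x ≠ y → cross (B.repr '' W) (ξ.1 0) = {x, y} → ξ = x →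
        ∃ d' : D, d' ≠ ⟨ξ, hξ⟩ ∧ d'.1.1 0 = ξ.1 0 ∧
        ∀ e : D, e.1.1 0 = ξ.1 0 → e = ⟨ξ, hξ⟩ ∨ e = d' := by
      rintro x y hxy he rfl
      have hy : y ∈ cross (B.repr '' W) (ξ.1 0) := by rw [he]; simp
      refine ⟨⟨y, by rw [hy.1]; exact hy⟩, fun h => hxy (congrArg Subtype.val h).symm, hy.1, ?_⟩
      rintro ⟨e, he'⟩ (h : e.1 0 = ξ.1 0)
      rw [h, he] at he'
      exact he'.imp Subtype.ext Subtype.ext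
    have hξ' := hξ
    rw [he] at hξ'
    rcases hξ' with h | h
    · exact key x y hxy he h
    · exact key y x hxy.symm (by rw [he, Set.pair_comm]) h
  choose p hpl hp0 using hp
  choose b hbne hb0 hb' using hb
  have hdfin : {ξ : Boundary n | ξ ∈ cross (B.repr '' W) (ξ.1 0)}.Finite := by
    refine (Set.finite_iUnion fun v => finite_cross h1 (hfin.image B.repr) v).subset ?_
    intro ξ hξ
    exact Set.mem_iUnion.2 ⟨_, hξ⟩
  have : Finite D := hdfin
  have hsurj : ∀ v, ∃ d : D, d.1.1 0 = v := by
    intro v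
    have hne : (cross (B.repr '' W) v).Nonempty := by
      rw [← Set.encard_ne_zero, hdeg]; simp
    obtain ⟨ξ, hξ⟩ := hne
    exact ⟨⟨ξ, by rw [hξ.1]; exact hξ⟩, hξ.1⟩
  have : Nonempty D := ⟨(hsurj (⟨0, by omega⟩, true)).choose⟩
  have huniq : ∀ d e : D, s(d.1, e.1) ∈ lineSet (B.repr '' W) → e = p d := fun d e h =>
    Subtype.ext (eq_of_mem_lineSet h1 h (hpl d))
  have hpp : ∀ d, p (p d) = d := fun d =>
    (huniq (p d) d (by rw [Sym2.eq_swap]; exact hpl d)).symm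
  obtain ⟨m, hm, f, hbij, hf, hcov, hne⟩ := exists_cycle p b (fun d : D => d.1.1 0) hpp
    (fun d => ((hb' _ _ (hb0 d).symm).resolve_left (hbne d).symm).symm) hbne hb0
    (fun d d' h => hb' d d' h.symm) hp0 (by
      intro S ⟨x, hx⟩ hS
      rw [Set.eq_univ_iff_forall]
      intro y
      induction hconn x y with
      | refl => exact hx
      | tail _ hab ih =>
        obtain ⟨hne, ξ, η, hl, rfl, rfl⟩ := hab
        have := hS ⟨ξ, rfl, η, hl, hne.symm⟩ ih
        rwa [← huniq ⟨ξ, rfl, η, hl, hne.symm⟩ ⟨η, rfl, ξ, by rwa [Sym2.eq_swap], hne⟩ hl] at this)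
  have hlink : ∀ i, (whiteheadGraph B W).IsLink s((f i).1, (p (f i)).1)
      ((f i).1.1 0) ((f (i + 1)).1.1 0) := by
    intro i
    refine ⟨?_, ?_, (f i).1, (p (f i)).1, rfl, rfl, ?_⟩
    · rw [lines_eq]; exact hpl _
    · rw [hf, hb0]; exact (hp0 _).symm
    · rw [hf, hb0]
  refine ⟨m, hm, Equiv.ofBijective (fun i => ⟨(f i).1.1 0, Set.mem_univ _⟩) ⟨?_, ?_⟩,
    Equiv.ofBijective (fun i => ⟨s((f i).1, (p (f i)).1), (hlink i).edge_mem⟩) ⟨?_, ?_⟩, hlink⟩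
  · intro i j h
    exact hbij.1 (congrArg Subtype.val h)
  · rintro ⟨v, -⟩
    obtain ⟨i, hi⟩ := hbij.2 v
    exact ⟨i, Subtype.ext hi⟩
  · intro i j h
    rcases Sym2.eq_iff.1 (congrArg Subtype.val h) with ⟨h, -⟩ | ⟨h, -⟩
    · exact hbij.1 (by simp only [Function.comp, h])
    · exact absurd (Subtype.ext h) (hne i j)
  · rintro ⟨l, hl⟩
    obtain ⟨x, y, hl, hxy, ξ, η, rfl, rfl, rfl⟩ := (Graph.edge_mem_iff_exists_isLink _ _).1 hl
    rw [lines_eq] at hl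
    obtain ⟨i, hi⟩ := hcov ⟨ξ, rfl, η, hl, hxy.symm⟩
    have he := huniq ⟨ξ, rfl, η, hl, hxy.symm⟩ ⟨η, rfl, ξ, by rwa [Sym2.eq_swap], hxy⟩ hl
    refine ⟨i, Subtype.ext ?_⟩
    rcases hi with hi | hi
    · rw [hi] at he
      have e1 := congrArg Subtype.val hi
      have e2 := congrArg Subtype.val he
      simp only at e1 e2
      simp only [← e1, ← e2]
    · rw [hi, hpp] at he
      have e1 := congrArg Subtype.val hi
      have e2 := congrArg Subtype.val he
      simp only at e1 e2
      simp only [← e1, ← e2]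
      exact Sym2.eq_swap

end LinePattern

end

theorem mainTheorem4 {F : Type*} [Group F] {n : ℕ} (hn : 2 ≤ n)
    (B₀ : FreeGroupBasis (Fin n) F) (W : Set F) (hWfin : W.Finite) (hW : (1 : F) ∉ W) :
    [ ∀ B : FreeGroupBasis (Fin n) F,
        (∀ v, ¬ (LinePattern.whiteheadGraph B W).IsCutVertex v) →
          (LinePattern.whiteheadGraph B W).IsCircle,
      ∃ B : FreeGroupBasis (Fin n) F, (LinePattern.whiteheadGraph B W).IsCircle,
      Nonempty (LinePattern.DecompositionSpace B₀ W ≃ₜ Circle),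
      ∀ S : Set (LinePattern.DecompositionSpace B₀ W),
        IsMinimalCutSet S → S.encard = 2 ].TFAE := by
  tfae_have 1 → 2 := fun h =>
    (LinePattern.exists_forall_not_isCutVertex B₀ hWfin hW).imp h
  tfae_have 2 → 3 := fun ⟨B, hB⟩ => by
    obtain ⟨e⟩ := LinePattern.nonempty_homeomorph B₀ B W
    obtain ⟨f⟩ := LinePattern.nonempty_homeomorph_circle hn hW hB
    exact ⟨e.trans f⟩
  tfae_have 3 → 4 := fun ⟨e⟩ =>
    encard_eq_two_of_homeomorph (e.trans (AddCircle.homeomorphCircle one_ne_zero).symm)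
      AddCircle.encard_of_isMinimalCutSet
  tfae_have 4 → 1 := fun h B hB => by
    obtain ⟨e⟩ := LinePattern.nonempty_homeomorph B B₀ W
    have h4 := encard_eq_two_of_homeomorph e h
    have h1 : 1 ∉ B.repr '' W := by
      rintro ⟨w, hw, hw1⟩
      rw [map_eq_one_iff _ B.repr.injective] at hw1
      exact hW (hw1 ▸ hw)
    exact LinePattern.isCircle_of_encard_cross hn h1 hWfin
      (LinePattern.reflTransGen_wadj h1 h4) (LinePattern.encard_cross hn h1 hWfin h4 hB)
  tfae_finish
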